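/- Let $n\ge 3$, $p\in(0,n-2)$, $P\ge 2$, and set $a=a_{n,p}=2(n-2-p)$. Let $\lambda:S^{n-1}\to[0,\infty)$ be a continuous function whose positivity set $\Lambda=\{\lambda>0\}$ is non-empty, connected and has smooth boundary, and which vanishes linearly at $\partial\Lambda$ (that is, $\lambda$ is comparable on $\Lambda$ to a smooth boundary defining function; $\Lambda=S^{n-1}$, $\lambda\equiv1$ is allowed). Write $d\chi=\lambda^{2P}d\hat x$, $N^\lambda=\int_\Lambda d\chi$ and $\langle f\rangle=\frac1{N^\lambda}\int_\Lambda f\,d\chi$. Fields on $\Lambda$ are pairs $\xi=(\xi^\perp,\xi^\parallel)$ of a scalar field and a tangent vector field (regarded as an $\mathbb R^n$-valued field with components $\xi^\parallel_l$); $\nabla$ is the Levi-Civita connection of the unit sphere, $\nabla_l f$ is the $l$-th Cartesian component of the tangential gradient, and $\mathrm{Sym}(\nabla\xi^\parallel)$ is the symmetric part of $\nabla\xi^\parallel$. Let $H^1_{-P}(\Lambda)$ be the completion of the smooth fields on $\Lambda$ of finite norm $\big(\int_\Lambda(|\xi^\perp|^2+|\nabla\xi^\perp|^2+|\xi^\parallel|^2+|\nabla\xi^\parallel|^2)\,d\chi\big)^{1/2}$.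 For $\alpha\in\mathbb R$ let $B^{\lambda,\alpha}:H^1_{-P}(\Lambda)\to H^1_{-P}(\Lambda)'$ be the operator with components $$\begin{aligned} B^{\perp\perp}[\xi^\perp]&=(\alpha(a-\alpha)+n-1)\xi^\perp-\tfrac12\lambda^{-2P}\nabla\cdot(\lambda^{2P}\nabla\xi^\perp),\\ B^{\perp\parallel}[\xi^\parallel]&=\tfrac12(\alpha+1)\lambda^{-2P}\nabla\cdot(\lambda^{2P}\xi^\parallel)+\nabla\cdot\xi^\parallel,\\ B^{\parallel\perp}[\xi^\perp]&=\tfrac12(\alpha-a-1)\nabla\xi^\perp-\lambda^{-2P}\nabla(\lambda^{2P}\xi^\perp),\\ B^{\parallel\parallel}[\xi^\parallel]&=\tfrac12(\alpha(a-\alpha)+a+1)\xi^\parallel-\lambda^{-2P}\nabla\cdot(\lambda^{2P}\,\mathrm{Sym}(\nabla\xi^\parallel)), \end{aligned}$$ understood in the variational sense, i.e. (after formal integration by parts) $$\begin{aligned} \langle B^{\lambda,\alpha}[\xi],\rho\rangle=\Big\langle &(\alpha(a-\alpha)+n-1)\xi^\perp\rho^\perp+\tfrac12\nabla\xi^\perp\cdot\nabla\rho^\perp-\tfrac12(\alpha+1)\,\xi^\parallel\cdot\nabla\rho^\perp+\rho^\perp\,\nabla\cdot\xi^\parallel\\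 &+\tfrac12(\alpha-a-1)\,\rho^\parallel\cdot\nabla\xi^\perp+\xi^\perp\,\nabla\cdot\rho^\parallel+\tfrac12(\alpha(a-\alpha)+a+1)\,\xi^\parallel\cdot\rho^\parallel+\mathrm{Sym}(\nabla\xi^\parallel)\cdot\mathrm{Sym}(\nabla\rho^\parallel)\Big\rangle . \end{aligned}$$ Let $\ker B^{\lambda,\alpha}$ be its kernel, and let $\operatorname{coker}B^{\lambda,\alpha}$ be the kernel of the adjoint, i.e. the set of $\rho\in H^1_{-P}(\Lambda)$ with $\langle B^{\lambda,\alpha}[\xi],\rho\rangle=0$ for all $\xi\in H^1_{-P}(\Lambda)$. For $l=1,\dots,n$ put $$L^\alpha_l(\xi)=\big\langle-\nabla_l\xi^\perp+2\alpha\,\hat x_l\,\xi^\perp\big\rangle+(\alpha+1)\langle\xi^\parallel_l\rangle .$$ Assume the harmonic stability condition for the momentum: for each $\alpha\in[a/2,a]$ there is $c>0$ such that $$\langle B^{\lambda,\alpha}[\xi],\xi\rangle\ \ge\ c\int_\Lambda\big(|\xi^\perp|^2+|\nabla\xi^\perp|^2+|\xi^\parallel|^2+|\mathrm{Sym}(\nabla\xi^\parallel)|^2\big)\,d\chi$$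 for all $\xi\in H^1_{-P}(\Lambda)$ with $L^\alpha_l(\xi)=0$ for $l=1,\dots,n$. Then: 1. For every $\alpha\in[a/2,a)$ the operator $B^{\lambda,\alpha}:H^1_{-P}(\Lambda)\to H^1_{-P}(\Lambda)'$ is bijective, and $\ker B^{\lambda,\alpha}=\operatorname{coker}B^{\lambda,\alpha}=0$. 2. For $\alpha=a$, the kernel and the co-kernel of $B^{\lambda}=B^{\lambda,a}$ are both $n$-dimensional; the fields $\xi^{\star(l)}=(\hat x_l,\nabla\hat x_l)$, $1\le l\le n$, belong to $H^1_{-P}(\Lambda)$, and $\operatorname{coker}B^\lambda=\mathrm{Span}\{\xi^{\star(l)}\}_{1\le l\le n}$. 3. There is exactly one family $\xi^{\mathrm{norm}(1)},\dots,\xi^{\mathrm{norm}(n)}\in\ker B^\lambda$ such that $L^a_l(\xi^{\mathrm{norm}(j)})=\eta^\lambda\,\delta_{jl}$ for all $j,l$, where $\eta^\lambda=2(n-1)|S^{n-1}|/N^\lambda$; it is linearly independent and $\ker B^\lambda=\mathrm{Span}\{\xi^{\mathrm{norm}(l)}\}_{1\le l\le n}$. -/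

import Mathlib

open MeasureTheory Set Metric
open scoped ContDiff ENNReal

noncomputable section

namespace HarmonicMomentum

/-- Euclidean space `ℝⁿ`. -/
abbrev Eucl (n : ℕ) : Type := EuclideanSpace ℝ (Fin n)

/-- The unit sphere `S^{n-1} ⊂ ℝⁿ`. -/
abbrev Sph (n : ℕ) : Type := sphere (0 : Eucl n) 1

/-! ### Localization functions and the weighted measure -/

/-- The domain `Λ ⊂ S^{n-1}` where the localization function is positive. -/
def domain {n : ℕ} (lam : Sph n → ℝ) : Set (Sph n) := {x | 0 < lam x}

/-- The orthogonal projection of `v` onto the tangent space `x^⊥` of the sphere at `x`. -/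
def tanProj {n : ℕ} (x v : Eucl n) : Eucl n := v - inner ℝ x v • x

/-- `lam` is a localization function on the sphere: it is continuous, nonnegative, its positivity
set `Λ` is nonempty and connected, `Λ` has smooth boundary, and `lam` vanishes linearly at the
boundary. The last two conditions are expressed through a smooth defining function `ρ`
(positive exactly on `Λ`, with non-zero tangential gradient at its zeros on the sphere), to which
`lam` is comparable on `Λ`. The whole sphere with `lam = 1` is allowed. -/
structure IsLocalizationFunction {n : ℕ} (lam : Sph n → ℝ) : Prop where
  continuous : Continuous lam
  nonneg : ∀ x, 0 ≤ lam x
  connected : IsConnected (domain lam)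
  linear_vanishing : ∃ ρ : Eucl n → ℝ, ContDiff ℝ ∞ ρ ∧
    (∀ x : Sph n, 0 < ρ x ↔ x ∈ domain lam) ∧
    (∀ x : Sph n, ρ x = 0 → ∃ v : Eucl n, fderiv ℝ ρ x (tanProj x v) ≠ 0) ∧
    ∃ c C : ℝ, 0 < c ∧ 0 < C ∧ ∀ x ∈ domain lam, c * ρ x ≤ lam x ∧ lam x ≤ C * ρ x

/-- The weighted measure `dχ = λ^{2P} dx̂` on the unit sphere. -/
def chi {n : ℕ} (lam : Sph n → ℝ) (P : ℝ) : Measure (Sph n) :=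
  (volume : Measure (Eucl n)).toSphere.withDensity fun x => ENNReal.ofReal (lam x ^ (2 * P))

/-! ### First-order jets of fields `ξ = (ξ^⊥, ξ^∥)` -/

/-- Values `(ξ^⊥, ∇ξ^⊥, ξ^∥, ∇ξ^∥)` at one point of the sphere of a field and its tangential
derivatives, in ambient Cartesian components. -/
abbrev Jet (n : ℕ) : Type := EuclideanSpace ℝ (Unit ⊕ Fin n ⊕ Fin n ⊕ (Fin n × Fin n))

/-- The component `ξ^⊥`. -/
def perp {n : ℕ} (u : Jet n) : ℝ := u (Sum.inl ())

/-- The component `∇_i ξ^⊥`. -/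
def dperp {n : ℕ} (u : Jet n) (i : Fin n) : ℝ := u (Sum.inr (Sum.inl i))

/-- The component `ξ^∥_i`. -/
def par {n : ℕ} (u : Jet n) (i : Fin n) : ℝ := u (Sum.inr (Sum.inr (Sum.inl i)))

/-- The component `∇_k ξ^∥_i` of the covariant derivative. -/
def dpar {n : ℕ} (u : Jet n) (i k : Fin n) : ℝ := u (Sum.inr (Sum.inr (Sum.inr (i, k))))

/-- The component `Sym(∇ξ^∥)_{ik}`. -/
def symPar {n : ℕ} (u : Jet n) (i k : Fin n) : ℝ := (dpar u i k + dpar u k i) / 2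

/-- The divergence `∇ · ξ^∥`. -/
def divPar {n : ℕ} (u : Jet n) : ℝ := ∑ i, dpar u i i

/-- The standard basis vector `e_i` of `ℝⁿ`. -/
def stdVec {n : ℕ} (i : Fin n) : Eucl n := EuclideanSpace.single i 1

/-- The tangential gradient on the unit sphere of a function given in ambient space. -/
def tanGrad {n : ℕ} (f : Eucl n → ℝ) (x : Eucl n) : Eucl n :=
  WithLp.toLp 2 fun i => fderiv ℝ f x (tanProj x (stdVec i))

/-- The jet on the unit sphere of a scalar field `f` and of a tangent vector field `X`. The
covariant derivative of the sphere is the tangential part of the ambient derivative. -/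
def jet {n : ℕ} (f : Eucl n → ℝ) (X : Eucl n → Eucl n) (x : Sph n) : Jet n :=
  WithLp.toLp 2 (Sum.elim (fun _ => f x) (Sum.elim (fun i => tanGrad f x i)
    (Sum.elim (fun i => X x i)
      (fun q => inner ℝ (tanProj x (stdVec q.1)) (fderiv ℝ X x (tanProj x (stdVec q.2)))))))

/-! ### The weighted Sobolev space `H¹_{-P}(Λ)` -/

/-- The open cone over `Λ`. -/
def coneOver {n : ℕ} (lam : Sph n → ℝ) : Set (Eucl n) :=
  {y | ∃ x ∈ domain lam, ∃ r : ℝ, 0 < r ∧ y = r • (x : Eucl n)}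

/-- `(f, X)` restricts to a smooth scalar field and a smooth tangent vector field on `Λ`. -/
structure IsSmoothField {n : ℕ} (lam : Sph n → ℝ) (f : Eucl n → ℝ) (X : Eucl n → Eucl n) :
    Prop where
  smooth_perp : ContDiffOn ℝ ∞ f (coneOver lam)
  smooth_par : ContDiffOn ℝ ∞ X (coneOver lam)
  tangent : ∀ x ∈ domain lam, inner ℝ (x : Eucl n) (X x) = 0

/-- The weighted Sobolev space `H¹_{-P}(Λ)` of fields `ξ = (ξ^⊥, ξ^∥)`: the completion of the
smooth fields on `Λ` of finite norm
`‖ξ‖² = ∫ (|ξ^⊥|² + |∇ξ^⊥|² + |ξ^∥|² + |∇ξ^∥|²) dχ`, each field being identified with its jet. -/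
def H1 {n : ℕ} (lam : Sph n → ℝ) (P : ℝ) : Submodule ℝ (Lp (Jet n) 2 (chi lam P)) :=
  (Submodule.span ℝ {u : Lp (Jet n) 2 (chi lam P) | ∃ f X, IsSmoothField lam f X ∧
    ∀ᵐ x ∂(chi lam P), u x = jet f X x}).topologicalClosure

/-! ### The momentum form and the operators `B^{λ,α}` -/

/-- Density of `ρ^⊥ B^{⊥⊥,α}[ξ^⊥]` after integration by parts against `dχ`. -/
def densPerpPerp {n : ℕ} (a α : ℝ) (u v : Jet n) : ℝ :=
  (α * (a - α) + (n - 1)) * perp u * perp v + 1 / 2 * ∑ i, dperp u i * dperp v i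

/-- Density of `ρ^⊥ B^{⊥∥,α}[ξ^∥]` after integration by parts against `dχ`. -/
def densPerpPar {n : ℕ} (α : ℝ) (u v : Jet n) : ℝ :=
  -(1 / 2) * (α + 1) * ∑ i, par u i * dperp v i + divPar u * perp v

/-- Density of `ρ^∥ · B^{∥⊥,α}[ξ^⊥]` after integration by parts against `dχ`. -/
def densParPerp {n : ℕ} (a α : ℝ) (u v : Jet n) : ℝ :=
  1 / 2 * (α - a - 1) * ∑ i, dperp u i * par v i + perp u * divPar v

/-- Density of `ρ^∥ · B^{∥∥,α}[ξ^∥]` after integration by parts against `dχ`. -/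
def densParPar {n : ℕ} (a α : ℝ) (u v : Jet n) : ℝ :=
  1 / 2 * (α * (a - α) + a + 1) * ∑ i, par u i * par v i + ∑ i, ∑ k, symPar u i k * symPar v i k

/-- Density of `ρ · B^{λ,α}[ξ]` after integration by parts against `dχ`. -/
def dens {n : ℕ} (a α : ℝ) (u v : Jet n) : ℝ :=
  densPerpPerp a α u v + densPerpPar α u v + densParPerp a α u v + densParPar a α u v

theorem dens_symm {n : ℕ} (a α : ℝ) (u v : Jet n) : dens a α u v = dens a (a - α) v u := by
  have h1 : ∑ i, dperp u i * dperp v i = ∑ i, dperp v i * dperp u i :=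
    Finset.sum_congr rfl fun i _ => mul_comm _ _
  have h2 : ∑ i, par u i * par v i = ∑ i, par v i * par u i :=
    Finset.sum_congr rfl fun i _ => mul_comm _ _
  have h3 : ∑ i, par u i * dperp v i = ∑ i, dperp v i * par u i :=
    Finset.sum_congr rfl fun i _ => mul_comm _ _
  have h4 : ∑ i, dperp u i * par v i = ∑ i, par v i * dperp u i :=
    Finset.sum_congr rfl fun i _ => mul_comm _ _
  have h5 : ∑ i, ∑ k, symPar u i k * symPar v i k = ∑ i, ∑ k, symPar v i k * symPar u i k :=
    Finset.sum_congr rfl fun i _ => Finset.sum_congr rfl fun k _ => mul_comm _ _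
  simp only [dens, densPerpPerp, densPerpPar, densParPerp, densParPar, h1, h2, h3, h4, h5]
  ring

/-- On the diagonal the density is the integrand of the momentum quadratic functional. -/
theorem dens_self {n : ℕ} (a α : ℝ) (u : Jet n) :
    dens a α u u = (n - 1 + α * (a - α)) * perp u ^ 2 + 1 / 2 * ∑ i, dperp u i ^ 2
      - 1 / 2 * (a + 2) * ∑ i, par u i * dperp u i + 2 * perp u * divPar u
      + 1 / 2 * (a + 1 + α * (a - α)) * ∑ i, par u i ^ 2 + ∑ i, ∑ k, symPar u i k ^ 2 := by
  have h : ∑ i, dperp u i * par u i = ∑ i, par u i * dperp u i :=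
    Finset.sum_congr rfl fun i _ => mul_comm _ _
  simp only [dens, densPerpPerp, densPerpPar, densParPerp, densParPar, pow_two, h]
  ring

theorem dens_add {n : ℕ} (a α : ℝ) (u u' v : Jet n) :
    dens a α (u + u') v = dens a α u v + dens a α u' v := by
  have hs : ∀ i k, symPar (u + u') i k = symPar u i k + symPar u' i k := by
    intro i k; simp only [symPar, dpar, PiLp.add_apply]; ring
  have hd : divPar (u + u') = divPar u + divPar u' := by
    simp only [divPar, dpar, PiLp.add_apply, Finset.sum_add_distrib]
  simp only [dens, densPerpPerp, densPerpPar, densParPerp, densParPar, hs, hd, perp, dperp, par,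
    PiLp.add_apply, add_mul, Finset.sum_add_distrib]
  ring

theorem dens_smul {n : ℕ} (a α : ℝ) (c : ℝ) (u v : Jet n) :
    dens a α (c • u) v = c * dens a α u v := by
  have hs : ∀ i k, symPar (c • u) i k = c * symPar u i k := by
    intro i k; simp only [symPar, dpar, PiLp.smul_apply, smul_eq_mul]; ring
  have hd : divPar (c • u) = c * divPar u := by
    simp only [divPar, dpar, PiLp.smul_apply, smul_eq_mul, Finset.mul_sum]
  simp only [dens, densPerpPerp, densPerpPar, densParPerp, densParPar, hs, hd, perp, dperp, par,
    PiLp.smul_apply, smul_eq_mul, mul_assoc, ← Finset.mul_sum]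
  ring

/-- The density as a continuous bilinear form on jets. -/
def densBilin {n : ℕ} (a α : ℝ) : Jet n →L[ℝ] Jet n →L[ℝ] ℝ :=
  LinearMap.toContinuousLinearMap
    ((LinearMap.toContinuousLinearMap : (Jet n →ₗ[ℝ] ℝ) ≃ₗ[ℝ] (Jet n →L[ℝ] ℝ)).toLinearMap ∘ₗ
      LinearMap.mk₂ ℝ (dens a α) (dens_add a α) (dens_smul a α)
        (fun u v v' => by
          rw [dens_symm, dens_add, ← dens_symm a α u v, ← dens_symm a α u v'])
        (fun c u v => by
          rw [dens_symm, dens_smul, ← dens_symm a α u v]; rfl))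

/-- The operator `B^{λ,α} : H¹_{-P}(Λ) → H¹_{-P}(Λ)'`, in its variational form:
`⟨B^{λ,α}[ξ], ρ⟩` is the `dχ`-average over `Λ` of the density of `ρ · B^{λ,α}[ξ]`. -/
def momentumOp {n : ℕ} (lam : Sph n → ℝ) (P a α : ℝ) :
    H1 lam P →L[ℝ] (H1 lam P →L[ℝ] ℝ) :=
  ((chi lam P).real univ)⁻¹ •
    ((densBilin a α).lpPairing (chi lam P) 2 2).bilinearComp
      (H1 lam P).subtypeL (H1 lam P).subtypeL

theorem momentumOp_apply {n : ℕ} (lam : Sph n → ℝ) (P a α : ℝ) (ξ ρ : H1 lam P) :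
    momentumOp lam P a α ξ ρ = ⨍ x, dens a α (ξ.1 x) (ρ.1 x) ∂(chi lam P) := by
  simp only [momentumOp, average_eq, smul_eq_mul]
  change _ * (densBilin a α).lpPairing (chi lam P) 2 2 ξ.1 ρ.1 = _
  rw [ContinuousLinearMap.lpPairing_eq_integral]
  rfl

/-- The kernel of `B^{λ,α}`. -/
def ker {n : ℕ} (lam : Sph n → ℝ) (P a α : ℝ) : Submodule ℝ (H1 lam P) :=
  LinearMap.ker (momentumOp lam P a α).toLinearMap

/-- The co-kernel of `B^{λ,α}`, that is, the kernel of the adjoint operator. -/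
def coker {n : ℕ} (lam : Sph n → ℝ) (P a α : ℝ) : Submodule ℝ (H1 lam P) :=
  LinearMap.ker (momentumOp lam P a α).flip.toLinearMap

/-! ### Averages and the stability condition -/

/-- The vector of averages
`⟨-∇_l ξ^⊥ + 2 α x̂_l ξ^⊥⟩ + (α + 1) ⟨ξ^∥_l⟩`, for `l = 1, …, n`. -/
def moment {n : ℕ} (lam : Sph n → ℝ) (P α : ℝ) (ξ : H1 lam P) (l : Fin n) : ℝ :=
  (⨍ x, (-dperp (ξ.1 x) l + 2 * α * (x : Eucl n) l * perp (ξ.1 x)) ∂(chi lam P))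
    + (α + 1) * ⨍ x, par (ξ.1 x) l ∂(chi lam P)

/-- `‖ξ^⊥‖²_{H¹_{-P}} + ‖ξ^∥‖²_{L²_{-P}} + ‖Sym(∇ξ^∥)‖²_{L²_{-P}}`. -/
def symEnergy {n : ℕ} (lam : Sph n → ℝ) (P : ℝ) (ξ : H1 lam P) : ℝ :=
  (∫ x, (perp (ξ.1 x) ^ 2 + ∑ i, dperp (ξ.1 x) i ^ 2) ∂(chi lam P))
    + (∫ x, ∑ i, par (ξ.1 x) i ^ 2 ∂(chi lam P))
    + ∫ x, ∑ i, ∑ k, symPar (ξ.1 x) i k ^ 2 ∂(chi lam P)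

/-- The harmonic stability condition for the momentum operator. -/
def HarmonicStability {n : ℕ} (lam : Sph n → ℝ) (P a : ℝ) : Prop :=
  ∀ α ∈ Icc (a / 2) a, ∃ c : ℝ, 0 < c ∧ ∀ ξ : H1 lam P, (∀ l, moment lam P α ξ l = 0) →
    c * symEnergy lam P ξ ≤ momentumOp lam P a α ξ ξ

/-- The harmonic exponent `a_{n,p} = 2 (n - 2 - p)`. -/
def harmonicExponent (n : ℕ) (p : ℝ) : ℝ := 2 * (n - 2 - p)

/-- The constant `η^λ = 2 (n - 1) |S^{n-1}| / ∫_Λ dχ`. -/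
def eta {n : ℕ} (lam : Sph n → ℝ) (P : ℝ) : ℝ :=
  2 * (n - 1) * (volume : Measure (Eucl n)).toSphere.real univ / (chi lam P).real univ

/-- `ξ` is the field `ξ^{⋆(l)} = (x̂_l, ∇x̂_l)`. -/
def IsXiStar {n : ℕ} {lam : Sph n → ℝ} {P : ℝ} (l : Fin n) (ξ : H1 lam P) : Prop :=
  ∀ᵐ x ∂(chi lam P), ξ.1 x = jet (fun y => y l) (tanGrad fun y => y l) x

/-- `ξ` is a family of normalized elements `ξ^{norm (j)}` of the kernel of `B^λ = B^{λ,a}`. -/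
def IsNormalizedFamily {n : ℕ} {lam : Sph n → ℝ} {P : ℝ} (a : ℝ) (ξ : Fin n → H1 lam P) : Prop :=
  ∀ j, ξ j ∈ ker lam P a a ∧ ∀ l, moment lam P a (ξ j) l = if j = l then eta lam P else 0

end HarmonicMomentum

end

open HarmonicMomentum

/-! The theorem rests on one algebraic identity: ⟨B^α[ξ], ξ⋆(l)⟩ = ½(a − α) L^α_l(ξ) for every ξ
(`momentumOp_xiStar`). It holds already for the densities, without integration by parts, because
Hess x̂_l = −x̂_l g on the sphere (`dens_starJet`). Moreover L^α_l(ξ⋆(k)) = α⟨δ_kl + x̂_k x̂_l⟩ is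
positive definite for α > 0 (`moment_xiStar_posDef`). Hence H¹ splits as V ⊕ Span ξ⋆ with V = ⋂ ker
L^α_l: on V the stability condition gives coercivity, and against ξ⋆ the value of B^α[ξ] is dictated
by the moments of ξ.

Lax–Milgram on V therefore solves B^α[ξ] = φ with prescribed moments m as soon as φ(ξ⋆(l)) = ½(a −
α) m_l (`exists_solution`). For α < a this relation determines m from φ, whence bijectivity. For α =
a the ξ⋆ lie in the cokernel, and coercivity shows that they exhaust it; with φ = 0 the relation is
empty, so every moment vector is realized by exactly one kernel element. The adjoint form
corresponds to a − α rather than α, which is why kernel and cokernel are described separately.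

The analytic difficulty is that stability controls only Sym(∇ξ∥), while Lax–Milgram needs the full
H¹ norm. The gap is filled by a Korn inequality for the degenerate weight λ^{2P}. Tangent fields are
extended one-homogeneously, so that the symmetric gradient on the sphere becomes the Euclidean one
(`dpar_jet`). For a zero-homogeneous defining function σ and q = 2P, two applications of the
divergence theorem with weights (σ − ε)₊^p are combined. A Hardy identity with p = q − 1 bounds ∫ (σ
− ε)₊^{q−2}|u|² by the symmetric energy, since |∇σ|² + σ² is bounded below
(`integral_hardy_identity`). A Korn identity with p = q exploits tr A² = 2|Sym A|² − |A|²
(`integral_korn_identity`). The truncation removes any need for regularity of u at ∂Λ; the constants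
do not depend on ε, and ε → 0 gives `exists_korn_weighted`. -/

namespace HarmonicMomentum

open Filter Topology

/-- The surface measure of the unit sphere. -/
noncomputable abbrev surf (n : ℕ) : Measure (Sph n) := (volume : Measure (Eucl n)).toSphere

/-! ### Polar coordinates and the divergence theorem on the sphere. -/

theorem integral_radial_mul_angular {n : ℕ} (hn : 1 ≤ n) (g : ℝ → ℝ) (f : Eucl n → ℝ) :
    ∫ x : Eucl n, g ‖x‖ * f (‖x‖⁻¹ • x) =
      (∫ θ : Sph n, f θ ∂(surf n)) * ∫ r : Ioi (0 : ℝ), g r ∂(Measure.volumeIoiPow (n - 1)) := by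
  have : Nonempty (Fin n) := ⟨⟨0, hn⟩⟩
  have hdim : Module.finrank ℝ (Eucl n) = n := by simp
  have h1 : ∫ x : Eucl n, g ‖x‖ * f (‖x‖⁻¹ • x) =
      ∫ x : ({(0)}ᶜ : Set (Eucl n)), g ‖x.1‖ * f (‖x.1‖⁻¹ • x.1)
        ∂((volume : Measure (Eucl n)).comap (↑)) := by
    rw [integral_subtype_comap (measurableSet_singleton _).compl
      fun x : Eucl n => g ‖x‖ * f (‖x‖⁻¹ • x), restrict_compl_singleton]
  rw [h1]
  have h2 := (volume : Measure (Eucl n)).measurePreserving_homeomorphUnitSphereProd.integral_comp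
    (Homeomorph.measurableEmbedding _) (fun z : Sph n × Ioi (0 : ℝ) => f z.1 * g z.2)
  rw [integral_prod_mul (fun θ : Sph n => f θ) (fun r : Ioi (0 : ℝ) => g r), hdim] at h2
  rw [← h2]
  refine integral_congr_ae (Eventually.of_forall fun x => ?_)
  simp [mul_comm]

/-- Used with c = r for one-homogeneous functions and with c = 1 for zero-homogeneous ones. -/
theorem fderiv_eq_of_homogeneous {n : ℕ} {f : Eucl n → ℝ} {r c : ℝ} {x : Eucl n}
    (h : ∀ᶠ y in 𝓝 x, f (r • y) = c * f y) (hf : DifferentiableAt ℝ f x) (v : Eucl n) :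
    r * fderiv ℝ f (r • x) v = c * fderiv ℝ f x v := by
  have h1 : fderiv ℝ (fun y => f (r • y)) x = fderiv ℝ (fun y => c * f y) x :=
    Filter.EventuallyEq.fderiv_eq h
  rw [fderiv_comp_smul, fderiv_const_mul hf] at h1
  simpa using congrArg (fun L => L v) h1

/-- A smooth radial profile supported in the annulus `1 ≤ |x| ≤ 3`. -/
noncomputable def radialBump : ContDiffBump (2 : ℝ) := ⟨1 / 2, 1, by norm_num, by norm_num⟩

theorem radialBump_eq_zero {r : ℝ} (hr : r ≤ 1) : radialBump r = 0 :=
  radialBump.zero_of_le_dist (by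
    rw [Real.dist_eq, abs_of_nonpos (by linarith)]; simp only [radialBump]; linarith)

theorem radialBump_eq_zero_of_ge {r : ℝ} (hr : 3 ≤ r) : radialBump r = 0 :=
  radialBump.zero_of_le_dist (by
    rw [Real.dist_eq, abs_of_nonneg (by linarith)]; simp only [radialBump]; linarith)

theorem radialBump_norm_eventually_zero {n : ℕ} :
    ∀ᶠ y : Eucl n in 𝓝 0, radialBump ‖y‖ = 0 := by
  filter_upwards [ball_mem_nhds (0 : Eucl n) one_pos] with y hy
  exact radialBump_eq_zero (by simpa using (mem_ball_zero_iff.1 hy).le)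

theorem contDiff_radialBump_norm_mul {n : ℕ} {f : Eucl n → ℝ}
    (hf : ∀ x ≠ 0, ContDiffAt ℝ 1 f x) : ContDiff ℝ 1 fun x => radialBump ‖x‖ * f x := by
  rw [contDiff_iff_contDiffAt]
  intro x
  by_cases hx : x = 0
  · subst hx
    refine (contDiffAt_const (c := (0 : ℝ))).congr_of_eventuallyEq ?_
    filter_upwards [radialBump_norm_eventually_zero] with y hy
    simp [hy]
  · exact (radialBump.contDiff.contDiffAt.comp x (contDiffAt_norm ℝ hx)).mul (hf x hx)

theorem hasCompactSupport_radialBump_norm_mul {n : ℕ} (f : Eucl n → ℝ) :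
    HasCompactSupport fun x => radialBump ‖x‖ * f x := by
  refine HasCompactSupport.intro (isCompact_closedBall (0 : Eucl n) 3) fun x hx => ?_
  rw [radialBump_eq_zero_of_ge, zero_mul]
  simpa using (not_le.1 (by simpa using hx)).le

theorem integral_fderiv_eq_zero_of_hasCompactSupport {n : ℕ} {f : Eucl n → ℝ}
    (hf : ContDiff ℝ 1 f) (hc : HasCompactSupport f) (v : Eucl n) :
    ∫ x, fderiv ℝ f x v = 0 := by
  have h := integral_mul_fderiv_eq_neg_fderiv_mul_of_integrable (μ := (volume : Measure (Eucl n)))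
    (f := fun _ => (1 : ℝ)) (g := f) (v := v) (by simp)
    (by
      simp only [one_mul]
      exact ((hf.continuous_fderiv one_ne_zero).clm_apply continuous_const).integrable_of_hasCompactSupport
        (hc.fderiv_apply (𝕜 := ℝ) v))
    (by simpa using hf.continuous.integrable_of_hasCompactSupport hc)
    (fun x _ => differentiableAt_const _) (fun x _ => hf.differentiable one_ne_zero x)
  simpa using h

theorem fderiv_radialBump_norm_mul {n : ℕ} {f : Eucl n → ℝ} {x : Eucl n} (hx : x ≠ 0)
    (hf : DifferentiableAt ℝ f x) (i : Fin n) :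
    fderiv ℝ (fun x => radialBump ‖x‖ * f x) x (stdVec i) =
      deriv radialBump ‖x‖ * (‖x‖⁻¹ * x i * f x) +
        radialBump ‖x‖ * fderiv ℝ f x (stdVec i) := by
  have h1 : HasFDerivAt (fun y : Eucl n => ‖y‖) (‖x‖⁻¹ • innerSL ℝ x) x := by
    have := (hasStrictFDerivAt_norm_sq x).hasFDerivAt.sqrt (by positivity)
    simp only [Real.sqrt_sq (norm_nonneg _)] at this
    have e : ‖x‖⁻¹ • innerSL ℝ x = (1 / (2 * ‖x‖)) • 2 • innerSL ℝ x := by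
      rw [← Nat.cast_smul_eq_nsmul ℝ, smul_smul]
      congr 1
      field_simp
      norm_num
    rw [e]
    exact this
  have h2 : HasDerivAt radialBump (deriv radialBump ‖x‖) ‖x‖ :=
    (radialBump.contDiff (n := 1)).differentiable one_ne_zero |>.differentiableAt.hasDerivAt
  have h3 := (h2.comp_hasFDerivAt x h1).mul hf.hasFDerivAt
  have h4 := h3.fderiv
  simp only [Function.comp_def] at h4
  change fderiv ℝ (fun x => radialBump ‖x‖ * f x) x = _ at h4
  rw [h4]
  simp [stdVec, EuclideanSpace.inner_single_right]
  ring

/-- The divergence theorem on the unit sphere for positively one-homogeneous vector fields. -/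
theorem integral_sphere_div {n : ℕ} (hn : 1 ≤ n) {V : Fin n → Eucl n → ℝ}
    (hV : ∀ i, ∀ x ≠ 0, ContDiffAt ℝ 1 (V i) x)
    (hh : ∀ i, ∀ r : ℝ, 0 < r → ∀ x, x ≠ 0 → V i (r • x) = r * V i x) :
    ∫ θ : Sph n, ∑ i, fderiv ℝ (V i) θ (stdVec i) ∂(surf n) =
      n * ∫ θ : Sph n, ∑ i, (θ : Eucl n) i * V i θ ∂(surf n) := by
  have : Nonempty (Fin n) := ⟨⟨0, hn⟩⟩
  set J : (ℝ → ℝ) → ℝ := fun g => ∫ r : Ioi (0 : ℝ), g r ∂(Measure.volumeIoiPow (n - 1)) with hJ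
  -- The divergence of χ(|x|) W integrates to zero over ℝⁿ. As W is one-homogeneous, both terms of
  -- this divergence are a radial factor times a function of x/|x|, so polar coordinates turn the
  -- identity into a relation between two sphere integrals.
  have key : ∀ W : Fin n → Eucl n → ℝ, (∀ i, ∀ x ≠ 0, ContDiffAt ℝ 1 (W i) x) →
      (∀ i, ∀ r : ℝ, 0 < r → ∀ x, x ≠ 0 → W i (r • x) = r * W i x) →
      (∫ θ : Sph n, ∑ i, (θ : Eucl n) i * W i θ ∂(surf n)) * J (fun r => deriv radialBump r * r) +
        (∫ θ : Sph n, ∑ i, fderiv ℝ (W i) θ (stdVec i) ∂(surf n)) * J radialBump = 0 := by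
    intro W hW hWh
    have hae : ∀ᵐ x : Eucl n, x ≠ 0 := by
      rw [ae_iff]; simp
    have hWd : ∀ i, ∀ x ≠ 0, DifferentiableAt ℝ (W i) x := fun i x hx =>
      (hW i x hx).differentiableAt one_ne_zero
    have e1 : ∫ x : Eucl n, ∑ i, fderiv ℝ (fun x => radialBump ‖x‖ * W i x) x (stdVec i) = 0 := by
      rw [integral_finsetSum]
      · exact Finset.sum_eq_zero fun i _ => integral_fderiv_eq_zero_of_hasCompactSupport
          (contDiff_radialBump_norm_mul (hW i)) (hasCompactSupport_radialBump_norm_mul _) _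
      · intro i _
        exact (((contDiff_radialBump_norm_mul (hW i)).continuous_fderiv one_ne_zero).clm_apply
          continuous_const).integrable_of_hasCompactSupport
            ((hasCompactSupport_radialBump_norm_mul _).fderiv_apply (𝕜 := ℝ) _)
    have e2 : ∀ x : Eucl n, x ≠ 0 → (deriv radialBump ‖x‖ * ‖x‖) *
        (fun y : Eucl n => ∑ i, y i * W i y) (‖x‖⁻¹ • x) =
          ∑ i, deriv radialBump ‖x‖ * (‖x‖⁻¹ * x i * W i x) := by
      intro x hx
      have hx' : 0 < ‖x‖ := norm_pos_iff.2 hx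
      simp only [Finset.mul_sum]
      refine Finset.sum_congr rfl fun i _ => ?_
      rw [hWh i _ (inv_pos.2 hx') x hx]
      simp
      field_simp
    have e3 : ∀ x : Eucl n, x ≠ 0 → radialBump ‖x‖ *
        (fun y : Eucl n => ∑ i, fderiv ℝ (W i) y (stdVec i)) (‖x‖⁻¹ • x) =
          ∑ i, radialBump ‖x‖ * fderiv ℝ (W i) x (stdVec i) := by
      intro x hx
      have hx' : 0 < ‖x‖⁻¹ := inv_pos.2 (norm_pos_iff.2 hx)
      simp only [Finset.mul_sum]
      refine Finset.sum_congr rfl fun i _ => ?_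
      have := fderiv_eq_of_homogeneous (f := W i) (r := ‖x‖⁻¹) (c := ‖x‖⁻¹) (x := x)
        ((isOpen_ne.eventually_mem hx).mono fun y hy => hWh i _ hx' y hy) (hWd i x hx) (stdVec i)
      rw [mul_left_cancel₀ hx'.ne' this]
    have hint1 : Integrable (fun x : Eucl n =>
        ∑ i, radialBump ‖x‖ * fderiv ℝ (W i) x (stdVec i)) := by
      refine integrable_finsetSum _ fun i _ => ?_
      refine Continuous.integrable_of_hasCompactSupport ?_
        (hasCompactSupport_radialBump_norm_mul _)
      rw [continuous_iff_continuousAt]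
      intro x
      by_cases hx : x = 0
      · subst hx
        refine (continuousAt_const (y := (0 : ℝ))).congr ?_
        filter_upwards [radialBump_norm_eventually_zero] with y hy
        simp [hy]
      · refine (radialBump.continuous.comp continuous_norm).continuousAt.mul ?_
        exact ((hW i x hx).continuousAt_fderiv one_ne_zero).clm_apply continuousAt_const
    have hint2 : Integrable (fun x : Eucl n =>
        ∑ i, fderiv ℝ (fun x => radialBump ‖x‖ * W i x) x (stdVec i)) := by
      refine integrable_finsetSum _ fun i _ => ?_
      exact (((contDiff_radialBump_norm_mul (hW i)).continuous_fderiv one_ne_zero).clm_apply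
          continuous_const).integrable_of_hasCompactSupport
            ((hasCompactSupport_radialBump_norm_mul _).fderiv_apply (𝕜 := ℝ) _)
    have e4 : ∀ x : Eucl n, x ≠ 0 → ∑ i, deriv radialBump ‖x‖ * (‖x‖⁻¹ * x i * W i x) =
        (∑ i, fderiv ℝ (fun x => radialBump ‖x‖ * W i x) x (stdVec i)) -
          ∑ i, radialBump ‖x‖ * fderiv ℝ (W i) x (stdVec i) := by
      intro x hx
      rw [← Finset.sum_sub_distrib]
      refine Finset.sum_congr rfl fun i _ => ?_
      rw [fderiv_radialBump_norm_mul hx (hWd i x hx)]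
      ring
    have f1 := integral_radial_mul_angular hn (fun r => deriv radialBump r * r)
      (fun y : Eucl n => ∑ i, y i * W i y)
    have f2 := integral_radial_mul_angular hn radialBump
      (fun y : Eucl n => ∑ i, fderiv ℝ (W i) y (stdVec i))
    rw [← f1, ← f2, integral_congr_ae (hae.mono e3),
      integral_congr_ae (hae.mono fun x hx => (e2 x hx).trans (e4 x hx)),
      integral_sub hint2 hint1, e1]
    ring
  have hJpos : J radialBump ≠ 0 := by
    intro h0
    have f := integral_radial_mul_angular hn radialBump (fun _ : Eucl n => (1 : ℝ))
    simp only [hJ] at h0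
    rw [h0, mul_zero] at f
    have hc : HasCompactSupport fun x : Eucl n => radialBump ‖x‖ * 1 :=
      hasCompactSupport_radialBump_norm_mul fun _ => 1
    have := Continuous.integral_pos_of_hasCompactSupport_nonneg_nonzero
      (μ := (volume : Measure (Eucl n))) (x := (2 : ℝ) • stdVec ⟨0, hn⟩)
      (contDiff_radialBump_norm_mul (n := n) (f := fun _ => 1)
        fun _ _ => contDiffAt_const).continuous hc
      (fun x => by simpa using radialBump.nonneg)
      (by
        have : ‖(2 : ℝ) • (stdVec ⟨0, hn⟩ : Eucl n)‖ = 2 := by simp [norm_smul, stdVec]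
        rw [this, mul_one]
        exact (radialBump.pos_of_mem_ball (by
          simp [radialBump])).ne')
    linarith
  have k1 := key V hV hh
  -- The position field, with divergence n and normal component 1, determines the ratio of the two
  -- radial integrals to be −n; no radial integration by parts is needed.
  have k2 := key (fun i y => y i) (fun i x _ => by fun_prop) (fun i r _ x _ => by simp)
  have hd : ∀ i : Fin n, ∀ θ : Eucl n, fderiv ℝ (fun y : Eucl n => y i) θ (stdVec i) = 1 := by
    intro i θ
    have : HasFDerivAt (fun y : Eucl n => y i) (EuclideanSpace.proj (𝕜 := ℝ) i) θ :=
      (EuclideanSpace.proj (𝕜 := ℝ) i).hasFDerivAt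
    rw [this.fderiv]; simp [stdVec]
  have hs : ∀ θ : Sph n, ∑ i, (θ : Eucl n) i * (θ : Eucl n) i = 1 := by
    intro θ
    have h1 : ‖(θ : Eucl n)‖ ^ 2 = 1 := by simp
    rw [EuclideanSpace.real_norm_sq_eq] at h1
    simpa [pow_two] using h1
  simp only [hd, hs] at k2
  have hS : (surf n).real univ ≠ 0 := by
    rw [Ne, measureReal_eq_zero_iff, Measure.measure_univ_eq_zero]
    exact Measure.toSphere_ne_zero (volume : Measure (Eucl n))
  simp only [integral_const, smul_eq_mul, Finset.sum_const, Finset.card_univ, Fintype.card_fin,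
    nsmul_eq_mul, mul_one] at k2
  have k3 : J (fun r => deriv radialBump r * r) = -(n * J radialBump) := by
    have : (surf n).real univ * (J (fun r => deriv radialBump r * r) + n * J radialBump) = 0 := by
      linarith
    rcases mul_eq_zero.1 this with h | h
    · exact absurd h hS
    · linarith
  rw [k3] at k1
  apply mul_right_cancel₀ hJpos
  linarith

/-! ### Truncated powers -/

/-- The truncated power `t₊ ^ p`. -/
noncomputable def posPow (p t : ℝ) : ℝ := max t 0 ^ p

theorem posPow_of_nonpos {p t : ℝ} (hp : 0 < p) (ht : t ≤ 0) : posPow p t = 0 := by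
  rw [posPow, max_eq_right ht, Real.zero_rpow hp.ne']

theorem posPow_nonneg (p t : ℝ) : 0 ≤ posPow p t := Real.rpow_nonneg (le_max_right _ _) _

theorem continuous_posPow {p : ℝ} (hp : 0 < p) : Continuous (posPow p) :=
  (continuous_id.max continuous_const).rpow_const fun _ => Or.inr hp.le

theorem posPow_add_one {p : ℝ} (hp : 0 < p) (t : ℝ) :
    posPow (p + 1) t = posPow p t * max t 0 := by
  rcases le_or_gt t 0 with h | h
  · rw [posPow_of_nonpos (by linarith) h, posPow_of_nonpos hp h, zero_mul]
  · rw [posPow, posPow, max_eq_left h.le, Real.rpow_add_one h.ne']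

/-- Since p > 1, both one-sided derivatives at 0 vanish, so the truncated power is differentiable
across the edge of its support. -/
theorem hasDerivAt_posPow {p : ℝ} (hp : 1 < p) (t : ℝ) :
    HasDerivAt (posPow p) (p * posPow (p - 1) t) t := by
  rcases lt_trichotomy t 0 with h | h | h
  · rw [posPow_of_nonpos (by linarith) h.le, mul_zero]
    refine (hasDerivAt_const t (0 : ℝ)).congr_of_eventuallyEq ?_
    filter_upwards [gt_mem_nhds h] with y hy using posPow_of_nonpos (by linarith) hy.le
  · subst h
    rw [posPow_of_nonpos (by linarith) le_rfl, mul_zero]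
    have h1 : HasDerivWithinAt (posPow p) 0 (Iic 0) 0 :=
      (hasDerivWithinAt_const (0 : ℝ) (Iic 0) (0 : ℝ)).congr
        (fun y hy => posPow_of_nonpos (by linarith) hy) (posPow_of_nonpos (by linarith) le_rfl)
    have h2 : HasDerivWithinAt (posPow p) 0 (Ici 0) 0 := by
      have := (Real.hasDerivAt_rpow_const (x := 0) (p := p) (Or.inr hp.le)).hasDerivWithinAt
        (s := Ici 0)
      rw [Real.zero_rpow (by linarith), mul_zero] at this
      refine this.congr (fun y hy => ?_) ?_
      · rw [posPow, max_eq_left hy]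
      · rw [posPow, max_self]
    have := h1.union h2
    rwa [Iic_union_Ici, hasDerivWithinAt_univ] at this
  · have := Real.hasDerivAt_rpow_const (x := t) (p := p) (Or.inr hp.le)
    rw [posPow, max_eq_left h.le]
    refine this.congr_of_eventuallyEq ?_
    filter_upwards [lt_mem_nhds h] with y hy
    rw [posPow, max_eq_left hy.le]

theorem contDiff_posPow {p : ℝ} (hp : 1 < p) : ContDiff ℝ 1 (posPow p) := by
  rw [contDiff_one_iff_deriv]
  refine ⟨fun t => (hasDerivAt_posPow hp t).differentiableAt, ?_⟩
  rw [funext fun t => (hasDerivAt_posPow hp t).deriv]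
  exact continuous_const.mul (continuous_posPow (by linarith))

/-! ### Partial derivatives -/

/-- The `i`-th partial derivative. -/
noncomputable def pd {n : ℕ} (i : Fin n) (f : Eucl n → ℝ) (x : Eucl n) : ℝ :=
  fderiv ℝ f x (stdVec i)

section pd

variable {n : ℕ} {i : Fin n} {f g : Eucl n → ℝ} {x : Eucl n}

theorem pd_add (hf : DifferentiableAt ℝ f x) (hg : DifferentiableAt ℝ g x) :
    pd i (fun y => f y + g y) x = pd i f x + pd i g x := by
  simp [pd, fderiv_fun_add hf hg]

theorem pd_sub (hf : DifferentiableAt ℝ f x) (hg : DifferentiableAt ℝ g x) :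
    pd i (fun y => f y - g y) x = pd i f x - pd i g x := by
  simp [pd, fderiv_fun_sub hf hg]

theorem pd_mul (hf : DifferentiableAt ℝ f x) (hg : DifferentiableAt ℝ g x) :
    pd i (fun y => f y * g y) x = pd i f x * g x + f x * pd i g x := by
  simp [pd, fderiv_fun_mul hf hg]
  ring

theorem pd_const_mul (c : ℝ) (hf : DifferentiableAt ℝ f x) :
    pd i (fun y => c * f y) x = c * pd i f x := by
  simp [pd, fderiv_const_mul hf c]

theorem pd_sum {ι : Type*} {s : Finset ι} {F : ι → Eucl n → ℝ}
    (hF : ∀ j ∈ s, DifferentiableAt ℝ (F j) x) :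
    pd i (fun y => ∑ j ∈ s, F j y) x = ∑ j ∈ s, pd i (F j) x := by
  simp [pd, fderiv_fun_sum hF]

theorem contDiffAt_pd (hf : ContDiffAt ℝ ∞ f x) (i : Fin n) : ContDiffAt ℝ ∞ (pd i f) x :=
  (hf.fderiv_right (m := ∞) (by simp)).clm_apply contDiffAt_const

theorem pd_comm (hf : ContDiffAt ℝ ∞ f x) (i j : Fin n) : pd i (pd j f) x = pd j (pd i f) x := by
  have hd : DifferentiableAt ℝ (fderiv ℝ f) x :=
    (hf.fderiv_right (m := ∞) (by simp)).differentiableAt (by simp)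
  have h := fun v w : Eucl n => (hf.isSymmSndFDerivAt
    (by
      rw [minSmoothness_of_isRCLikeNormedField]
      exact WithTop.coe_le_coe.2 (le_top : (2 : ℕ∞) ≤ ⊤))).eq v w
  have e : ∀ i j : Fin n, pd i (pd j f) x = fderiv ℝ (fderiv ℝ f) x (stdVec i) (stdVec j) := by
    intro i j
    have := (hd.hasFDerivAt.clm_apply (hasFDerivAt_const (stdVec j) x)).fderiv
    change fderiv ℝ (fun y => fderiv ℝ f y (stdVec j)) x (stdVec i) = _
    rw [this]
    simp
  rw [e, e, h]

theorem fderiv_apply_eq_sum_pd (f : Eucl n → ℝ) (x v : Eucl n) :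
    fderiv ℝ f x v = ∑ i, v i * pd i f x := by
  have hv : v = ∑ i, v i • (stdVec i : Eucl n) := by
    ext j
    simp [stdVec, Pi.single_apply]
  conv_lhs => rw [hv]
  simp [pd]

end pd

/-- A homogeneous (of degree zero) function, smooth away from the origin. -/
structure IsConicDefining {n : ℕ} (σ : Eucl n → ℝ) : Prop where
  smooth : ∀ x, x ≠ 0 → ContDiffAt ℝ ∞ σ x
  hom : ∀ r : ℝ, 0 < r → ∀ x, x ≠ 0 → σ (r • x) = σ x

/-! ### Cutting off by powers of (σ − ε)₊. -/

section cutoff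

variable {n : ℕ} {σ : Eucl n → ℝ}

/-- By continuity σ < ε on a neighbourhood of any point where σ ≤ 0. A product with the cutoff is
thus locally zero there, however badly the other factor behaves near {σ = 0}. -/
theorem eventually_posPow_eq_zero (hσ : IsConicDefining σ) {x : Eucl n} (hx : x ≠ 0) (h : σ x ≤ 0) {p ε : ℝ} (hp : 0 < p)
    (hε : 0 < ε) : ∀ᶠ y in 𝓝 x, posPow p (σ y - ε) = 0 := by
  have : ∀ᶠ y in 𝓝 x, σ y < ε :=
    (hσ.smooth x hx).continuousAt.eventually_lt continuousAt_const (by linarith)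
  filter_upwards [this] with y hy using posPow_of_nonpos hp (by linarith)

theorem contDiffAt_posPow_mul (hσ : IsConicDefining σ) {p ε : ℝ} (hp : 1 < p) (hε : 0 < ε) {g : Eucl n → ℝ}
    (hg : ∀ x, x ≠ 0 → 0 < σ x → ContDiffAt ℝ 1 g x) {x : Eucl n} (hx : x ≠ 0) :
    ContDiffAt ℝ 1 (fun y => posPow p (σ y - ε) * g y) x := by
  rcases le_or_gt (σ x) 0 with h | h
  · refine (contDiffAt_const (c := (0 : ℝ))).congr_of_eventuallyEq ?_
    filter_upwards [eventually_posPow_eq_zero hσ hx h (p := p) (by linarith) hε] with y hy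
    rw [hy, zero_mul]
  · have h1 : ContDiffAt ℝ 1 (fun y => σ y - ε) x :=
      ((hσ.smooth x hx).of_le (by exact_mod_cast le_top)).sub contDiffAt_const
    exact ((contDiff_posPow hp).contDiffAt.comp x h1).mul (hg x hx h)

theorem continuous_posPow_mul (hσ : IsConicDefining σ) {p ε : ℝ} (hp : 0 < p) (hε : 0 < ε) {g : Eucl n → ℝ}
    (hg : ∀ x, x ≠ 0 → 0 < σ x → ContinuousAt g x) :
    Continuous fun θ : Sph n => posPow p (σ θ - ε) * g θ := by
  rw [continuous_iff_continuousAt]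
  intro θ
  have hx : (θ : Eucl n) ≠ 0 := ne_zero_of_mem_unit_sphere θ
  refine ContinuousAt.comp (g := fun x => posPow p (σ x - ε) * g x) (f := ((↑) : Sph n → Eucl n))
    ?_ continuous_subtype_val.continuousAt
  rcases le_or_gt (σ θ) 0 with h | h
  · refine (continuousAt_const (y := (0 : ℝ))).congr ?_
    filter_upwards [eventually_posPow_eq_zero hσ hx h hp hε] with y hy
    rw [hy, zero_mul]
  · exact ((continuous_posPow hp).continuousAt.comp
      ((hσ.smooth _ hx).continuousAt.sub continuousAt_const)).mul (hg _ hx h)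

theorem integrable_posPow_mul (hσ : IsConicDefining σ) {p ε : ℝ} (hp : 0 < p) (hε : 0 < ε) {g : Eucl n → ℝ}
    (hg : ∀ x, x ≠ 0 → 0 < σ x → ContinuousAt g x) :
    Integrable (fun θ : Sph n => posPow p (σ θ - ε) * g θ) (surf n) :=
  (continuous_posPow_mul hσ hp hε hg).integrable_of_hasCompactSupport
    (HasCompactSupport.of_compactSpace _)

/-- The divergence theorem on the sphere for a one-homogeneous field on the cone `σ > 0`, cut off
by a power of `(σ - ε)₊`. -/
theorem integral_sphere_div_posPow (hσ : IsConicDefining σ) (hn : 1 ≤ n) {p ε : ℝ} (hp : 1 < p) (hε : 0 < ε)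
    {g : Fin n → Eucl n → ℝ} (hg : ∀ i x, x ≠ 0 → 0 < σ x → ContDiffAt ℝ 1 (g i) x)
    (hh : ∀ i, ∀ r : ℝ, 0 < r → ∀ x, x ≠ 0 → 0 < σ x → g i (r • x) = r * g i x) :
    ∫ θ : Sph n, (posPow p (σ θ - ε) * ∑ i, pd i (g i) θ +
        p * posPow (p - 1) (σ θ - ε) * ∑ i, pd i σ θ * g i θ) ∂(surf n) =
      n * ∫ θ : Sph n, posPow p (σ θ - ε) * ∑ i, (θ : Eucl n) i * g i θ ∂(surf n) := by
  have h := integral_sphere_div hn (V := fun i x => posPow p (σ x - ε) * g i x)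
    (fun i x hx => contDiffAt_posPow_mul hσ hp hε (hg i) hx)
    (fun i r hr x hx => by
      simp only [hσ.hom r hr x hx]
      rcases le_or_gt (σ x) 0 with h | h
      · rw [posPow_of_nonpos (by linarith) (by linarith)]; simp
      · rw [hh i r hr x hx h]; ring)
  have e1 : ∀ θ : Sph n, ∑ i, fderiv ℝ (fun x => posPow p (σ x - ε) * g i x) θ (stdVec i) =
      posPow p (σ θ - ε) * ∑ i, pd i (g i) θ +
        p * posPow (p - 1) (σ θ - ε) * ∑ i, pd i σ θ * g i θ := by
    intro θ
    have hx : (θ : Eucl n) ≠ 0 := ne_zero_of_mem_unit_sphere θ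
    rw [Finset.mul_sum, Finset.mul_sum, ← Finset.sum_add_distrib]
    refine Finset.sum_congr rfl fun i _ => ?_
    rcases le_or_gt (σ θ) 0 with h | h
    · have e : (fun x => posPow p (σ x - ε) * g i x) =ᶠ[𝓝 (θ : Eucl n)] fun _ => (0 : ℝ) := by
        filter_upwards [eventually_posPow_eq_zero hσ hx h (p := p) (by linarith) hε] with y hy
        rw [hy, zero_mul]
      rw [e.fderiv_eq, posPow_of_nonpos (by linarith) (by linarith),
        posPow_of_nonpos (by linarith) (by linarith)]
      simp
    · have hs : HasFDerivAt (fun x => σ x - ε) (fderiv ℝ σ θ) (θ : Eucl n) :=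
        ((hσ.smooth _ hx).differentiableAt (by simp)).hasFDerivAt.sub_const ε
      have hw := (hasDerivAt_posPow hp (σ θ - ε)).comp_hasFDerivAt (θ : Eucl n) hs
      have := (hw.mul ((hg i _ hx h).differentiableAt one_ne_zero).hasFDerivAt).fderiv
      change fderiv ℝ (fun x => posPow p (σ x - ε) * g i x) θ = _ at this
      rw [this]
      simp [pd]
      ring
  rw [integral_congr_ae (Eventually.of_forall e1)] at h
  rw [h]
  congr 1
  refine integral_congr_ae (Eventually.of_forall fun θ => ?_)
  simp only [Finset.mul_sum]
  exact Finset.sum_congr rfl fun i _ => by ring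

end cutoff

/-- The components of a tangent vector field on `σ > 0`, extended homogeneously of degree one. -/
structure IsConicField {n : ℕ} (σ : Eucl n → ℝ) (u : Fin n → Eucl n → ℝ) : Prop where
  smooth : ∀ i x, x ≠ 0 → 0 < σ x → ContDiffAt ℝ ∞ (u i) x
  hom : ∀ i, ∀ r : ℝ, 0 < r → ∀ x, x ≠ 0 → 0 < σ x → u i (r • x) = r * u i x
  tangent : ∀ x, x ≠ 0 → 0 < σ x → ∑ i, x i * u i x = 0

/-- Euler's relation: differentiate r ↦ f (r • x) at r = 1. The function φ leaves the degree of
homogeneity open. -/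
theorem sum_mul_pd_of_homogeneous {n : ℕ} {f : Eucl n → ℝ} {x : Eucl n}
    (hf : DifferentiableAt ℝ f x) {φ : ℝ → ℝ} {d : ℝ} (hφ : HasDerivAt φ d 1)
    (h : ∀ r : ℝ, 0 < r → f (r • x) = φ r) : ∑ i, x i * pd i f x = d := by
  rw [← fderiv_apply_eq_sum_pd]
  have h1 : HasDerivAt (fun r : ℝ => r • x) x 1 := by
    simpa using (hasDerivAt_id (1 : ℝ)).smul_const x
  have h2 : HasFDerivAt f (fderiv ℝ f x) ((1 : ℝ) • x) := by
    rw [one_smul]; exact hf.hasFDerivAt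
  have h3 := h2.comp_hasDerivAt (1 : ℝ) h1
  refine h3.unique (hφ.congr_of_eventuallyEq ?_)
  filter_upwards [lt_mem_nhds one_pos] with r hr using h r hr

/-! ### Conic fields, Euler relations, and the Hardy and Korn identities. -/

section fields

variable {n : ℕ} {σ : Eucl n → ℝ} {u : Fin n → Eucl n → ℝ}

theorem IsConicDefining.sum_mul_pd (hσ : IsConicDefining σ) {x : Eucl n} (hx : x ≠ 0) :
    ∑ i, x i * pd i σ x = 0 :=
  sum_mul_pd_of_homogeneous ((hσ.smooth x hx).differentiableAt (by simp))
    (hasDerivAt_const (1 : ℝ) (σ x)) fun r hr => hσ.hom r hr x hx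

theorem IsConicDefining.eventually_pos (hσ : IsConicDefining σ) {x : Eucl n} (hx : x ≠ 0)
    (h : 0 < σ x) : ∀ᶠ y in 𝓝 x, y ≠ 0 ∧ 0 < σ y :=
  (isOpen_ne.eventually_mem hx).and
    (continuousAt_const.eventually_lt (hσ.smooth x hx).continuousAt h)

theorem IsConicDefining.pd_hom (hσ : IsConicDefining σ) (i : Fin n) {r : ℝ} (hr : 0 < r)
    {x : Eucl n} (hx : x ≠ 0) : pd i σ (r • x) = r⁻¹ * pd i σ x := by
  have h := fderiv_eq_of_homogeneous (f := σ) (r := r) (c := 1) (x := x)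
    ((isOpen_ne.eventually_mem hx).mono fun y hy => by rw [hσ.hom r hr y hy, one_mul])
    ((hσ.smooth x hx).differentiableAt (by simp)) (stdVec i)
  rw [eq_inv_mul_iff_mul_eq₀ hr.ne']
  simpa [pd] using h

theorem IsConicField.sum_mul_pd (hu : IsConicField σ u) {x : Eucl n} (hx : x ≠ 0)
    (h : 0 < σ x) (i : Fin n) : ∑ k, x k * pd k (u i) x = u i x :=
  sum_mul_pd_of_homogeneous ((hu.smooth i x hx h).differentiableAt (by simp))
    (by simpa using (hasDerivAt_id (1 : ℝ)).mul_const (u i x))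
    fun r hr => hu.hom i r hr x hx h

/-- Differentiate x · u = 0 in the direction k. This is the curvature of the sphere, and the source
of the zeroth-order term in the Korn identity. -/
theorem IsConicField.sum_mul_pd' (hσ : IsConicDefining σ) (hu : IsConicField σ u) {x : Eucl n}
    (hx : x ≠ 0) (h : 0 < σ x) (k : Fin n) : ∑ i, x i * pd k (u i) x = -u k x := by
  have hd : ∀ i, DifferentiableAt ℝ (u i) x := fun i =>
    (hu.smooth i x hx h).differentiableAt (by simp)
  have hp : ∀ i : Fin n, DifferentiableAt ℝ (fun y : Eucl n => y i) x := fun i => by fun_prop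
  have e : (fun y : Eucl n => ∑ i, y i * u i y) =ᶠ[𝓝 x] fun _ => (0 : ℝ) :=
    (hσ.eventually_pos hx h).mono fun y hy => hu.tangent y hy.1 hy.2
  have h1 : pd k (fun y : Eucl n => ∑ i, y i * u i y) x = 0 := by
    simp [pd, e.fderiv_eq]
  rw [pd_sum fun i _ => (hp i).fun_mul (hd i)] at h1
  have hc : ∀ i : Fin n, pd k (fun y : Eucl n => y i) x = if i = k then 1 else 0 := by
    intro i
    have : HasFDerivAt (fun y : Eucl n => y i) (EuclideanSpace.proj (𝕜 := ℝ) i) x :=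
      (EuclideanSpace.proj (𝕜 := ℝ) i).hasFDerivAt
    simp [pd, this.fderiv, stdVec]
  rw [Finset.sum_congr rfl fun i _ => pd_mul (hp i) (hd i), Finset.sum_add_distrib] at h1
  simp only [hc, ite_mul, one_mul, zero_mul, Finset.sum_ite_eq', Finset.mem_univ, if_true] at h1
  linarith

theorem IsConicField.pd_hom (hσ : IsConicDefining σ) (hu : IsConicField σ u) (i k : Fin n) {r : ℝ}
    (hr : 0 < r) {x : Eucl n} (hx : x ≠ 0) (h : 0 < σ x) :
    pd k (u i) (r • x) = pd k (u i) x := by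
  have h := fderiv_eq_of_homogeneous (f := u i) (r := r) (c := r) (x := x)
    ((hσ.eventually_pos hx h).mono fun y hy => hu.hom i r hr y hy.1 hy.2)
    ((hu.smooth i x hx h).differentiableAt (by simp)) (stdVec k)
  exact mul_left_cancel₀ hr.ne' h

/-- The Hardy-type identity for `div ((σ - ε)₊ ^ p ((u·∇σ) u + |u|² ∇σ / 2))`. -/
theorem integral_hardy_identity (hσ : IsConicDefining σ) (hu : IsConicField σ u) (hn : 1 ≤ n)
    {p ε : ℝ} (hp : 1 < p) (hε : 0 < ε) :
    ∫ θ : Sph n, (posPow p (σ θ - ε) *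
        ((∑ i, ∑ j, (pd j (u i) θ + pd i (u j) θ) * (u i θ * pd j σ θ)) +
          (∑ i, ∑ j, pd i (u i) θ * (u j θ * pd j σ θ)) +
          (∑ i, ∑ j, pd i (pd j σ) θ * (u i θ * u j θ)) +
          1 / 2 * ∑ i, ∑ j, pd i (pd i σ) θ * u j θ ^ 2) +
        p * posPow (p - 1) (σ θ - ε) *
          ((∑ j, u j θ * pd j σ θ) ^ 2 + 1 / 2 * (∑ j, u j θ ^ 2) * ∑ i, pd i σ θ ^ 2))
        ∂(surf n) = 0 := by
  -- The coefficient 1/2 is what makes the first derivatives of u enter div g only through the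
  -- symmetric gradient and its trace.
  set g : Fin n → Eucl n → ℝ := fun i x =>
    (∑ j, u j x * pd j σ x) * u i x + 1 / 2 * ((∑ j, u j x * u j x) * pd i σ x) with hg
  have hgs : ∀ i x, x ≠ 0 → 0 < σ x → ContDiffAt ℝ 1 (g i) x := by
    intro i x hx h
    have h1 : ∀ j, ContDiffAt ℝ 1 (u j) x := fun j =>
      (hu.smooth j x hx h).of_le (by exact_mod_cast le_top)
    have h2 : ∀ j, ContDiffAt ℝ 1 (pd j σ) x := fun j =>
      (contDiffAt_pd (hσ.smooth x hx) j).of_le (by exact_mod_cast le_top)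
    exact ((ContDiffAt.sum fun j _ => (h1 j).mul (h2 j)).mul (h1 i)).add
      (contDiffAt_const.mul ((ContDiffAt.sum fun j _ => (h1 j).mul (h1 j)).mul (h2 i)))
  have hgh : ∀ i, ∀ r : ℝ, 0 < r → ∀ x, x ≠ 0 → 0 < σ x → g i (r • x) = r * g i x := by
    intro i r hr x hx h
    have e1 : ∀ j, u j (r • x) * pd j σ (r • x) = u j x * pd j σ x := by
      intro j
      rw [hu.hom j r hr x hx h, hσ.pd_hom j hr hx]
      field_simp
    have e2 : ∀ j, u j (r • x) * u j (r • x) = r ^ 2 * (u j x * u j x) := by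
      intro j
      rw [hu.hom j r hr x hx h]
      ring
    simp only [hg, e1, e2, hu.hom i r hr x hx h, hσ.pd_hom i hr hx, ← Finset.mul_sum]
    field_simp
  have key := integral_sphere_div_posPow hσ hn hp hε hgs hgh
  -- Both u and ∇σ are tangent to the sphere, the latter because σ has degree zero; hence g is
  -- tangent and the right side of the divergence theorem vanishes.
  have hz : ∀ θ : Sph n, posPow p (σ θ - ε) * ∑ i, (θ : Eucl n) i * g i θ = 0 := by
    intro θ
    have hx : (θ : Eucl n) ≠ 0 := ne_zero_of_mem_unit_sphere θ
    rcases le_or_gt (σ θ) 0 with h | h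
    · rw [posPow_of_nonpos (by linarith) (by linarith), zero_mul]
    · have e : ∑ i, (θ : Eucl n) i * g i θ =
          (∑ j, u j θ * pd j σ θ) * (∑ i, (θ : Eucl n) i * u i θ) +
            1 / 2 * ((∑ j, u j θ * u j θ) * ∑ i, (θ : Eucl n) i * pd i σ θ) := by
        simp only [hg, mul_add, Finset.sum_add_distrib]
        rw [Finset.mul_sum, Finset.mul_sum, Finset.mul_sum]
        congr 1 <;> exact Finset.sum_congr rfl fun i _ => by ring
      rw [e, hu.tangent _ hx h, hσ.sum_mul_pd hx]
      ring
  simp only [hz, integral_zero, mul_zero] at key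
  rw [← key]
  refine integral_congr_ae (Eventually.of_forall fun θ => ?_)
  have hx : (θ : Eucl n) ≠ 0 := ne_zero_of_mem_unit_sphere θ
  rcases le_or_gt (σ θ) 0 with h | h
  · simp only [posPow_of_nonpos (show 0 < p by linarith) (show σ θ - ε ≤ 0 by linarith),
      posPow_of_nonpos (show 0 < p - 1 by linarith) (show σ θ - ε ≤ 0 by linarith)]
    ring
  · have hd : ∀ j, DifferentiableAt ℝ (u j) θ := fun j =>
      (hu.smooth j _ hx h).differentiableAt (by simp)
    have hN : ∀ j, DifferentiableAt ℝ (pd j σ) θ := fun j =>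
      (contDiffAt_pd (hσ.smooth _ hx) j).differentiableAt (by simp)
    have hdN : DifferentiableAt ℝ (fun y => ∑ j, u j y * pd j σ y) (θ : Eucl n) :=
      DifferentiableAt.fun_sum fun j _ => (hd j).fun_mul (hN j)
    have hdd : DifferentiableAt ℝ (fun y => ∑ j, u j y * u j y) (θ : Eucl n) :=
      DifferentiableAt.fun_sum fun j _ => (hd j).fun_mul (hd j)
    have e : ∀ i, pd i (g i) θ =
        (∑ j, (pd i (u j) θ * pd j σ θ + u j θ * pd i (pd j σ) θ)) * u i θ +
          (∑ j, u j θ * pd j σ θ) * pd i (u i) θ +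
          1 / 2 * ((∑ j, (pd i (u j) θ * u j θ + u j θ * pd i (u j) θ)) * pd i σ θ +
            (∑ j, u j θ * u j θ) * pd i (pd i σ) θ) := by
      intro i
      simp only [hg]
      rw [pd_add (hdN.fun_mul (hd i)) ((hdd.fun_mul (hN i)).const_mul _), pd_mul hdN (hd i),
        pd_const_mul _ (hdd.fun_mul (hN i)), pd_mul hdd (hN i), pd_sum fun j _ => (hd j).fun_mul (hN j),
        pd_sum fun j _ => (hd j).fun_mul (hd j),
        Finset.sum_congr rfl fun j _ => pd_mul (i := i) (hd j) (hN j),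
        Finset.sum_congr rfl fun j _ => pd_mul (i := i) (hd j) (hd j)]
    have e1 : ∑ i, pd i (g i) θ = (∑ i, ∑ j, (pd j (u i) θ + pd i (u j) θ) * (u i θ * pd j σ θ)) +
          (∑ i, ∑ j, pd i (u i) θ * (u j θ * pd j σ θ)) +
          (∑ i, ∑ j, pd i (pd j σ) θ * (u i θ * u j θ)) +
          1 / 2 * ∑ i, ∑ j, pd i (pd i σ) θ * u j θ ^ 2 := by
      -- The derivative of u·∇σ along u gives one half of the symmetrized sum, the gradient of
      -- |u|²/2 along ∇σ the other half.
      have e2 : ∑ i, ∑ j, (pd j (u i) θ + pd i (u j) θ) * (u i θ * pd j σ θ) =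
          (∑ i, ∑ j, pd i (u j) θ * (u j θ * pd i σ θ)) +
            ∑ i, ∑ j, pd i (u j) θ * (u i θ * pd j σ θ) := by
        rw [Finset.sum_comm (f := fun i j => pd i (u j) θ * (u j θ * pd i σ θ))]
        simp only [add_mul, Finset.sum_add_distrib]
      rw [e2]
      simp only [e, Finset.mul_sum, Finset.sum_mul, ← Finset.sum_add_distrib]
      refine Finset.sum_congr rfl fun i _ => ?_
      refine Finset.sum_congr rfl fun j _ => ?_
      ring
    have e3 : ∑ i, pd i σ θ * g i θ =
        (∑ j, u j θ * pd j σ θ) ^ 2 + 1 / 2 * (∑ j, u j θ ^ 2) * ∑ i, pd i σ θ ^ 2 := by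
      simp only [hg, mul_add, Finset.sum_add_distrib]
      rw [pow_two (∑ j, u j θ * pd j σ θ), Finset.mul_sum, Finset.mul_sum]
      congr 1
      · exact Finset.sum_congr rfl fun i _ => by ring
      · refine Finset.sum_congr rfl fun i _ => ?_
        simp only [pow_two]
        ring
    simp only [e1, e3]

/-- The Korn-type identity for `div ((σ - ε)₊ ^ p ((u·∇) u - (div u) u))`. -/
theorem integral_korn_identity (hσ : IsConicDefining σ) (hu : IsConicField σ u) (hn : 1 ≤ n)
    {p ε : ℝ} (hp : 1 < p) (hε : 0 < ε) :
    ∫ θ : Sph n, (posPow p (σ θ - ε) * ((∑ i, ∑ j, pd j (u i) θ * pd i (u j) θ) -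
          (∑ i, pd i (u i) θ) ^ 2) +
        p * posPow (p - 1) (σ θ - ε) *
          ((∑ i, ∑ j, pd j (u i) θ * (u j θ * pd i σ θ)) -
            ∑ i, ∑ j, pd i (u i) θ * (u j θ * pd j σ θ))) ∂(surf n) =
      n * ∫ θ : Sph n, posPow p (σ θ - ε) * -∑ i, u i θ ^ 2 ∂(surf n) := by
  -- This combination is the one whose divergence contains no second derivatives of u.
  set g : Fin n → Eucl n → ℝ := fun i x =>
    (∑ j, pd j (u i) x * u j x) - (∑ j, pd j (u j) x) * u i x with hg
  have hgs : ∀ i x, x ≠ 0 → 0 < σ x → ContDiffAt ℝ 1 (g i) x := by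
    intro i x hx h
    have h1 : ∀ j, ContDiffAt ℝ 1 (u j) x := fun j =>
      (hu.smooth j x hx h).of_le (by exact_mod_cast le_top)
    have h2 : ∀ j k, ContDiffAt ℝ 1 (pd j (u k)) x := fun j k =>
      (contDiffAt_pd (hu.smooth k x hx h) j).of_le (by exact_mod_cast le_top)
    exact (ContDiffAt.sum fun j _ => (h2 j i).mul (h1 j)).sub
      ((ContDiffAt.sum fun j _ => h2 j j).mul (h1 i))
  have hgh : ∀ i, ∀ r : ℝ, 0 < r → ∀ x, x ≠ 0 → 0 < σ x → g i (r • x) = r * g i x := by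
    intro i r hr x hx h
    simp only [hg, hu.hom _ r hr x hx h, hu.pd_hom hσ _ _ hr hx h, mul_sub, Finset.mul_sum]
    congr 1
    · exact Finset.sum_congr rfl fun i _ => by ring
    · ring
  have key := integral_sphere_div_posPow hσ hn hp hε hgs hgh
  -- Unlike the Hardy field, this one is not tangent: its normal component is −|u|², by
  -- `IsConicField.sum_mul_pd'`.
  have hz : ∀ θ : Sph n, posPow p (σ θ - ε) * ∑ i, (θ : Eucl n) i * g i θ =
      posPow p (σ θ - ε) * -∑ i, u i θ ^ 2 := by
    intro θ
    have hx : (θ : Eucl n) ≠ 0 := ne_zero_of_mem_unit_sphere θ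
    rcases le_or_gt (σ θ) 0 with h | h
    · rw [posPow_of_nonpos (by linarith) (by linarith), zero_mul, zero_mul]
    · congr 1
      have e : ∑ i, (θ : Eucl n) i * g i θ =
          (∑ j, (∑ i, (θ : Eucl n) i * pd j (u i) θ) * u j θ) -
            (∑ j, pd j (u j) θ) * ∑ i, (θ : Eucl n) i * u i θ := by
        simp only [hg, mul_sub, Finset.sum_sub_distrib]
        congr 1
        · simp only [Finset.mul_sum, Finset.sum_mul]
          rw [Finset.sum_comm]
          exact Finset.sum_congr rfl fun i _ => Finset.sum_congr rfl fun j _ => by ring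
        · rw [Finset.mul_sum]
          exact Finset.sum_congr rfl fun i _ => by ring
      rw [e, hu.tangent _ hx h]
      simp only [hu.sum_mul_pd' hσ hx h, mul_zero, sub_zero, ← Finset.sum_neg_distrib]
      exact Finset.sum_congr rfl fun i _ => by ring
  rw [integral_congr_ae (Eventually.of_forall hz)] at key
  rw [← key]
  refine integral_congr_ae (Eventually.of_forall fun θ => ?_)
  have hx : (θ : Eucl n) ≠ 0 := ne_zero_of_mem_unit_sphere θ
  rcases le_or_gt (σ θ) 0 with h | h
  · simp only [posPow_of_nonpos (show 0 < p by linarith) (show σ θ - ε ≤ 0 by linarith),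
      posPow_of_nonpos (show 0 < p - 1 by linarith) (show σ θ - ε ≤ 0 by linarith)]
    ring
  · have hd : ∀ j, DifferentiableAt ℝ (u j) θ := fun j =>
      (hu.smooth j _ hx h).differentiableAt (by simp)
    have hA : ∀ j k, DifferentiableAt ℝ (pd j (u k)) θ := fun j k =>
      (contDiffAt_pd (hu.smooth k _ hx h) j).differentiableAt (by simp)
    have hdA : ∀ i, DifferentiableAt ℝ (fun y => ∑ j, pd j (u i) y * u j y) (θ : Eucl n) :=
      fun i => DifferentiableAt.fun_sum fun j _ => (hA j i).fun_mul (hd j)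
    have hdt : DifferentiableAt ℝ (fun y => ∑ j, pd j (u j) y) (θ : Eucl n) :=
      DifferentiableAt.fun_sum fun j _ => hA j j
    have e : ∀ i, pd i (g i) θ =
        (∑ j, (pd i (pd j (u i)) θ * u j θ + pd j (u i) θ * pd i (u j) θ)) -
          ((∑ j, pd i (pd j (u j)) θ) * u i θ + (∑ j, pd j (u j) θ) * pd i (u i) θ) := by
      intro i
      simp only [hg]
      rw [pd_sub (hdA i) (hdt.fun_mul (hd i)), pd_mul hdt (hd i), pd_sum fun j _ => hA j j,
        pd_sum fun j _ => (hA j i).fun_mul (hd j),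
        Finset.sum_congr rfl fun j _ => pd_mul (i := i) (hA j i) (hd j)]
    have e1 : ∑ i, pd i (g i) θ = (∑ i, ∑ j, pd j (u i) θ * pd i (u j) θ) -
          (∑ i, pd i (u i) θ) ^ 2 := by
      -- The second derivatives of u cancel by symmetry of mixed partials.
      have e2 : ∑ i, ∑ j, pd i (pd j (u i)) θ * u j θ =
          ∑ i, (∑ j, pd i (pd j (u j)) θ) * u i θ := by
        rw [Finset.sum_comm]
        refine Finset.sum_congr rfl fun i _ => ?_
        rw [Finset.sum_mul]
        refine Finset.sum_congr rfl fun j _ => ?_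
        rw [pd_comm (hu.smooth j _ hx h)]
      simp only [e, Finset.sum_sub_distrib, Finset.sum_add_distrib, e2, ← Finset.mul_sum]
      ring
    have e3 : ∑ i, pd i σ θ * g i θ = (∑ i, ∑ j, pd j (u i) θ * (u j θ * pd i σ θ)) -
            ∑ i, ∑ j, pd i (u i) θ * (u j θ * pd j σ θ) := by
      rw [Finset.sum_comm (f := fun i j => pd i (u i) θ * (u j θ * pd j σ θ)),
        ← Finset.sum_sub_distrib]
      refine Finset.sum_congr rfl fun i _ => ?_
      simp only [hg, mul_sub, Finset.sum_mul, Finset.mul_sum]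
      congr 1 <;> exact Finset.sum_congr rfl fun i _ => by ring
    simp only [e1, e3]

end fields

/-! ### Pointwise bounds for the integrands of the two identities. -/

theorem neg_young_le {δ a z : ℝ} (hδ : 0 < δ) : -(δ * a ^ 2 + z ^ 2 / δ) ≤ 2 * (a * z) := by
  have h : δ * a ^ 2 + z ^ 2 / δ + 2 * (a * z) = (δ * a + z) ^ 2 / δ := by
    field_simp
    ring
  have : 0 ≤ (δ * a + z) ^ 2 / δ := by positivity
  linarith

theorem sq_mul_le_of_abs_le {x N M : ℝ} (h : |N| ≤ M) : (x * N) ^ 2 ≤ M ^ 2 * x ^ 2 := by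
  have : N ^ 2 ≤ M ^ 2 := sq_le_sq.2 (h.trans (le_abs_self M))
  nlinarith [sq_nonneg x, mul_le_mul_of_nonneg_left this (sq_nonneg x)]

theorem sum_diag_sq_le {n : ℕ} (e : Fin n → Fin n → ℝ) :
    ∑ i, e i i ^ 2 ≤ ∑ i, ∑ j, e i j ^ 2 :=
  Finset.sum_le_sum fun i _ =>
    Finset.single_le_sum (f := fun j => e i j ^ 2) (fun _ _ => sq_nonneg _) (Finset.mem_univ i)

/-- Here t stands for (σ − ε)₊, N for ∇σ, A for ∇u and H for the Hessian of σ, after the common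
weight (σ − ε)₊^{q−2} has been factored out. The term ½|u|²|N|² supplies a positive multiple of |u|²
up to an error t²|u|²; every other term carries a factor t and is absorbed by Young's inequality,
the derivatives of u being present only through Sym A. -/
theorem hardy_pointwise (n : ℕ) {c M b : ℝ} (hc : 0 < c) (hb : 1 ≤ b) :
    ∃ C, 0 ≤ C ∧ ∀ t : ℝ, 0 ≤ t → ∀ (u N : Fin n → ℝ) (A H : Fin n → Fin n → ℝ),
      (∀ i, |N i| ≤ M) → (∀ i j, |H i j| ≤ M) → c ≤ ∑ i, N i ^ 2 + 2 * t ^ 2 →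
      c / 4 * ∑ j, u j ^ 2 - C * (t ^ 2 * (∑ j, u j ^ 2 + ∑ i, ∑ j, ((A i j + A j i) / 2) ^ 2)) ≤
        t * ((∑ i, ∑ j, (A i j + A j i) * (u i * N j)) + (∑ i, ∑ j, A i i * (u j * N j)) +
          (∑ i, ∑ j, H i j * (u i * u j)) + 1 / 2 * ∑ i, ∑ j, H i i * u j ^ 2) +
        b * ((∑ j, u j * N j) ^ 2 + 1 / 2 * (∑ j, u j ^ 2) * ∑ i, N i ^ 2) := by
  -- Young's inequality is paid with nδ|u|² in `h1`, nδ|u|² in `h2` and δ|u|² in `h5`: in total c/4,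
  -- half of the c/2 provided by `h6`.
  set δ : ℝ := c / (4 * (2 * n + 1)) with hδdef
  have hδ : 0 < δ := by positivity
  have hδc : (2 * n + 1) * δ = c / 4 := by rw [hδdef]; field_simp
  -- The three summands come from `h1` together with `h2`, from `h5` (where 3/2 = 1 + 1/2 collects
  -- both Hessian terms), and from the error t²|u|² in `h6`.
  refine ⟨M ^ 2 / δ * (1 + n) + (3 / 4 * M * n) ^ 2 / δ + 1, by positivity, ?_⟩
  intro t ht u N A H hN hH hcN
  set U := ∑ j, u j ^ 2 with hU
  set Ee := ∑ i, ∑ j, ((A i j + A j i) / 2) ^ 2 with hEe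
  have hU0 : 0 ≤ U := Finset.sum_nonneg fun j _ => sq_nonneg _
  have hE0 : 0 ≤ Ee := Finset.sum_nonneg fun i _ => Finset.sum_nonneg fun j _ => sq_nonneg _
  have sumU1 : ∑ _i : Fin n, ∑ j, u j ^ 2 = n * U := by simp [hU]
  have sumU2 : ∑ i : Fin n, ∑ _j : Fin n, u i ^ 2 = n * U := by simp [hU, Finset.mul_sum]
  have h1 : -(δ * (n * U) + M ^ 2 / δ * t ^ 2 * Ee) ≤
      t * ∑ i, ∑ j, (A i j + A j i) * (u i * N j) := by
    rw [← sumU2, hEe]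
    simp only [Finset.mul_sum, ← Finset.sum_add_distrib, ← Finset.sum_neg_distrib]
    refine Finset.sum_le_sum fun i _ => Finset.sum_le_sum fun j _ => ?_
    have y := neg_young_le (a := u i) (z := t * ((A i j + A j i) / 2) * N j) hδ
    have z := sq_mul_le_of_abs_le (x := t * ((A i j + A j i) / 2)) (hN j)
    have z' := div_le_div_of_nonneg_right z hδ.le
    have e : M ^ 2 * (t * ((A i j + A j i) / 2)) ^ 2 / δ =
      M ^ 2 / δ * t ^ 2 * ((A i j + A j i) / 2) ^ 2 := by ring
    rw [e] at z'
    linarith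
  have h2 : -(δ * (n * U) + M ^ 2 / δ * t ^ 2 * (n * Ee)) ≤
      t * ∑ i, ∑ j, A i i * (u j * N j) := by
    have hd : ∑ i, A i i ^ 2 ≤ Ee := by
      have := sum_diag_sq_le fun i j => (A i j + A j i) / 2
      simpa using this
    have hd' : M ^ 2 / δ * t ^ 2 * (n * ∑ i, A i i ^ 2) ≤ M ^ 2 / δ * t ^ 2 * (n * Ee) := by
      gcongr
    have hs : (n : ℝ) * ∑ i, A i i ^ 2 = ∑ i : Fin n, ∑ _j : Fin n, A i i ^ 2 := by
      simp [Finset.mul_sum]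
    refine le_trans (by linarith) (?_ : -(δ * (n * U) + M ^ 2 / δ * t ^ 2 *
      (n * ∑ i, A i i ^ 2)) ≤ _)
    rw [hs, ← sumU1]
    simp only [Finset.mul_sum, ← Finset.sum_add_distrib, ← Finset.sum_neg_distrib]
    refine Finset.sum_le_sum fun i _ => Finset.sum_le_sum fun j _ => ?_
    have y := neg_young_le (a := u j) (z := t * A i i * N j) hδ
    have z := sq_mul_le_of_abs_le (x := t * A i i) (hN j)
    have z' := div_le_div_of_nonneg_right z hδ.le
    have e : M ^ 2 * (t * A i i) ^ 2 / δ = M ^ 2 / δ * t ^ 2 * A i i ^ 2 := by ring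
    rw [e] at z'
    have : 0 ≤ δ * u j ^ 2 := by positivity
    have : 0 ≤ (t * A i i * N j) ^ 2 / δ := by positivity
    linarith
  have h3 : -(t * M * (n * U)) ≤ t * ∑ i, ∑ j, H i j * (u i * u j) := by
    have e : t * M * (n * U) = t * M * (1 / 2 * (∑ _i : Fin n, ∑ j, u j ^ 2) +
        1 / 2 * ∑ i : Fin n, ∑ _j : Fin n, u i ^ 2) := by rw [sumU1, sumU2]; ring
    rw [e, mul_assoc, ← mul_neg]
    refine mul_le_mul_of_nonneg_left ?_ ht
    simp only [Finset.mul_sum, ← Finset.sum_add_distrib, ← Finset.sum_neg_distrib]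
    refine Finset.sum_le_sum fun i _ => Finset.sum_le_sum fun j _ => ?_
    have h := abs_le.1 (hH i j)
    nlinarith [sq_nonneg (u i + u j), sq_nonneg (u i - u j)]
  have h4 : -(t * M * (n * U)) ≤ t * ∑ i, ∑ j, H i i * u j ^ 2 := by
    rw [← sumU1, mul_assoc, ← mul_neg]
    refine mul_le_mul_of_nonneg_left ?_ ht
    simp only [Finset.mul_sum, ← Finset.sum_neg_distrib]
    refine Finset.sum_le_sum fun i _ => Finset.sum_le_sum fun j _ => ?_
    have h := abs_le.1 (hH i i)
    nlinarith [sq_nonneg (u j)]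
  have h5 : 3 / 2 * (t * M * (n * U)) ≤ δ * U + (3 / 4 * M * n) ^ 2 / δ * (t ^ 2 * U) := by
    have y := neg_young_le (a := -1) (z := 3 / 4 * M * n * t) hδ
    have e : (3 / 4 * M * n) ^ 2 / δ * (t ^ 2 * U) = (3 / 4 * M * n * t) ^ 2 / δ * U := by ring
    rw [e]
    nlinarith [mul_le_mul_of_nonneg_right y hU0]
  have h6 : c / 2 * U - t ^ 2 * U ≤
      b * ((∑ j, u j * N j) ^ 2 + 1 / 2 * U * ∑ i, N i ^ 2) := by
    have hN0 : 0 ≤ ∑ i, N i ^ 2 := Finset.sum_nonneg fun j _ => sq_nonneg _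
    have : 0 ≤ (∑ j, u j * N j) ^ 2 + 1 / 2 * U * ∑ i, N i ^ 2 := by positivity
    have h7 := mul_le_mul_of_nonneg_right hb this
    have h8 := mul_le_mul_of_nonneg_left hcN hU0
    nlinarith [sq_nonneg (∑ j, u j * N j)]
  have h9 : 0 ≤ M ^ 2 / δ * (1 + n) * (t ^ 2 * U) := by positivity
  have h10 : 0 ≤ (3 / 4 * M * n) ^ 2 / δ * (t ^ 2 * Ee) := by positivity
  have h11 : 0 ≤ t ^ 2 * Ee := by positivity
  have h12 : (2 * n + 1) * δ * U = c / 4 * U := by rw [hδc]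
  linarith

/-- From tr A² = 2|Sym A|² − |A|², the full gradient appears with coefficient −1. Each of the two
cross terms u·A·N consumes a quarter of it, which leaves −1/2, and (tr A)² has the favourable sign.
-/
theorem korn_pointwise {n : ℕ} (hn : 1 ≤ n) (M b : ℝ) :
    ∃ C, 0 ≤ C ∧ ∀ t : ℝ, 0 ≤ t → ∀ (u N : Fin n → ℝ) (A : Fin n → Fin n → ℝ),
      (∀ i, |N i| ≤ M) →
        t ^ 2 * ((∑ i, ∑ j, A i j * A j i) - (∑ i, A i i) ^ 2) +
          b * t * ((∑ i, ∑ j, A i j * (u j * N i)) - ∑ i, ∑ j, A i i * (u j * N j)) ≤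
        2 * (t ^ 2 * ∑ i, ∑ j, ((A i j + A j i) / 2) ^ 2) - 1 / 2 * (t ^ 2 * ∑ i, ∑ j, A i j ^ 2) +
          C * ∑ j, u j ^ 2 := by
  refine ⟨n * (b * M) ^ 2 + n ^ 2 * (b * M) ^ 2, by positivity, ?_⟩
  intro t ht u N A hN
  have hn' : (0 : ℝ) < n := by exact_mod_cast hn
  set U := ∑ j, u j ^ 2 with hU
  set AA := ∑ i, ∑ j, A i j ^ 2 with hAA
  have sumU1 : ∑ _i : Fin n, ∑ j, u j ^ 2 = n * U := by simp [hU]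
  have e1 : ∑ i, ∑ j, A i j * A j i = 2 * (∑ i, ∑ j, ((A i j + A j i) / 2) ^ 2) - AA := by
    have : ∑ i, ∑ j, A j i ^ 2 = AA := Finset.sum_comm
    have e : 2 * (∑ i, ∑ j, ((A i j + A j i) / 2) ^ 2) =
        1 / 2 * AA + 1 / 2 * (∑ i, ∑ j, A j i ^ 2) + ∑ i, ∑ j, A i j * A j i := by
      simp only [hAA, Finset.mul_sum, ← Finset.sum_add_distrib]
      exact Finset.sum_congr rfl fun i _ => Finset.sum_congr rfl fun j _ => by ring
    rw [e, this]
    ring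
  have h1 : b * t * (∑ i, ∑ j, A i j * (u j * N i)) ≤
      1 / 4 * t ^ 2 * AA + (b * M) ^ 2 * (n * U) := by
    rw [← sumU1, hAA]
    simp only [Finset.mul_sum, ← Finset.sum_add_distrib]
    refine Finset.sum_le_sum fun i _ => Finset.sum_le_sum fun j _ => ?_
    have z := sq_mul_le_of_abs_le (x := b * u j) (hN i)
    nlinarith [sq_nonneg (1 / 2 * (t * A i j) - b * u j * N i)]
  have h2 : -(b * t * (∑ i, ∑ j, A i i * (u j * N j))) ≤
      1 / 4 * t ^ 2 * AA + n * (b * M) ^ 2 * (n * U) := by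
    have hd := sum_diag_sq_le A
    have hs : ∑ i, A i i ^ 2 = 1 / n * ∑ i : Fin n, ∑ _j : Fin n, A i i ^ 2 := by
      simp [Finset.mul_sum]
      field_simp
    have hd' : 1 / 4 * t ^ 2 * ∑ i, A i i ^ 2 ≤ 1 / 4 * t ^ 2 * AA := by gcongr
    refine le_trans ?_ (add_le_add_left hd' _)
    rw [← sumU1, hs]
    simp only [Finset.mul_sum, ← Finset.sum_add_distrib, ← Finset.sum_neg_distrib]
    refine Finset.sum_le_sum fun i _ => Finset.sum_le_sum fun j _ => ?_
    have z := mul_le_mul_of_nonneg_left (sq_mul_le_of_abs_le (x := b * u j) (hN j)) hn'.le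
    -- The weight n compensates for the n-fold repetition of each diagonal entry in the double sum.
    have y' := neg_young_le (a := (b * u j * N j)) (z := 1 / 2 * (t * A i i)) hn'
    have e : (1 / 2 * (t * A i i)) ^ 2 / (n : ℝ) = 1 / 4 * t ^ 2 * (1 / n * A i i ^ 2) := by
      field_simp
      ring
    rw [e] at y'
    linarith
  rw [e1]
  have h3 : 0 ≤ t ^ 2 * (∑ i, A i i) ^ 2 := by positivity
  linarith

/-! ### Korn's inequality for truncated weights. -/

section korn

variable {n : ℕ} {σ : Eucl n → ℝ}

/-- A uniform lower bound for the gradient of a defining function near its zero set. -/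
theorem exists_gradient_bound (hσ : IsConicDefining σ) (hn : 1 ≤ n)
    (hreg : ∀ θ : Sph n, σ θ = 0 → ∃ i, pd i σ θ ≠ 0) :
    ∃ c, 0 < c ∧ ∀ θ : Sph n, 2 * c ≤ ∑ i, pd i σ θ ^ 2 + σ θ ^ 2 := by
  have : Nonempty (Fin n) := ⟨⟨0, hn⟩⟩
  have hne : (univ : Set (Sph n)).Nonempty := by
    have : Nonempty (Sph n) := (NormedSpace.sphere_nonempty.2 zero_le_one).to_subtype
    exact univ_nonempty
  have hc : Continuous fun θ : Sph n => ∑ i, pd i σ θ ^ 2 + σ θ ^ 2 := by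
    rw [continuous_iff_continuousAt]
    intro θ
    have hx : (θ : Eucl n) ≠ 0 := ne_zero_of_mem_unit_sphere θ
    refine ContinuousAt.comp (g := fun x : Eucl n => ∑ i, pd i σ x ^ 2 + σ x ^ 2)
      (f := ((↑) : Sph n → Eucl n)) ?_ continuous_subtype_val.continuousAt
    have h1 : ∀ i, ContinuousAt (pd i σ) (θ : Eucl n) := fun i =>
      (contDiffAt_pd (hσ.smooth _ hx) i).continuousAt
    have h2 := (hσ.smooth _ hx).continuousAt
    fun_prop
  obtain ⟨θ₀, -, h⟩ := isCompact_univ.exists_isMinOn hne hc.continuousOn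
  -- Taking half of the minimum leaves the margin needed later to replace σ by σ − ε.
  refine ⟨(∑ i, pd i σ θ₀ ^ 2 + σ θ₀ ^ 2) / 2, ?_, fun θ => ?_⟩
  · have h0 : 0 ≤ ∑ i, pd i σ θ₀ ^ 2 := Finset.sum_nonneg fun i _ => sq_nonneg _
    by_cases hz : σ θ₀ = 0
    · obtain ⟨i, hi⟩ := hreg θ₀ hz
      have : 0 < ∑ i, pd i σ θ₀ ^ 2 :=
        Finset.sum_pos' (fun i _ => sq_nonneg _) ⟨i, Finset.mem_univ i, by positivity⟩
      positivity
    · positivity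
  · have := h (mem_univ θ)
    simp only [mem_ofPred_eq] at this
    linarith

theorem exists_derivative_bound (hσ : IsConicDefining σ) :
    ∃ M, ∀ θ : Sph n, (∀ i, |pd i σ θ| ≤ M) ∧ ∀ i j, |pd i (pd j σ) θ| ≤ M := by
  have hc : Continuous fun θ : Sph n => ∑ i, |pd i σ θ| + ∑ i, ∑ j, |pd i (pd j σ) θ| := by
    rw [continuous_iff_continuousAt]
    intro θ
    have hx : (θ : Eucl n) ≠ 0 := ne_zero_of_mem_unit_sphere θ
    refine ContinuousAt.comp
      (g := fun x : Eucl n => ∑ i, |pd i σ x| + ∑ i, ∑ j, |pd i (pd j σ) x|)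
      (f := ((↑) : Sph n → Eucl n)) ?_ continuous_subtype_val.continuousAt
    have h1 : ∀ i, ContinuousAt (pd i σ) (θ : Eucl n) := fun i =>
      (contDiffAt_pd (hσ.smooth _ hx) i).continuousAt
    have h2 : ∀ i j, ContinuousAt (pd i (pd j σ)) (θ : Eucl n) := fun i j =>
      (contDiffAt_pd (contDiffAt_pd (hσ.smooth _ hx) j) i).continuousAt
    fun_prop
  obtain ⟨M, hM⟩ := isCompact_univ.exists_bound_of_continuousOn hc.continuousOn
  refine ⟨M, fun θ => ?_⟩
  have h := (le_abs_self _).trans (hM θ (mem_univ θ))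
  have h1 : 0 ≤ ∑ i, |pd i σ θ| := Finset.sum_nonneg fun i _ => abs_nonneg _
  have h2 : 0 ≤ ∑ i, ∑ j, |pd i (pd j σ) θ| :=
    Finset.sum_nonneg fun i _ => Finset.sum_nonneg fun j _ => abs_nonneg _
  refine ⟨fun i => ?_, fun i j => ?_⟩
  · have := Finset.single_le_sum (f := fun i => |pd i σ θ|) (fun i _ => abs_nonneg _)
      (Finset.mem_univ i)
    linarith
  · have h3 := Finset.single_le_sum (f := fun j => |pd i (pd j σ) θ|) (fun i _ => abs_nonneg _)
      (Finset.mem_univ j)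
    have h4 := Finset.single_le_sum (f := fun i => ∑ j, |pd i (pd j σ) θ|)
      (fun i _ => Finset.sum_nonneg fun j _ => abs_nonneg _) (Finset.mem_univ i)
    linarith

/-- Korn's inequality for the truncated weights `(σ - ε)₊ ^ q`, uniformly in small `ε`. -/
theorem exists_korn_truncated (hσ : IsConicDefining σ) (hn : 1 ≤ n)
    (hreg : ∀ θ : Sph n, σ θ = 0 → ∃ i, pd i σ θ ≠ 0) {q : ℝ} (hq : 4 ≤ q) :
    ∃ C ε₀ : ℝ, 0 ≤ C ∧ 0 < ε₀ ∧ ∀ u, IsConicField σ u → ∀ ε, 0 < ε → ε < ε₀ →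
      ∫ θ : Sph n, posPow q (σ θ - ε) * ∑ i, ∑ j, pd j (u i) θ ^ 2 ∂(surf n) ≤
        C * ∫ θ : Sph n, posPow q (σ θ - ε) * (∑ j, u j θ ^ 2 +
          ∑ i, ∑ j, ((pd j (u i) θ + pd i (u j) θ) / 2) ^ 2) ∂(surf n) := by
  obtain ⟨c, hc, hcb⟩ := exists_gradient_bound hσ hn hreg
  obtain ⟨M, hMb⟩ := exists_derivative_bound hσ
  obtain ⟨C₁, hC₁, H₁⟩ := hardy_pointwise (M := M) n hc (b := q - 1) (by linarith)
  obtain ⟨C₂, hC₂, H₂⟩ := korn_pointwise hn M q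
  -- In the final estimate ½∫|∇u|² is bounded by twice the symmetric part, n times the curvature
  -- term |u|², and `C₂` times the Hardy bound. The threshold for ε ensures 2ε² ≤ c.
  refine ⟨2 * (2 + n + C₂ * (4 / c * C₁)), min 1 (c / 2), by positivity, by positivity, ?_⟩
  intro u hu ε hε hε'
  have hε1 : ε < 1 := lt_of_lt_of_le hε' (min_le_left _ _)
  have hε2 : ε < c / 2 := lt_of_lt_of_le hε' (min_le_right _ _)
  have hεc : 2 * ε ^ 2 ≤ c := by nlinarith
  -- continuity
  have cu : ∀ i x, x ≠ 0 → 0 < σ x → ContinuousAt (u i) x := fun i x hx h =>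
    (hu.smooth i x hx h).continuousAt
  have cA : ∀ i j x, x ≠ 0 → 0 < σ x → ContinuousAt (pd j (u i)) x := fun i j x hx h =>
    (contDiffAt_pd (hu.smooth i x hx h) j).continuousAt
  have cN : ∀ i x, x ≠ 0 → ContinuousAt (pd i σ) x := fun i x hx =>
    (contDiffAt_pd (hσ.smooth x hx) i).continuousAt
  have cH : ∀ i j x, x ≠ 0 → ContinuousAt (pd i (pd j σ)) x := fun i j x hx =>
    (contDiffAt_pd (contDiffAt_pd (hσ.smooth x hx) j) i).continuousAt
  have cont : ∀ {p : ℝ}, 0 < p → ∀ {g : Eucl n → ℝ},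
      (∀ x, (∀ i, ContinuousAt (u i) x) → (∀ i j, ContinuousAt (pd j (u i)) x) →
        (∀ i, ContinuousAt (pd i σ) x) → (∀ i j, ContinuousAt (pd i (pd j σ)) x) →
        ContinuousAt g x) →
      Integrable (fun θ : Sph n => posPow p (σ θ - ε) * g θ) (surf n) := fun hp g hg =>
    integrable_posPow_mul hσ hp hε fun x hx h => hg x (fun i => cu i x hx h)
      (fun i j => cA i j x hx h) (fun i => cN i x hx) (fun i j => cH i j x hx)
  have iU : ∀ {p : ℝ}, 0 < p →
      Integrable (fun θ : Sph n => posPow p (σ θ - ε) * ∑ j, u j θ ^ 2) (surf n) := fun hp =>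
    cont (g := fun x => ∑ j, u j x ^ 2) hp fun x _ _ _ _ => by fun_prop
  have iE : Integrable (fun θ : Sph n => posPow q (σ θ - ε) *
      ∑ i, ∑ j, ((pd j (u i) θ + pd i (u j) θ) / 2) ^ 2) (surf n) :=
    cont (g := fun x => ∑ i, ∑ j, ((pd j (u i) x + pd i (u j) x) / 2) ^ 2) (by linarith)
      fun x _ _ _ _ => by fun_prop
  have iA : Integrable (fun θ : Sph n => posPow q (σ θ - ε) *
      ∑ i, ∑ j, pd j (u i) θ ^ 2) (surf n) :=
    cont (g := fun x => ∑ i, ∑ j, pd j (u i) x ^ 2) (by linarith) fun x _ _ _ _ => by fun_prop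
  have w1 : ∀ θ : Sph n, posPow (q - 1) (σ θ - ε) =
      posPow (q - 2) (σ θ - ε) * max (σ θ - ε) 0 := fun θ => by
    rw [← posPow_add_one (by linarith)]; congr 1; ring
  have w2 : ∀ θ : Sph n, posPow q (σ θ - ε) =
      posPow (q - 2) (σ θ - ε) * max (σ θ - ε) 0 ^ 2 := fun θ => by
    rw [pow_two, ← mul_assoc, ← w1, ← posPow_add_one (by linarith)]; congr 1; ring
  -- the Hardy inequality
  have hardy : ∫ θ : Sph n, posPow (q - 2) (σ θ - ε) * ∑ j, u j θ ^ 2 ∂(surf n) ≤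
      4 / c * C₁ * ∫ θ : Sph n, posPow q (σ θ - ε) * (∑ j, u j θ ^ 2 +
          ∑ i, ∑ j, ((pd j (u i) θ + pd i (u j) θ) / 2) ^ 2) ∂(surf n) := by
    have id1 := integral_hardy_identity hσ hu hn (p := q - 1) (by linarith) hε
    have hmono := integral_mono (μ := surf n)
      (f := fun θ : Sph n => c / 4 * (posPow (q - 2) (σ θ - ε) * ∑ j, u j θ ^ 2) -
        C₁ * (posPow q (σ θ - ε) * (∑ j, u j θ ^ 2 +
          ∑ i, ∑ j, ((pd j (u i) θ + pd i (u j) θ) / 2) ^ 2)))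
      (((iU (by linarith)).const_mul _).sub (Integrable.const_mul (by
        simp only [mul_add]; exact (iU (by linarith)).add iE) _))
      (?_ : Integrable (fun θ : Sph n => posPow (q - 1) (σ θ - ε) *
        ((∑ i, ∑ j, (pd j (u i) θ + pd i (u j) θ) * (u i θ * pd j σ θ)) +
          (∑ i, ∑ j, pd i (u i) θ * (u j θ * pd j σ θ)) +
          (∑ i, ∑ j, pd i (pd j σ) θ * (u i θ * u j θ)) +
          1 / 2 * ∑ i, ∑ j, pd i (pd i σ) θ * u j θ ^ 2) +
        (q - 1) * posPow (q - 1 - 1) (σ θ - ε) *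
          ((∑ j, u j θ * pd j σ θ) ^ 2 + 1 / 2 * (∑ j, u j θ ^ 2) * ∑ i, pd i σ θ ^ 2)) (surf n))
      ?_
    · rw [id1, integral_sub ((iU (by linarith)).const_mul _) (Integrable.const_mul (by
        simp only [mul_add]; exact (iU (by linarith)).add iE) _), integral_const_mul,
        integral_const_mul] at hmono
      rw [mul_assoc, div_mul_eq_mul_div, le_div_iff₀ hc]
      linarith
    · refine Integrable.add ?_ ?_
      · exact cont (g := fun x =>
          ((∑ i, ∑ j, (pd j (u i) x + pd i (u j) x) * (u i x * pd j σ x)) +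
          (∑ i, ∑ j, pd i (u i) x * (u j x * pd j σ x)) +
          (∑ i, ∑ j, pd i (pd j σ) x * (u i x * u j x)) +
          1 / 2 * ∑ i, ∑ j, pd i (pd i σ) x * u j x ^ 2)) (by linarith)
          fun x _ _ _ _ => by fun_prop
      · simp only [mul_assoc]
        refine Integrable.const_mul ?_ _
        exact cont (g := fun x => ((∑ j, u j x * pd j σ x) ^ 2 +
          1 / 2 * ((∑ j, u j x ^ 2) * ∑ i, pd i σ x ^ 2))) (by linarith)
          fun x _ _ _ _ => by fun_prop
    · intro θ
      rcases le_or_gt (σ θ - ε) 0 with h | h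
      · simp only [posPow_of_nonpos (show 0 < q by linarith) h,
          posPow_of_nonpos (show 0 < q - 1 by linarith) h,
          posPow_of_nonpos (show 0 < q - 2 by linarith) h,
          posPow_of_nonpos (show 0 < q - 1 - 1 by linarith) h]
        simp
      · have hT : max (σ θ - ε) 0 = σ θ - ε := max_eq_left h.le
        -- With T = σ − ε one has σ² ≤ 2T² + 2ε², so the lower bound 2c for |∇σ|² + σ² leaves at
        -- least 2c − 2ε² ≥ c.
        have hcθ : c ≤ ∑ i, pd i σ θ ^ 2 + 2 * max (σ θ - ε) 0 ^ 2 := by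
          rw [hT]
          nlinarith [hcb θ, sq_nonneg (σ θ - ε - ε)]
        have := mul_le_mul_of_nonneg_left (H₁ (max (σ θ - ε) 0) (le_max_right _ _) (fun i => u i θ)
          (fun i => pd i σ θ) (fun i j => pd j (u i) θ) (fun i j => pd i (pd j σ) θ) (hMb θ).1
          (hMb θ).2 hcθ) (posPow_nonneg (q - 2) (σ θ - ε))
        rw [show q - 1 - 1 = q - 2 by ring]
        simp only [w1, w2]
        linarith
  -- the Korn inequality
  have id2 := integral_korn_identity hσ hu hn (p := q) (by linarith) hε
  have iU2 := (iU (p := q - 2) (by linarith)).const_mul C₂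
  have iEA : Integrable (fun θ : Sph n => 2 * (posPow q (σ θ - ε) *
          ∑ i, ∑ j, ((pd j (u i) θ + pd i (u j) θ) / 2) ^ 2) -
        1 / 2 * (posPow q (σ θ - ε) * ∑ i, ∑ j, pd j (u i) θ ^ 2)) (surf n) :=
    (iE.const_mul _).sub (iA.const_mul _)
  have hmono := integral_mono (μ := surf n)
      (f := fun θ : Sph n => posPow q (σ θ - ε) * ((∑ i, ∑ j, pd j (u i) θ * pd i (u j) θ) -
          (∑ i, pd i (u i) θ) ^ 2) +
        q * posPow (q - 1) (σ θ - ε) *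
          ((∑ i, ∑ j, pd j (u i) θ * (u j θ * pd i σ θ)) -
            ∑ i, ∑ j, pd i (u i) θ * (u j θ * pd j σ θ)))
      (g := fun θ : Sph n => 2 * (posPow q (σ θ - ε) *
          ∑ i, ∑ j, ((pd j (u i) θ + pd i (u j) θ) / 2) ^ 2) -
        1 / 2 * (posPow q (σ θ - ε) * ∑ i, ∑ j, pd j (u i) θ ^ 2) +
        C₂ * (posPow (q - 2) (σ θ - ε) * ∑ j, u j θ ^ 2))
      ?_ (iEA.add iU2) ?_
  · rw [id2, integral_add iEA iU2,
      integral_sub (iE.const_mul _) (iA.const_mul _), integral_const_mul, integral_const_mul,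
      integral_const_mul] at hmono
    simp only [mul_neg, integral_neg] at hmono
    have hsplit : ∫ θ : Sph n, posPow q (σ θ - ε) * (∑ j, u j θ ^ 2 +
          ∑ i, ∑ j, ((pd j (u i) θ + pd i (u j) θ) / 2) ^ 2) ∂(surf n) =
        (∫ θ : Sph n, posPow q (σ θ - ε) * ∑ j, u j θ ^ 2 ∂(surf n)) +
        ∫ θ : Sph n, posPow q (σ θ - ε) *
          ∑ i, ∑ j, ((pd j (u i) θ + pd i (u j) θ) / 2) ^ 2 ∂(surf n) := by
      rw [← integral_add (iU (by linarith)) iE]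
      simp only [mul_add]
    have p1 : 0 ≤ ∫ θ : Sph n, posPow q (σ θ - ε) * ∑ j, u j θ ^ 2 ∂(surf n) :=
      integral_nonneg fun θ => mul_nonneg (posPow_nonneg _ _)
        (Finset.sum_nonneg fun _ _ => sq_nonneg _)
    have p2 : 0 ≤ ∫ θ : Sph n, posPow q (σ θ - ε) *
          ∑ i, ∑ j, ((pd j (u i) θ + pd i (u j) θ) / 2) ^ 2 ∂(surf n) :=
      integral_nonneg fun θ => mul_nonneg (posPow_nonneg _ _)
        (Finset.sum_nonneg fun _ _ => Finset.sum_nonneg fun _ _ => sq_nonneg _)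
    have hh := mul_le_mul_of_nonneg_left hardy hC₂
    have hn0 : (0 : ℝ) ≤ n := Nat.cast_nonneg n
    have p3 := mul_nonneg hn0 p2
    rw [hsplit] at hh ⊢
    linarith
  · refine Integrable.add ?_ ?_
    · exact cont (g := fun x => ((∑ i, ∑ j, pd j (u i) x * pd i (u j) x) -
          (∑ i, pd i (u i) x) ^ 2)) (by linarith) fun x _ _ _ _ => by fun_prop
    · simp only [mul_assoc]
      refine Integrable.const_mul ?_ _
      exact cont (g := fun x => ((∑ i, ∑ j, pd j (u i) x * (u j x * pd i σ x)) -
            ∑ i, ∑ j, pd i (u i) x * (u j x * pd j σ x))) (by linarith)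
          fun x _ _ _ _ => by fun_prop
  · intro θ
    have := mul_le_mul_of_nonneg_left (H₂ (max (σ θ - ε) 0) (le_max_right _ _) (fun i => u i θ)
          (fun i => pd i σ θ) (fun i j => pd j (u i) θ) (hMb θ).1)
          (posPow_nonneg (q - 2) (σ θ - ε))
    simp only [w1, w2]
    linarith

end korn

/-! ### Removing the truncation. -/

section korn

variable {n : ℕ} {σ : Eucl n → ℝ}

theorem posPow_mono {q s t : ℝ} (hq : 0 ≤ q) (h : s ≤ t) : posPow q s ≤ posPow q t :=
  Real.rpow_le_rpow (le_max_right _ _) (max_le_max_right 0 h) hq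

/-- Korn's inequality for the degenerate weight `σ₊ ^ q`. -/
theorem exists_korn_weighted (hσ : IsConicDefining σ) (hn : 1 ≤ n)
    (hreg : ∀ θ : Sph n, σ θ = 0 → ∃ i, pd i σ θ ≠ 0) {q : ℝ} (hq : 4 ≤ q) :
    ∃ C : ℝ, 0 ≤ C ∧ ∀ u, IsConicField σ u → ∀ G₁ G₂ : Sph n → ℝ,
      Integrable G₁ (surf n) → Integrable G₂ (surf n) →
      (∀ᵐ θ : Sph n ∂(surf n), posPow q (σ θ) * ∑ i, ∑ j, pd j (u i) θ ^ 2 ≤ G₁ θ) →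
      (∀ᵐ θ : Sph n ∂(surf n), posPow q (σ θ) * (∑ j, u j θ ^ 2 +
          ∑ i, ∑ j, ((pd j (u i) θ + pd i (u j) θ) / 2) ^ 2) ≤ G₂ θ) →
      Integrable (fun θ : Sph n => posPow q (σ θ) * ∑ i, ∑ j, pd j (u i) θ ^ 2) (surf n) ∧
      ∫ θ : Sph n, posPow q (σ θ) * ∑ i, ∑ j, pd j (u i) θ ^ 2 ∂(surf n) ≤
        C * ∫ θ, G₂ θ ∂(surf n) := by
  obtain ⟨C, ε₀, hC, hε₀, H⟩ := exists_korn_truncated hσ hn hreg hq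
  refine ⟨C, hC, ?_⟩
  intro u hu G₁ G₂ hG₁ hG₂ h₁ h₂
  have hq0 : 0 < q := by linarith
  set F : Sph n → ℝ := fun θ => ∑ i, ∑ j, pd j (u i) θ ^ 2 with hF
  have hF0 : ∀ θ, 0 ≤ F θ := fun θ =>
    Finset.sum_nonneg fun _ _ => Finset.sum_nonneg fun _ _ => sq_nonneg _
  -- The shift by 2 keeps ε m strictly below ε₀, even for m = 0.
  set ε : ℕ → ℝ := fun m => ε₀ / (m + 2) with hε
  have hεpos : ∀ m, 0 < ε m := fun m => by positivity
  have hεlt : ∀ m, ε m < ε₀ := fun m =>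
    div_lt_self hε₀ (by have : (0 : ℝ) ≤ m := Nat.cast_nonneg m; linarith)
  have hεlim : Tendsto ε atTop (𝓝 0) :=
    (tendsto_const_nhds (x := ε₀)).div_atTop
      (tendsto_natCast_atTop_atTop.atTop_add tendsto_const_nhds)
  have hmeas : ∀ m, AEStronglyMeasurable (fun θ : Sph n => posPow q (σ θ - ε m) * F θ) (surf n) :=
    fun m => (integrable_posPow_mul hσ hq0 (hεpos m)
      (g := fun x => ∑ i, ∑ j, pd j (u i) x ^ 2) fun x hx h => by
        have cA : ∀ i j, ContinuousAt (pd j (u i)) x := fun i j =>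
          (contDiffAt_pd (hu.smooth i x hx h) j).continuousAt
        fun_prop).aestronglyMeasurable
  have hlim : ∀ θ : Sph n, Tendsto (fun m => posPow q (σ θ - ε m) * F θ) atTop
      (𝓝 (posPow q (σ θ) * F θ)) := fun θ => by
    have h1 : Tendsto (fun m => σ θ - ε m) atTop (𝓝 (σ θ)) := by
      simpa using (tendsto_const_nhds (x := σ θ)).sub hεlim
    exact (((continuous_posPow hq0).tendsto _).comp h1).mul_const _
  have hbound : ∀ m (θ : Sph n), posPow q (σ θ - ε m) * F θ ≤ posPow q (σ θ) * F θ := fun m θ =>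
    mul_le_mul_of_nonneg_right (posPow_mono hq0.le (by linarith [hεpos m])) (hF0 θ)
  have hG : ∀ m, ∀ᵐ θ : Sph n ∂(surf n), ‖posPow q (σ θ - ε m) * F θ‖ ≤ G₁ θ := fun m => by
    filter_upwards [h₁] with θ hθ
    rw [Real.norm_of_nonneg (mul_nonneg (posPow_nonneg _ _) (hF0 θ))]
    exact (hbound m θ).trans hθ
  -- `G₁` serves only as a dominating function, expressing a priori finiteness; it does not enter
  -- the bound. Measurability is inherited from the truncated integrands.
  refine ⟨hG₁.mono' (aestronglyMeasurable_of_tendsto_ae atTop hmeas (Eventually.of_forall hlim))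
    ?_, ?_⟩
  · filter_upwards [h₁] with θ hθ
    rwa [Real.norm_of_nonneg (mul_nonneg (posPow_nonneg _ _) (hF0 θ))]
  · refine le_of_tendsto (tendsto_integral_of_dominated_convergence G₁ hmeas hG₁ hG
      (Eventually.of_forall hlim)) (Eventually.of_forall fun m => ?_)
    refine (H u hu (ε m) (hεpos m) (hεlt m)).trans (mul_le_mul_of_nonneg_left ?_ hC)
    have hE0 : ∀ θ : Sph n, 0 ≤ ∑ j, u j θ ^ 2 +
          ∑ i, ∑ j, ((pd j (u i) θ + pd i (u j) θ) / 2) ^ 2 := fun θ =>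
      add_nonneg (Finset.sum_nonneg fun _ _ => sq_nonneg _)
        (Finset.sum_nonneg fun _ _ => Finset.sum_nonneg fun _ _ => sq_nonneg _)
    refine integral_mono_of_nonneg (Eventually.of_forall fun θ =>
      mul_nonneg (posPow_nonneg _ _) (hE0 θ)) hG₂ ?_
    filter_upwards [h₂] with θ hθ
    exact (mul_le_mul_of_nonneg_right (posPow_mono hq0.le (by linarith [hεpos m])) (hE0 θ)).trans hθ

end korn

/-! ### Homogeneous extensions -/

section extension

variable {n : ℕ}

theorem hasFDerivAt_norm_inv_smul (θ : Sph n) :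
    HasFDerivAt (fun x : Eucl n => ‖x‖⁻¹ • x)
      (ContinuousLinearMap.id ℝ (Eucl n) - (innerSL ℝ (θ : Eucl n)).smulRight (θ : Eucl n))
      (θ : Eucl n) := by
  have hθ : ‖(θ : Eucl n)‖ = 1 := norm_eq_of_mem_sphere θ
  have h0 := (hasStrictFDerivAt_norm_sq (θ : Eucl n)).hasFDerivAt
  have h1 : HasFDerivAt (fun y : Eucl n => ‖y‖⁻¹) (-(innerSL ℝ (θ : Eucl n))) (θ : Eucl n) := by
    have h2 := h0.sqrt (by rw [hθ]; norm_num)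
    simp only [Real.sqrt_sq (norm_nonneg _)] at h2
    have h3 := (hasDerivAt_inv (x := ‖(θ : Eucl n)‖) (by rw [hθ]; norm_num)).comp_hasFDerivAt
      (θ : Eucl n) h2
    refine h3.congr_fderiv ?_
    rw [hθ, ← Nat.cast_smul_eq_nsmul ℝ]
    ext v
    simp
  refine (h1.smul (hasFDerivAt_id (θ : Eucl n))).congr_fderiv ?_
  ext v
  simp [hθ]
  ring

theorem hasFDerivAt_norm_sphere (θ : Sph n) :
    HasFDerivAt (fun x : Eucl n => ‖x‖) (innerSL ℝ (θ : Eucl n)) (θ : Eucl n) := by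
  have hθ : ‖(θ : Eucl n)‖ = 1 := norm_eq_of_mem_sphere θ
  have h2 := (hasStrictFDerivAt_norm_sq (θ : Eucl n)).hasFDerivAt.sqrt (by rw [hθ]; norm_num)
  simp only [Real.sqrt_sq (norm_nonneg _)] at h2
  refine h2.congr_fderiv ?_
  rw [hθ, ← Nat.cast_smul_eq_nsmul ℝ]
  ext v
  simp

theorem contDiffAt_norm_inv_smul {x : Eucl n} (hx : x ≠ 0) :
    ContDiffAt ℝ ∞ (fun x : Eucl n => ‖x‖⁻¹ • x) x :=
  ((contDiffAt_norm ℝ hx).inv (norm_ne_zero_iff.2 hx)).smul contDiffAt_id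

theorem norm_inv_smul_sphere (θ : Sph n) : ‖(θ : Eucl n)‖⁻¹ • (θ : Eucl n) = θ := by
  rw [norm_eq_of_mem_sphere θ, inv_one, one_smul]

theorem norm_inv_smul_smul {r : ℝ} (hr : 0 < r) (x : Eucl n) :
    ‖r • x‖⁻¹ • (r • x) = ‖x‖⁻¹ • x := by
  rw [norm_smul, Real.norm_of_nonneg hr.le, smul_smul]
  congr 1
  field_simp

theorem hasFDerivAt_comp_norm_inv_smul {F : Type*} [NormedAddCommGroup F] [NormedSpace ℝ F]
    {g : Eucl n → F} (θ : Sph n) (hg : DifferentiableAt ℝ g θ) :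
    HasFDerivAt (fun x : Eucl n => g (‖x‖⁻¹ • x))
      ((fderiv ℝ g θ).comp (ContinuousLinearMap.id ℝ (Eucl n) -
        (innerSL ℝ (θ : Eucl n)).smulRight (θ : Eucl n))) (θ : Eucl n) := by
  have h : HasFDerivAt g (fderiv ℝ g θ) (‖(θ : Eucl n)‖⁻¹ • (θ : Eucl n)) := by
    rw [norm_inv_smul_sphere]; exact hg.hasFDerivAt
  exact HasFDerivAt.comp (g := g) (f := fun x : Eucl n => ‖x‖⁻¹ • x) (θ : Eucl n) h
    (hasFDerivAt_norm_inv_smul θ)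

/-- The extension of a function on the sphere that is constant along rays. -/
noncomputable def conicExt (ρ : Eucl n → ℝ) (x : Eucl n) : ℝ := ρ (‖x‖⁻¹ • x)

/-- The components of the one-homogeneous extension of a vector field on the sphere. -/
noncomputable def conicField (X : Eucl n → Eucl n) (i : Fin n) (x : Eucl n) : ℝ :=
  ‖x‖ * X (‖x‖⁻¹ • x) i

theorem conicExt_sphere (ρ : Eucl n → ℝ) (θ : Sph n) : conicExt ρ θ = ρ θ := by
  rw [conicExt, norm_inv_smul_sphere]

theorem conicField_sphere (X : Eucl n → Eucl n) (i : Fin n) (θ : Sph n) :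
    conicField X i θ = X θ i := by
  rw [conicField, norm_inv_smul_sphere, norm_eq_of_mem_sphere, one_mul]

theorem isConicDefining_conicExt {ρ : Eucl n → ℝ} (hρ : ContDiff ℝ ∞ ρ) :
    IsConicDefining (conicExt ρ) where
  smooth x hx := hρ.contDiffAt.comp x (contDiffAt_norm_inv_smul hx)
  hom r hr x _ := by rw [conicExt, norm_inv_smul_smul hr, conicExt]

theorem pd_conicExt {ρ : Eucl n → ℝ} (hρ : ContDiff ℝ ∞ ρ) (θ : Sph n) (v : Eucl n) :
    fderiv ℝ (conicExt ρ) θ v = fderiv ℝ ρ θ (tanProj θ v) := by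
  have h : fderiv ℝ (conicExt ρ) θ = _ :=
    (hasFDerivAt_comp_norm_inv_smul θ (hρ.differentiable (by simp) _)).fderiv
  rw [h]
  simp [tanProj]

variable {lam : Sph n → ℝ} {ρ : Eucl n → ℝ}

theorem mem_coneOver_iff (hpos : ∀ x : Sph n, 0 < ρ x ↔ x ∈ domain lam) (y : Eucl n) :
    y ∈ coneOver lam ↔ y ≠ 0 ∧ 0 < conicExt ρ y := by
  constructor
  · rintro ⟨x, hx, r, hr, rfl⟩
    refine ⟨smul_ne_zero hr.ne' (ne_zero_of_mem_unit_sphere x), ?_⟩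
    rw [conicExt, norm_inv_smul_smul hr, norm_inv_smul_sphere]
    exact (hpos x).2 hx
  · rintro ⟨h0, h⟩
    have hy : 0 < ‖y‖ := norm_pos_iff.2 h0
    refine ⟨⟨‖y‖⁻¹ • y, by simp [norm_smul, hy.ne']⟩, (hpos _).1 h, ‖y‖, hy, ?_⟩
    simp [smul_smul, hy.ne']

theorem isOpen_coneOver (hρ : ContDiff ℝ ∞ ρ) (hpos : ∀ x : Sph n, 0 < ρ x ↔ x ∈ domain lam) :
    IsOpen (coneOver lam) := by
  rw [isOpen_iff_mem_nhds]
  intro x hx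
  rw [mem_coneOver_iff hpos] at hx
  filter_upwards [(isConicDefining_conicExt hρ).eventually_pos hx.1 hx.2] with y hy
  exact (mem_coneOver_iff hpos y).2 hy

theorem sphere_mem_coneOver {θ : Sph n} (hθ : θ ∈ domain lam) : (θ : Eucl n) ∈ coneOver lam :=
  ⟨θ, hθ, 1, one_pos, (one_smul ℝ _).symm⟩

theorem norm_inv_smul_mem_coneOver (hpos : ∀ x : Sph n, 0 < ρ x ↔ x ∈ domain lam) {x : Eucl n}
    (hx : x ≠ 0) (h : 0 < conicExt ρ x) : ‖x‖⁻¹ • x ∈ coneOver lam := by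
  have hr : 0 < ‖x‖⁻¹ := inv_pos.2 (norm_pos_iff.2 hx)
  rw [mem_coneOver_iff hpos]
  refine ⟨smul_ne_zero hr.ne' hx, ?_⟩
  rwa [conicExt, norm_inv_smul_smul hr]

theorem isConicField_conicField (hρ : ContDiff ℝ ∞ ρ)
    (hpos : ∀ x : Sph n, 0 < ρ x ↔ x ∈ domain lam) {f : Eucl n → ℝ} {X : Eucl n → Eucl n}
    (hX : IsSmoothField lam f X) : IsConicField (conicExt ρ) (conicField X) where
  smooth i x hx h := by
    have h1 : ContDiffAt ℝ ∞ X (‖x‖⁻¹ • x) := hX.smooth_par.contDiffAt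
      ((isOpen_coneOver hρ hpos).mem_nhds (norm_inv_smul_mem_coneOver hpos hx h))
    have h2 : ContDiffAt ℝ ∞ (fun x : Eucl n => X (‖x‖⁻¹ • x)) x :=
      ContDiffAt.comp (g := X) (f := fun x : Eucl n => ‖x‖⁻¹ • x) x h1 (contDiffAt_norm_inv_smul hx)
    exact (contDiffAt_norm ℝ hx).mul
      ((EuclideanSpace.proj (𝕜 := ℝ) i).contDiff.contDiffAt.comp x h2)
  hom i r hr x hx h := by
    rw [conicField, norm_inv_smul_smul hr, conicField, norm_smul, Real.norm_of_nonneg hr.le,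
      mul_assoc]
  tangent x hx h := by
    have hy : 0 < ‖x‖ := norm_pos_iff.2 hx
    have := hX.tangent ⟨‖x‖⁻¹ • x, by simp [norm_smul, hy.ne']⟩ ((hpos _).1 h)
    simp only [PiLp.inner_apply, PiLp.smul_apply, smul_eq_mul, RCLike.inner_apply, conj_trivial]
      at this
    calc ∑ i, x i * conicField X i x
        = ‖x‖ ^ 2 * ∑ i, X (‖x‖⁻¹ • x) i * (‖x‖⁻¹ * x i) := by
          rw [Finset.mul_sum]
          refine Finset.sum_congr rfl fun i _ => ?_
          rw [conicField]
          field_simp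
      _ = 0 := by rw [this, mul_zero]

theorem pd_conicField {f : Eucl n → ℝ} {X : Eucl n → Eucl n} (hρ : ContDiff ℝ ∞ ρ)
    (hpos : ∀ x : Sph n, 0 < ρ x ↔ x ∈ domain lam) (hX : IsSmoothField lam f X) {θ : Sph n}
    (hθ : θ ∈ domain lam) (i k : Fin n) :
    pd k (conicField X i) θ =
      (θ : Eucl n) k * X θ i + fderiv ℝ X θ (tanProj θ (stdVec k)) i := by
  have h1 : DifferentiableAt ℝ X θ := (hX.smooth_par.contDiffAt
      ((isOpen_coneOver hρ hpos).mem_nhds (sphere_mem_coneOver hθ))).differentiableAt (by simp)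
  have h2 := (EuclideanSpace.proj (𝕜 := ℝ) i).hasFDerivAt.comp (θ : Eucl n)
    (hasFDerivAt_comp_norm_inv_smul θ h1)
  have h3 := ((hasFDerivAt_norm_sphere θ).mul h2).fderiv
  change fderiv ℝ (conicField X i) θ = _ at h3
  rw [pd, h3]
  simp [stdVec, tanProj, EuclideanSpace.inner_single_right]
  ring

/-- The covariant derivative differs from the Euclidean gradient of the one-homogeneous extension by
an antisymmetric matrix, so both have the same symmetric part. This is the reason for choosing
degree one. -/
theorem dpar_jet {f : Eucl n → ℝ} {X : Eucl n → Eucl n} (hρ : ContDiff ℝ ∞ ρ)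
    (hpos : ∀ x : Sph n, 0 < ρ x ↔ x ∈ domain lam) (hX : IsSmoothField lam f X) {θ : Sph n}
    (hθ : θ ∈ domain lam) (i k : Fin n) :
    dpar (jet f X θ) i k = pd k (conicField X i) θ - (θ : Eucl n) k * X θ i +
      (θ : Eucl n) i * X θ k := by
  have hu := isConicField_conicField hρ hpos hX
  have h0 : 0 < conicExt ρ θ := by rw [conicExt_sphere]; exact (hpos θ).2 hθ
  have h1 := hu.sum_mul_pd' (isConicDefining_conicExt hρ) (ne_zero_of_mem_unit_sphere θ) h0 k
  have h2 := hX.tangent θ hθ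
  -- The normal component of the tangential derivative of X is −X, by differentiating tangency; it
  -- produces the term θ_i X_k when the derivative is projected.
  have h3 : ∑ j, (θ : Eucl n) j * fderiv ℝ X θ (tanProj θ (stdVec k)) j = -X θ k := by
    rw [← conicField_sphere X k θ, ← h1]
    simp only [pd_conicField hρ hpos hX hθ, mul_add, Finset.sum_add_distrib]
    simp only [PiLp.inner_apply, RCLike.inner_apply, conj_trivial] at h2
    have : ∑ i, (θ : Eucl n) i * ((θ : Eucl n) k * X θ i) =
        (θ : Eucl n) k * ∑ i, X θ i * (θ : Eucl n) i := by
      rw [Finset.mul_sum]; exact Finset.sum_congr rfl fun i _ => by ring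
    rw [this, h2, mul_zero, zero_add]
  have h4 : inner ℝ (θ : Eucl n) (fderiv ℝ X θ (tanProj θ (stdVec k))) = -X θ k := by
    rw [← h3, PiLp.inner_apply]
    exact Finset.sum_congr rfl fun i _ => by simp [mul_comm]
  have h5 : inner ℝ (stdVec i : Eucl n) (fderiv ℝ X θ (tanProj θ (stdVec k))) =
      fderiv ℝ X θ (tanProj θ (stdVec k)) i := by
    simp [stdVec, EuclideanSpace.inner_single_left]
  have h6 : inner ℝ (θ : Eucl n) (stdVec i) = (θ : Eucl n) i := by
    simp [stdVec, EuclideanSpace.inner_single_right]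
  change inner ℝ (tanProj (θ : Eucl n) (stdVec i)) (fderiv ℝ X θ (tanProj θ (stdVec k))) = _
  rw [pd_conicField hρ hpos hX hθ, tanProj, inner_sub_left, h5, inner_smul_left, h4, h6]
  simp

end extension

/-! ### The weighted measure -/

section chi

variable {n : ℕ} {lam : Sph n → ℝ} {P : ℝ}

theorem measurable_weight (hc : Continuous lam) (P : ℝ) :
    Measurable fun x => ENNReal.ofReal (lam x ^ (2 * P)) :=
  (hc.measurable.pow_const _).ennreal_ofReal

theorem integral_chi (hlam : IsLocalizationFunction lam) (F : Sph n → ℝ) :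
    ∫ x, F x ∂(chi lam P) = ∫ x, lam x ^ (2 * P) * F x ∂(surf n) := by
  rw [chi, integral_withDensity_eq_integral_toReal_smul (measurable_weight hlam.continuous P)
    (Eventually.of_forall fun _ => ENNReal.ofReal_lt_top)]
  refine integral_congr_ae (Eventually.of_forall fun x => ?_)
  simp [ENNReal.toReal_ofReal (Real.rpow_nonneg (hlam.nonneg x) _)]

theorem integrable_chi_iff (hlam : IsLocalizationFunction lam) (F : Sph n → ℝ) :
    Integrable F (chi lam P) ↔ Integrable (fun x => lam x ^ (2 * P) * F x) (surf n) := by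
  rw [chi, integrable_withDensity_iff_integrable_smul' (measurable_weight hlam.continuous P)
    (Eventually.of_forall fun _ => ENNReal.ofReal_lt_top)]
  refine integrable_congr (Eventually.of_forall fun x => ?_)
  simp [ENNReal.toReal_ofReal (Real.rpow_nonneg (hlam.nonneg x) _)]

theorem ae_chi_iff (hlam : IsLocalizationFunction lam) (hP : 0 < P) {p : Sph n → Prop} :
    (∀ᵐ x ∂(chi lam P), p x) ↔ ∀ᵐ x ∂(surf n), x ∈ domain lam → p x := by
  rw [chi, ae_withDensity_iff (measurable_weight hlam.continuous P)]
  refine eventually_congr (Eventually.of_forall fun x => ?_)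
  have : ENNReal.ofReal (lam x ^ (2 * P)) ≠ 0 ↔ x ∈ domain lam := by
    rw [Ne, ENNReal.ofReal_eq_zero, not_le]
    constructor
    · intro h
      refine lt_of_le_of_ne (hlam.nonneg x) fun h0 => ?_
      rw [← h0, Real.zero_rpow (by linarith)] at h
      exact lt_irrefl _ h
    · exact fun h => Real.rpow_pos_of_pos h _
  rw [this]

theorem ae_chi_domain (hlam : IsLocalizationFunction lam) (hP : 0 < P) :
    ∀ᵐ x ∂(chi lam P), x ∈ domain lam :=
  (ae_chi_iff hlam hP).2 (Eventually.of_forall fun _ h => h)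

theorem isFiniteMeasure_chi (hlam : IsLocalizationFunction lam) (hP : 0 < P) :
    IsFiniteMeasure (chi lam P) := by
  have h : Continuous fun x => lam x ^ (2 * P) :=
    hlam.continuous.rpow_const fun _ => Or.inr (by linarith)
  have := h.integrable_of_hasCompactSupport (μ := surf n) (HasCompactSupport.of_compactSpace _)
  exact isFiniteMeasure_withDensity_ofReal this.2

theorem chi_univ_pos (hlam : IsLocalizationFunction lam) (hP : 0 < P) (hn : 1 ≤ n) :
    0 < (chi lam P).real univ := by
  have := isFiniteMeasure_chi hlam hP
  have : Nonempty (Fin n) := ⟨⟨0, hn⟩⟩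
  rw [measureReal_def, ENNReal.toReal_pos_iff]
  refine ⟨?_, measure_lt_top _ _⟩
  rw [pos_iff_ne_zero]
  intro h0
  have h1 : ∀ᵐ x ∂(chi lam P), False := by
    rw [ae_iff]; simpa using h0
  rw [ae_chi_iff hlam hP] at h1
  have hopen : IsOpen (domain lam) := isOpen_lt continuous_const hlam.continuous
  have h2 : surf n (domain lam) = 0 := by
    rw [ae_iff] at h1
    simpa using h1
  exact (hopen.measure_pos (surf n) hlam.connected.nonempty).ne' h2

end chi

/-! ### Square-integrable jets -/

section jets

variable {n : ℕ} {μ : Measure (Sph n)}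

theorem memLp_coord (v : Lp (Jet n) 2 μ) (j : Unit ⊕ Fin n ⊕ Fin n ⊕ (Fin n × Fin n)) :
    MemLp (fun x => v x j) 2 μ :=
  (EuclideanSpace.proj (𝕜 := ℝ) j : Jet n →L[ℝ] ℝ).comp_memLp' (Lp.memLp v)

theorem memLp_perp (v : Lp (Jet n) 2 μ) : MemLp (fun x => perp (v x)) 2 μ := memLp_coord v _

theorem memLp_dperp (v : Lp (Jet n) 2 μ) (i : Fin n) : MemLp (fun x => dperp (v x) i) 2 μ :=
  memLp_coord v _

theorem memLp_par (v : Lp (Jet n) 2 μ) (i : Fin n) : MemLp (fun x => par (v x) i) 2 μ :=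
  memLp_coord v _

theorem memLp_dpar (v : Lp (Jet n) 2 μ) (i k : Fin n) : MemLp (fun x => dpar (v x) i k) 2 μ :=
  memLp_coord v _

theorem memLp_symPar (v : Lp (Jet n) 2 μ) (i k : Fin n) :
    MemLp (fun x => symPar (v x) i k) 2 μ := by
  have := ((memLp_dpar v i k).add (memLp_dpar v k i)).const_mul (1 / 2)
  refine this.congr_norm ?_ (Eventually.of_forall fun x => ?_)
  · exact (((memLp_dpar v i k).1.add (memLp_dpar v k i).1).const_mul (1 / 2)).congr
      (Eventually.of_forall fun x => by simp [symPar]; ring)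
  · simp only [symPar, Pi.add_apply]
    congr 1
    ring

theorem integrable_scalar (v : Lp (Jet n) 2 μ) :
    Integrable (fun x => perp (v x) ^ 2 + ∑ i, dperp (v x) i ^ 2) μ :=
  (memLp_perp v).integrable_sq.add (integrable_finsetSum _ fun i _ => (memLp_dperp v i).integrable_sq)

theorem integrable_par (v : Lp (Jet n) 2 μ) : Integrable (fun x => ∑ i, par (v x) i ^ 2) μ :=
  integrable_finsetSum _ fun i _ => (memLp_par v i).integrable_sq

theorem integrable_dpar (v : Lp (Jet n) 2 μ) :
    Integrable (fun x => ∑ i, ∑ k, dpar (v x) i k ^ 2) μ :=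
  integrable_finsetSum _ fun i _ => integrable_finsetSum _ fun k _ =>
    (memLp_dpar v i k).integrable_sq

theorem integrable_symPar (v : Lp (Jet n) 2 μ) :
    Integrable (fun x => ∑ i, ∑ k, symPar (v x) i k ^ 2) μ :=
  integrable_finsetSum _ fun i _ => integrable_finsetSum _ fun k _ =>
    (memLp_symPar v i k).integrable_sq

theorem norm_sq_jet (u : Jet n) : ‖u‖ ^ 2 =
    (perp u ^ 2 + ∑ i, dperp u i ^ 2) + ∑ i, par u i ^ 2 + ∑ i, ∑ k, dpar u i k ^ 2 := by
  rw [EuclideanSpace.real_norm_sq_eq]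
  simp only [Fintype.sum_sum_type, Fintype.sum_prod_type, perp, dperp, par, dpar]
  simp
  ring

theorem norm_sq_Lp (v : Lp (Jet n) 2 μ) : ‖v‖ ^ 2 =
    (∫ x, (perp (v x) ^ 2 + ∑ i, dperp (v x) i ^ 2) ∂μ) + (∫ x, ∑ i, par (v x) i ^ 2 ∂μ) +
      ∫ x, ∑ i, ∑ k, dpar (v x) i k ^ 2 ∂μ := by
  rw [← real_inner_self_eq_norm_sq, L2.inner_def]
  simp only [real_inner_self_eq_norm_sq, norm_sq_jet]
  have h : Integrable (fun x => (perp (v x) ^ 2 + ∑ i, dperp (v x) i ^ 2) +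
      ∑ i, par (v x) i ^ 2) μ := (integrable_scalar v).add (integrable_par v)
  rw [integral_add h (integrable_dpar v), integral_add (integrable_scalar v) (integrable_par v)]

/-- The linear map replacing the covariant derivative of a jet by its symmetric part. -/
noncomputable def symJet (n : ℕ) : Jet n →L[ℝ] Jet n :=
  LinearMap.toContinuousLinearMap
    { toFun := fun u => WithLp.toLp 2 (Sum.elim (fun _ => perp u) (Sum.elim (fun i => dperp u i)
        (Sum.elim (fun i => par u i) (fun q => symPar u q.1 q.2))))
      map_add' := fun u v => by
        ext (j | j | j | j) <;> simp [perp, dperp, par, symPar, dpar]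
        ring
      map_smul' := fun c u => by
        ext (j | j | j | j) <;> simp [perp, dperp, par, symPar, dpar]
        ring }

/-- The energy `‖ξ^⊥‖²_{H¹} + ‖ξ^∥‖²_{L²} + ‖Sym(∇ξ^∥)‖²_{L²}` of a square-integrable jet. -/
theorem norm_sq_symJet (v : Lp (Jet n) 2 μ) : ‖(symJet n).compLpL 2 μ v‖ ^ 2 =
    (∫ x, (perp (v x) ^ 2 + ∑ i, dperp (v x) i ^ 2) ∂μ) + (∫ x, ∑ i, par (v x) i ^ 2 ∂μ) +
      ∫ x, ∑ i, ∑ k, symPar (v x) i k ^ 2 ∂μ := by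
  rw [norm_sq_Lp]
  have h := (symJet n).coeFn_compLpL (p := 2) (μ := μ) v
  congr 1
  · congr 1
    · exact integral_congr_ae (h.mono fun x hx => by simp only [hx]; rfl)
    · exact integral_congr_ae (h.mono fun x hx => by simp only [hx]; rfl)
  · exact integral_congr_ae (h.mono fun x hx => by simp only [hx]; rfl)

end jets

/-! ### Korn's inequality on `H¹_{-P}(Λ)` -/

section H1

variable {n : ℕ} {lam : Sph n → ℝ} {P : ℝ}

/-- Linear vanishing makes λ^{2P} comparable to σ₊^{2P}, so Korn's inequality carries over from the
smooth weight function; P ≥ 2 is the condition q = 2P ≥ 4. -/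
theorem exists_korn_smooth (hlam : IsLocalizationFunction lam) (hn : 1 ≤ n) (hP : 2 ≤ P) :
    ∃ C, 0 ≤ C ∧ ∀ v : Lp (Jet n) 2 (chi lam P), (∃ f X, IsSmoothField lam f X ∧
      ∀ᵐ x ∂(chi lam P), v x = jet f X x) →
      ∫ x, ∑ i, ∑ k, dpar (v x) i k ^ 2 ∂(chi lam P) ≤
        C * ∫ x, (∑ i, par (v x) i ^ 2 + ∑ i, ∑ k, symPar (v x) i k ^ 2) ∂(chi lam P) := by
  obtain ⟨ρ, hρ, hpos, hgrad, c, C, hc, hC, hcomp⟩ := hlam.linear_vanishing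
  have hσ := isConicDefining_conicExt hρ
  have hq : (4 : ℝ) ≤ 2 * P := by linarith
  have hreg : ∀ θ : Sph n, conicExt ρ θ = 0 → ∃ i, pd i (conicExt ρ) θ ≠ 0 := by
    intro θ hθ
    rw [conicExt_sphere] at hθ
    obtain ⟨v, hv⟩ := hgrad θ hθ
    by_contra hne
    push Not at hne
    apply hv
    rw [← pd_conicExt hρ, fderiv_apply_eq_sum_pd]
    exact Finset.sum_eq_zero fun i _ => by rw [hne i, mul_zero]
  obtain ⟨K, hK, H⟩ := exists_korn_weighted hσ hn hreg hq
  set q : ℝ := 2 * P with hqdef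
  have hq0 : 0 < q := by linarith
  -- comparison of the weights
  have hw : ∀ θ : Sph n, c ^ q * posPow q (conicExt ρ θ) ≤ lam θ ^ q ∧
      lam θ ^ q ≤ C ^ q * posPow q (conicExt ρ θ) := by
    intro θ
    rw [conicExt_sphere]
    by_cases hθ : θ ∈ domain lam
    · have h1 := (hpos θ).2 hθ
      obtain ⟨h2, h3⟩ := hcomp θ hθ
      rw [posPow, max_eq_left h1.le, ← Real.mul_rpow hc.le h1.le, ← Real.mul_rpow hC.le h1.le]
      exact ⟨Real.rpow_le_rpow (by positivity) h2 hq0.le,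
        Real.rpow_le_rpow (hlam.nonneg θ) h3 hq0.le⟩
    · have h1 : lam θ = 0 := le_antisymm (not_lt.1 hθ) (hlam.nonneg θ)
      have h2 : ρ θ ≤ 0 := not_lt.1 fun h => hθ ((hpos θ).1 h)
      rw [posPow_of_nonpos hq0 h2, h1, Real.zero_rpow hq0.ne']
      simp
  have hcq : 0 < c ^ q := Real.rpow_pos_of_pos hc _
  have hCq : 0 < C ^ q := Real.rpow_pos_of_pos hC _
  have hw' : ∀ θ : Sph n, posPow q (conicExt ρ θ) ≤ (c ^ q)⁻¹ * lam θ ^ q := fun θ => by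
    rw [← div_eq_inv_mul, le_div_iff₀ hcq, mul_comm]
    exact (hw θ).1
  -- C^q and (c^q)⁻¹ come from comparing the weights in each direction. The 3 is from (x + y + z)² ≤
  -- 3(x² + y² + z²), and 6 = 3 + 3 from the two antisymmetric corrections, each summing to |ξ∥|²
  -- because |θ| = 1.
  refine ⟨3 * C ^ q * K * (c ^ q)⁻¹ + 6, by positivity, ?_⟩
  rintro v ⟨f, X, hX, hv⟩
  have hu := isConicField_conicField hρ hpos hX
  rw [ae_chi_iff hlam (by linarith)] at hv
  set u := conicField X with hudef
  -- pointwise comparison of the derivatives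
  have hone : ∀ θ : Sph n, ∑ i, (θ : Eucl n) i ^ 2 = 1 := by
    intro θ
    have h1 : ‖(θ : Eucl n)‖ ^ 2 = 1 := by simp
    rwa [EuclideanSpace.real_norm_sq_eq] at h1
  have hjet : ∀ θ : Sph n, θ ∈ domain lam → ∀ i k, dpar (jet f X θ) i k =
      pd k (u i) θ - (θ : Eucl n) k * u i θ + (θ : Eucl n) i * u k θ := fun θ hθ i k => by
    rw [dpar_jet hρ hpos hX hθ, hudef, conicField_sphere, conicField_sphere]
  have hpar : ∀ θ : Sph n, ∀ i, par (jet f X θ) i = u i θ := fun θ i => by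
    rw [hudef, conicField_sphere]; rfl
  have hsym : ∀ θ : Sph n, θ ∈ domain lam → ∀ i k, symPar (jet f X θ) i k =
      (pd k (u i) θ + pd i (u k) θ) / 2 := fun θ hθ i k => by
    rw [symPar, hjet θ hθ, hjet θ hθ]; ring
  -- Needed only to produce the integrable majorant `G₁`; the quantitative comparison is the reverse
  -- one, `hDle`.
  have hAle : ∀ θ : Sph n, θ ∈ domain lam → ∑ i, ∑ k, pd k (u i) θ ^ 2 ≤
      3 * (∑ i, ∑ k, dpar (jet f X θ) i k ^ 2) + 6 * ∑ i, par (jet f X θ) i ^ 2 := by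
    intro θ hθ
    calc ∑ i, ∑ k, pd k (u i) θ ^ 2
        ≤ ∑ i, ∑ k, (3 * dpar (jet f X θ) i k ^ 2 +
            3 * ((θ : Eucl n) k ^ 2 * par (jet f X θ) i ^ 2) +
            3 * ((θ : Eucl n) i ^ 2 * par (jet f X θ) k ^ 2)) := by
          refine Finset.sum_le_sum fun i _ => Finset.sum_le_sum fun k _ => ?_
          rw [hjet θ hθ, hpar, hpar]
          set x := pd k (u i) θ
          set y := (θ : Eucl n) k * u i θ with hy
          set z := (θ : Eucl n) i * u k θ with hz
          rw [← mul_pow, ← mul_pow, ← hy, ← hz]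
          nlinarith [sq_nonneg ((x - y + z) - y), sq_nonneg ((x - y + z) + z), sq_nonneg (y + z)]
      _ = _ := by
          simp only [Finset.sum_add_distrib, ← Finset.mul_sum, ← Finset.sum_mul, hone, one_mul]
          ring
  have hDle : ∀ θ : Sph n, θ ∈ domain lam → ∑ i, ∑ k, dpar (jet f X θ) i k ^ 2 ≤
      3 * (∑ i, ∑ k, pd k (u i) θ ^ 2) + 6 * ∑ i, par (jet f X θ) i ^ 2 := by
    intro θ hθ
    calc ∑ i, ∑ k, dpar (jet f X θ) i k ^ 2
        ≤ ∑ i, ∑ k, (3 * pd k (u i) θ ^ 2 +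
            3 * ((θ : Eucl n) k ^ 2 * par (jet f X θ) i ^ 2) +
            3 * ((θ : Eucl n) i ^ 2 * par (jet f X θ) k ^ 2)) := by
          refine Finset.sum_le_sum fun i _ => Finset.sum_le_sum fun k _ => ?_
          rw [hjet θ hθ, hpar, hpar]
          set x := pd k (u i) θ
          set y := (θ : Eucl n) k * u i θ with hy
          set z := (θ : Eucl n) i * u k θ with hz
          rw [← mul_pow, ← mul_pow, ← hy, ← hz]
          nlinarith [sq_nonneg (x + y), sq_nonneg (x - z), sq_nonneg (y + z)]
      _ = _ := by
          simp only [Finset.sum_add_distrib, ← Finset.mul_sum, ← Finset.sum_mul, hone, one_mul]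
          ring
  -- integrability
  have iD := (integrable_chi_iff hlam _).1 (integrable_dpar v)
  have iU := (integrable_chi_iff hlam _).1 (integrable_par v)
  have iS : Integrable (fun x => lam x ^ q * (∑ i, par (v x) i ^ 2 +
      ∑ i, ∑ k, symPar (v x) i k ^ 2)) (surf n) :=
    (integrable_chi_iff hlam _).1 ((integrable_par v).add (integrable_symPar v))
  have hzero : ∀ θ : Sph n, θ ∉ domain lam → lam θ ^ q = 0 ∧ posPow q (conicExt ρ θ) = 0 := by
    intro θ hθ
    have h1 : lam θ = 0 := le_antisymm (not_lt.1 hθ) (hlam.nonneg θ)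
    have h2 : ρ θ ≤ 0 := not_lt.1 fun h => hθ ((hpos θ).1 h)
    rw [conicExt_sphere, posPow_of_nonpos hq0 h2, h1, Real.zero_rpow hq0.ne']
    simp
  obtain ⟨iA, hA⟩ := H u hu
    (fun θ => (c ^ q)⁻¹ * (3 * (lam θ ^ q * ∑ i, ∑ k, dpar (v θ) i k ^ 2) +
      6 * (lam θ ^ q * ∑ i, par (v θ) i ^ 2)))
    (fun θ => (c ^ q)⁻¹ * (lam θ ^ q * (∑ i, par (v θ) i ^ 2 + ∑ i, ∑ k, symPar (v θ) i k ^ 2)))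
    (((iD.const_mul 3).add (iU.const_mul 6)).const_mul _) (iS.const_mul _)
    (by
      filter_upwards [hv] with θ hθ
      by_cases hd : θ ∈ domain lam
      · rw [hθ hd]
        have h0 : 0 ≤ ∑ i, ∑ j, pd j (u i) θ ^ 2 :=
          Finset.sum_nonneg fun _ _ => Finset.sum_nonneg fun _ _ => sq_nonneg _
        have hl : 0 ≤ (c ^ q)⁻¹ * lam θ ^ q :=
          mul_nonneg (inv_nonneg.2 hcq.le) (Real.rpow_nonneg (hlam.nonneg θ) _)
        calc _ ≤ (c ^ q)⁻¹ * lam θ ^ q * ∑ i, ∑ j, pd j (u i) θ ^ 2 :=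
              mul_le_mul_of_nonneg_right (hw' θ) h0
          _ ≤ _ := mul_le_mul_of_nonneg_left (hAle θ hd) hl
          _ = _ := by ring
      · rw [(hzero θ hd).1, (hzero θ hd).2]; simp)
    (by
      filter_upwards [hv] with θ hθ
      by_cases hd : θ ∈ domain lam
      · rw [hθ hd]
        simp only [hsym θ hd, hpar]
        rw [← mul_assoc]
        refine mul_le_mul_of_nonneg_right (hw' θ) (add_nonneg ?_ ?_)
        · exact Finset.sum_nonneg fun _ _ => sq_nonneg _
        · exact Finset.sum_nonneg fun _ _ => Finset.sum_nonneg fun _ _ => sq_nonneg _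
      · rw [(hzero θ hd).1, (hzero θ hd).2]; simp)
  have hfinal : ∫ x, lam x ^ q * ∑ i, ∑ k, dpar (v x) i k ^ 2 ∂(surf n) ≤
      ∫ x : Sph n, (3 * C ^ q * (posPow q (conicExt ρ x) * ∑ i, ∑ j, pd j (u i) x ^ 2) +
        6 * (lam x ^ q * (∑ i, par (v x) i ^ 2 + ∑ i, ∑ k, symPar (v x) i k ^ 2))) ∂(surf n) := by
    refine integral_mono_ae iD ((iA.const_mul _).add (iS.const_mul _)) ?_
    filter_upwards [hv] with θ hθ
    by_cases hd : θ ∈ domain lam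
    · simp only [hθ hd]
      have h0 : 0 ≤ ∑ i, ∑ j, pd j (u i) θ ^ 2 :=
          Finset.sum_nonneg fun _ _ => Finset.sum_nonneg fun _ _ => sq_nonneg _
      have hl : 0 ≤ lam θ ^ q := Real.rpow_nonneg (hlam.nonneg θ) _
      have hs : 0 ≤ ∑ i, ∑ k, symPar (jet f X θ) i k ^ 2 :=
          Finset.sum_nonneg fun _ _ => Finset.sum_nonneg fun _ _ => sq_nonneg _
      have h1 := mul_le_mul_of_nonneg_left (hDle θ hd) hl
      have h2 := mul_le_mul_of_nonneg_right (hw θ).2 h0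
      have h3 := mul_nonneg hl hs
      linarith
    · simp [(hzero θ hd).1, (hzero θ hd).2]
  rw [integral_add (iA.const_mul _) (iS.const_mul _), integral_const_mul, integral_const_mul]
    at hfinal
  rw [integral_chi hlam, integral_chi hlam]
  rw [integral_const_mul] at hA
  have h4 := mul_le_mul_of_nonneg_left hA (show 0 ≤ 3 * C ^ q by positivity)
  refine hfinal.trans ((add_le_add_left h4 _).trans (le_of_eq ?_))
  ring

theorem jet_add {f g : Eucl n → ℝ} {X Y : Eucl n → Eucl n} {θ : Sph n}
    (hf : DifferentiableAt ℝ f θ) (hg : DifferentiableAt ℝ g θ)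
    (hX : DifferentiableAt ℝ X θ) (hY : DifferentiableAt ℝ Y θ) :
    jet (f + g) (X + Y) θ = jet f X θ + jet g Y θ := by
  ext (j | j | j | j) <;> simp [jet, tanGrad, fderiv_add, hf, hg, hX, hY, inner_add_right]

theorem jet_smul (c : ℝ) {f : Eucl n → ℝ} {X : Eucl n → Eucl n} {θ : Sph n}
    (hf : DifferentiableAt ℝ f θ) (hX : DifferentiableAt ℝ X θ) :
    jet (c • f) (c • X) θ = c • jet f X θ := by
  ext (j | j | j | j) <;>
    simp [jet, tanGrad, fderiv_const_smul, hf, hX, inner_smul_right]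

theorem IsSmoothField.contDiffAt (hlam : IsLocalizationFunction lam) {f : Eucl n → ℝ}
    {X : Eucl n → Eucl n} (h : IsSmoothField lam f X) {θ : Sph n} (hθ : θ ∈ domain lam) :
    ContDiffAt ℝ ∞ f θ ∧ ContDiffAt ℝ ∞ X θ := by
  obtain ⟨ρ, hρ, hpos, -⟩ := hlam.linear_vanishing
  have := (isOpen_coneOver hρ hpos).mem_nhds (sphere_mem_coneOver hθ)
  exact ⟨h.smooth_perp.contDiffAt this, h.smooth_par.contDiffAt this⟩

/-- The square-integrable jets of smooth fields form a subspace. -/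
theorem span_smooth_jets (hlam : IsLocalizationFunction lam) (hP : 0 < P)
    {u : Lp (Jet n) 2 (chi lam P)}
    (hu : u ∈ Submodule.span ℝ {u : Lp (Jet n) 2 (chi lam P) | ∃ f X, IsSmoothField lam f X ∧
      ∀ᵐ x ∂(chi lam P), u x = jet f X x}) :
    ∃ f X, IsSmoothField lam f X ∧ ∀ᵐ x ∂(chi lam P), u x = jet f X x := by
  induction hu using Submodule.span_induction with
  | mem u hu => exact hu
  | zero =>
    refine ⟨0, 0, ⟨contDiffOn_const, contDiffOn_const, fun x _ => by simp⟩, ?_⟩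
    filter_upwards [Lp.coeFn_zero (Jet n) 2 (chi lam P)] with x hx
    rw [hx]
    ext (j | j | j | j) <;> simp [jet, tanGrad]
  | add u v _ _ hu hv =>
    obtain ⟨f, X, h1, h2⟩ := hu
    obtain ⟨g, Y, h3, h4⟩ := hv
    refine ⟨f + g, X + Y, ⟨h1.smooth_perp.add h3.smooth_perp, h1.smooth_par.add h3.smooth_par,
      fun x hx => by simp [inner_add_right, h1.tangent x hx, h3.tangent x hx]⟩, ?_⟩
    filter_upwards [h2, h4, Lp.coeFn_add u v, ae_chi_domain hlam hP] with x e1 e2 e3 hx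
    obtain ⟨d1, d2⟩ := h1.contDiffAt hlam hx
    obtain ⟨d3, d4⟩ := h3.contDiffAt hlam hx
    rw [e3, Pi.add_apply, e1, e2, jet_add (d1.differentiableAt (by simp))
      (d3.differentiableAt (by simp)) (d2.differentiableAt (by simp))
      (d4.differentiableAt (by simp))]
  | smul c u _ hu =>
    obtain ⟨f, X, h1, h2⟩ := hu
    refine ⟨c • f, c • X, ⟨contDiffOn_const.smul h1.smooth_perp,
      contDiffOn_const.smul h1.smooth_par,
      fun x hx => by simp [inner_smul_right, h1.tangent x hx]⟩, ?_⟩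
    filter_upwards [h2, Lp.coeFn_smul c u, ae_chi_domain hlam hP] with x e1 e3 hx
    obtain ⟨d1, d2⟩ := h1.contDiffAt hlam hx
    rw [e3, Pi.smul_apply, e1, jet_smul c (d1.differentiableAt (by simp))
      (d2.differentiableAt (by simp))]

/-- A closed property of jets that holds for smooth fields holds on `H¹_{-P}(Λ)`. -/
theorem H1_induction (hlam : IsLocalizationFunction lam) (hP : 0 < P)
    {p : Lp (Jet n) 2 (chi lam P) → Prop} (hp : IsClosed {u | p u})
    (h : ∀ u : Lp (Jet n) 2 (chi lam P), ∀ f X, IsSmoothField lam f X →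
      (∀ᵐ x ∂(chi lam P), u x = jet f X x) → p u) (ξ : H1 lam P) : p ξ.1 := by
  have hξ : ξ.1 ∈ closure (Submodule.span ℝ {u : Lp (Jet n) 2 (chi lam P) | ∃ f X,
    IsSmoothField lam f X ∧ ∀ᵐ x ∂(chi lam P), u x = jet f X x} : Set _) := ξ.2
  refine closure_minimal (fun u hu => ?_) hp hξ
  obtain ⟨f, X, h1, h2⟩ := span_smooth_jets hlam hP hu
  exact h u f X h1 h2

/-- Korn's inequality: on `H¹_{-P}(Λ)` the norm is controlled by the symmetric energy. -/
theorem exists_norm_sq_le_symEnergy (hlam : IsLocalizationFunction lam) (hn : 1 ≤ n)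
    (hP : 2 ≤ P) : ∃ C, 0 < C ∧ ∀ ξ : H1 lam P, ‖ξ‖ ^ 2 ≤ C * symEnergy lam P ξ := by
  obtain ⟨K, hK, H⟩ := exists_korn_smooth hlam hn hP
  have hE : ∀ ξ : H1 lam P, symEnergy lam P ξ =
      ‖(symJet n).compLpL 2 (chi lam P) ξ.1‖ ^ 2 := fun ξ => (norm_sq_symJet ξ.1).symm
  refine ⟨1 + K, by positivity, fun ξ => ?_⟩
  rw [hE]
  refine H1_induction hlam (by linarith) (p := fun u => ‖u‖ ^ 2 ≤
    (1 + K) * ‖(symJet n).compLpL 2 (chi lam P) u‖ ^ 2) ?_ ?_ ξ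
  · exact isClosed_le (by fun_prop) (by fun_prop)
  · intro u f X h1 h2
    have h := H u ⟨f, X, h1, h2⟩
    rw [integral_add (integrable_par u) (integrable_symPar u)] at h
    rw [norm_sq_Lp, norm_sq_symJet]
    have p1 : 0 ≤ ∫ x, (perp (u x) ^ 2 + ∑ i, dperp (u x) i ^ 2) ∂(chi lam P) :=
      integral_nonneg fun x => add_nonneg (sq_nonneg _) (Finset.sum_nonneg fun _ _ => sq_nonneg _)
    have p3 : 0 ≤ ∫ x, ∑ i, ∑ k, symPar (u x) i k ^ 2 ∂(chi lam P) :=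
      integral_nonneg fun x => Finset.sum_nonneg fun _ _ => Finset.sum_nonneg fun _ _ => sq_nonneg _
    have p4 := mul_nonneg hK p1
    linarith

end H1

/-! ### Bilinear forms that are coercive on the kernel of finitely many functionals -/

section abstract_form

variable {n : ℕ} {H : Type*} [NormedAddCommGroup H] [InnerProductSpace ℝ H]
  {B : H →L[ℝ] H →L[ℝ] ℝ} {L : Fin n → H →L[ℝ] ℝ} {e : Fin n → H} {κ γ : ℝ}

/-- The hypothesis says that the matrix L_l(e_k) is positive definite, though perhaps not symmetric.
It is therefore injective, hence surjective, and every vector differs from a combination of the e_k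
by an element of ⋂ ker L_l. -/
theorem exists_combination (hγ : 0 < γ)
    (hG : ∀ d : Fin n → ℝ, γ * ∑ l, d l ^ 2 ≤ ∑ l, d l * ∑ k, d k * L l (e k))
    (m : Fin n → ℝ) : ∃ d : Fin n → ℝ, ∀ l, L l (∑ k, d k • e k) = m l := by
  let T : (Fin n → ℝ) →ₗ[ℝ] (Fin n → ℝ) :=
    { toFun := fun d l => ∑ k, d k * L l (e k)
      map_add' := fun d d' => by ext l; simp [add_mul, Finset.sum_add_distrib]
      map_smul' := fun c d => by ext l; simp [Finset.mul_sum, mul_assoc] }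
  have hinj : Function.Injective T := by
    rw [← LinearMap.ker_eq_bot, LinearMap.ker_eq_bot']
    intro d hd
    have h := hG d
    have h0 : ∀ l, ∑ k, d k * L l (e k) = 0 := fun l => congrFun hd l
    simp only [h0, mul_zero, Finset.sum_const_zero] at h
    have h1 : ∑ l, d l ^ 2 = 0 := le_antisymm (by
      by_contra hpos
      exact absurd h (not_le.2 (mul_pos hγ (not_le.1 hpos))))
      (Finset.sum_nonneg fun _ _ => sq_nonneg _)
    ext l
    have := (Finset.sum_eq_zero_iff_of_nonneg fun i _ => sq_nonneg (d i)).1 h1 l (Finset.mem_univ l)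
    simpa using this
  obtain ⟨d, hd⟩ := LinearMap.injective_iff_surjective.1 hinj m
  exact ⟨d, fun l => by simpa [T] using congrFun hd l⟩

theorem eq_zero_of_coercive (hcoer : ∃ c > 0, ∀ ξ, (∀ l, L l ξ = 0) → c * ‖ξ‖ ^ 2 ≤ B ξ ξ) {ξ : H}
    (hL : ∀ l, L l ξ = 0) (hB : B ξ ξ = 0) : ξ = 0 := by
  obtain ⟨c, hc, h⟩ := hcoer
  have h1 := h ξ hL
  rw [hB] at h1
  have h2 : ‖ξ‖ ^ 2 ≤ 0 := by
    by_contra hpos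
    exact absurd h1 (not_le.2 (mul_pos hc (not_le.1 hpos)))
  simpa using h2

/-- Lax–Milgram on V = ⋂ ker L_l, after translation by a combination w of the e_k with moments m,
gives Bξ = φ on V. On the e_l the equation reads κ L_l ξ = κ m_l, which holds by the choice of
moments. -/
theorem exists_solution [CompleteSpace H] (hK : ∀ ξ l, B ξ (e l) = κ * L l ξ) (hγ : 0 < γ)
    (hG : ∀ d : Fin n → ℝ, γ * ∑ l, d l ^ 2 ≤ ∑ l, d l * ∑ k, d k * L l (e k))
    (hcoer : ∃ c > 0, ∀ ξ, (∀ l, L l ξ = 0) → c * ‖ξ‖ ^ 2 ≤ B ξ ξ) (φ : H →L[ℝ] ℝ)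
    (m : Fin n → ℝ) (hφ : ∀ l, φ (e l) = κ * m l) : ∃ ξ, B ξ = φ ∧ ∀ l, L l ξ = m l := by
  obtain ⟨d, hd⟩ := exists_combination hγ hG m
  set w := ∑ k, d k • e k with hw
  set V : Submodule ℝ H := (ContinuousLinearMap.pi L).ker with hV
  have memV : ∀ v, v ∈ V ↔ ∀ l, L l v = 0 := fun v => by
    rw [hV, LinearMap.mem_ker]
    exact ⟨fun h l => congrFun h l, fun h => funext h⟩
  have : CompleteSpace V := (ContinuousLinearMap.isClosed_ker (ContinuousLinearMap.pi L)).completeSpace_coe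
  set BV : V →L[ℝ] V →L[ℝ] ℝ := B.bilinearComp V.subtypeL V.subtypeL with hBV
  have hBVc : IsCoercive BV := by
    obtain ⟨c, hc, h⟩ := hcoer
    refine ⟨c, hc, fun v => ?_⟩
    have := h v ((memV v).1 v.2)
    rw [mul_assoc, ← pow_two]
    exact this
  set ψ : V →L[ℝ] ℝ := (φ - B w).comp V.subtypeL with hψ
  obtain ⟨v, hv⟩ := hBVc.continuousLinearEquivOfBilin.surjective
    ((InnerProductSpace.toDual ℝ V).symm ψ)
  have hsol : ∀ z : V, B v z = φ z - B w z := by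
    intro z
    have h1 := hBVc.continuousLinearEquivOfBilin_apply v z
    rw [hv, InnerProductSpace.toDual_symm_apply] at h1
    exact h1.symm
  have hLξ : ∀ l, L l (v + w) = m l := fun l => by
    rw [map_add, (memV v).1 v.2 l, hd, zero_add]
  refine ⟨v + w, ?_, hLξ⟩
  have he : ∀ l, B (v + w) (e l) = φ (e l) := fun l => by rw [hK, hLξ, hφ]
  ext z
  -- Decompose the test vector z along V and the span of e; the equation is already known on both
  -- pieces.
  obtain ⟨d', hd'⟩ := exists_combination hγ hG fun l => L l z
  have hz : z - ∑ k, d' k • e k ∈ V := (memV _).2 fun l => by rw [map_sub, hd', sub_self]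
  have h1 := hsol ⟨_, hz⟩
  have h2 : B (v + w) (∑ k, d' k • e k) = φ (∑ k, d' k • e k) := by
    simp only [map_sum, map_smul, he]
  have h3 : B (v + w) (z - ∑ k, d' k • e k) = φ (z - ∑ k, d' k • e k) := by
    rw [map_add, _root_.add_apply]
    simp only at h1
    rw [h1]
    ring
  rw [map_sub, map_sub, h2] at h3
  linarith

/-- Subtract from ρ the combination of the e_k with the same moments. The remainder r has zero
moments and B r r = 0, because ρ and all e_k annihilate every B ξ; coercivity then gives r = 0. -/
theorem coker_eq_span (hK : ∀ ξ l, B ξ (e l) = 0) (hγ : 0 < γ)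
    (hG : ∀ d : Fin n → ℝ, γ * ∑ l, d l ^ 2 ≤ ∑ l, d l * ∑ k, d k * L l (e k))
    (hcoer : ∃ c > 0, ∀ ξ, (∀ l, L l ξ = 0) → c * ‖ξ‖ ^ 2 ≤ B ξ ξ) :
    LinearMap.ker B.flip.toLinearMap = Submodule.span ℝ (range e) := by
  apply le_antisymm
  · intro ρ hρ
    have hρ' : ∀ ξ, B ξ ρ = 0 := fun ξ => by
      have : B.flip ρ = 0 := hρ
      rw [← B.flip_apply, this]; rfl
    obtain ⟨d, hd⟩ := exists_combination hγ hG fun l => L l ρ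
    have h0 : ρ - ∑ k, d k • e k = 0 := by
      refine eq_zero_of_coercive hcoer (fun l => by rw [map_sub, hd, sub_self]) ?_
      rw [map_sub, hρ', map_sum]
      simp [hK]
    rw [sub_eq_zero.1 h0]
    exact Submodule.sum_mem _ fun k _ => Submodule.smul_mem _ _ (Submodule.subset_span ⟨k, rfl⟩)
  · rw [Submodule.span_le]
    rintro _ ⟨l, rfl⟩
    change B.flip (e l) = 0
    ext ξ
    exact hK ξ l

theorem linearIndependent_of_moments (hγ : 0 < γ)
    (hG : ∀ d : Fin n → ℝ, γ * ∑ l, d l ^ 2 ≤ ∑ l, d l * ∑ k, d k * L l (e k)) :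
    LinearIndependent ℝ e := by
  rw [Fintype.linearIndependent_iff]
  intro d hd
  have h := hG d
  have h0 : ∀ l, ∑ k, d k * L l (e k) = 0 := fun l => by
    have := congrArg (L l) hd
    simpa using this
  simp only [h0, mul_zero, Finset.sum_const_zero] at h
  have h1 : ∑ l, d l ^ 2 = 0 := le_antisymm (by
    by_contra hpos
    exact absurd h (not_le.2 (mul_pos hγ (not_le.1 hpos))))
    (Finset.sum_nonneg fun _ _ => sq_nonneg _)
  intro l
  have := (Finset.sum_eq_zero_iff_of_nonneg fun i _ => sq_nonneg (d i)).1 h1 l (Finset.mem_univ l)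
  simpa using this

end abstract_form

/-! ### The fields `ξ^⋆` -/

section star

variable {n : ℕ}

theorem sum_sq_sphere (θ : Sph n) : ∑ i, (θ : Eucl n) i ^ 2 = 1 := by
  have h1 : ‖(θ : Eucl n)‖ ^ 2 = 1 := by simp
  rwa [EuclideanSpace.real_norm_sq_eq] at h1

theorem tanProj_stdVec_apply (x : Eucl n) (i l : Fin n) :
    tanProj x (stdVec i) l = (if i = l then 1 else 0) - x i * x l := by
  simp [tanProj, stdVec, EuclideanSpace.inner_single_right, eq_comm]

theorem fderiv_coord (x v : Eucl n) (l : Fin n) : fderiv ℝ (fun y : Eucl n => y l) x v = v l := by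
  have : HasFDerivAt (fun y : Eucl n => y l) (EuclideanSpace.proj (𝕜 := ℝ) l) x :=
    (EuclideanSpace.proj (𝕜 := ℝ) l).hasFDerivAt
  rw [this.fderiv]; simp

theorem tanGrad_coord (l : Fin n) :
    (tanGrad fun y : Eucl n => y l) = fun y => stdVec l - y l • y := by
  funext y
  ext i
  simp only [tanGrad, fderiv_coord, tanProj_stdVec_apply]
  simp [stdVec, mul_comm]

theorem inner_tanProj_stdVec (θ : Sph n) (i k : Fin n) :
    inner ℝ (tanProj (θ : Eucl n) (stdVec i)) (tanProj (θ : Eucl n) (stdVec k)) =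
      (if i = k then 1 else 0) - (θ : Eucl n) i * (θ : Eucl n) k := by
  have h : inner ℝ (θ : Eucl n) (θ : Eucl n) = 1 := by
    rw [real_inner_self_eq_norm_sq, norm_eq_of_mem_sphere, one_pow]
  simp only [tanProj, inner_sub_left, inner_sub_right, inner_smul_left, inner_smul_right, h]
  simp [stdVec, EuclideanSpace.inner_single_right, EuclideanSpace.inner_single_left]
  ring_nf
  simp only [eq_comm]

theorem inner_tanProj_self (θ : Sph n) (i : Fin n) :
    inner ℝ (tanProj (θ : Eucl n) (stdVec i)) (θ : Eucl n) = 0 := by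
  have h : inner ℝ (θ : Eucl n) (θ : Eucl n) = 1 := by
    rw [real_inner_self_eq_norm_sq, norm_eq_of_mem_sphere, one_pow]
  rw [tanProj, inner_sub_left, inner_smul_left, h, real_inner_comm]
  simp

/-- The jet of the field `ξ^{⋆(l)} = (x̂_l, ∇x̂_l)`. -/
noncomputable def starJet (l : Fin n) (θ : Sph n) : Jet n :=
  WithLp.toLp 2 (Sum.elim (fun _ => (θ : Eucl n) l)
    (Sum.elim (fun i => (if i = l then 1 else 0) - (θ : Eucl n) i * (θ : Eucl n) l)
    (Sum.elim (fun i => (if i = l then 1 else 0) - (θ : Eucl n) i * (θ : Eucl n) l)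
      (fun q => -(θ : Eucl n) l *
        ((if q.1 = q.2 then 1 else 0) - (θ : Eucl n) q.1 * (θ : Eucl n) q.2)))))

/-- The last block expresses Hess x̂_l = −x̂_l g. The values of the vector field off the sphere are
irrelevant, since only tangential derivatives enter the jet. -/
theorem jet_star (l : Fin n) (θ : Sph n) :
    jet (fun y => y l) (tanGrad fun y => y l) θ = starJet l θ := by
  have hd : ∀ v, fderiv ℝ (fun y : Eucl n => stdVec l - y l • y) θ v =
      -(v l • (θ : Eucl n) + (θ : Eucl n) l • v) := by
    intro v
    have h1 : HasFDerivAt (fun y : Eucl n => y l) (EuclideanSpace.proj (𝕜 := ℝ) l) (θ : Eucl n) :=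
      (EuclideanSpace.proj (𝕜 := ℝ) l).hasFDerivAt
    have h2 := ((h1.smul (hasFDerivAt_id (θ : Eucl n))).const_sub (stdVec l)).fderiv
    change fderiv ℝ (fun y : Eucl n => stdVec l - y l • y) θ = _ at h2
    rw [h2]
    simp [add_comm]
  rw [jet, starJet]
  congr 1
  ext (j | j | j | ⟨i, k⟩)
  · simp
  · simp only [Sum.elim_inr, Sum.elim_inl, tanGrad, fderiv_coord, tanProj_stdVec_apply]
  · simp only [Sum.elim_inr, Sum.elim_inl, tanGrad, fderiv_coord, tanProj_stdVec_apply]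
  · simp only [Sum.elim_inr, tanGrad_coord, hd, inner_neg_right, inner_add_right,
      inner_smul_right, inner_tanProj_self, inner_tanProj_stdVec]
    ring

theorem isSmoothField_star (lam : Sph n → ℝ) (l : Fin n) :
    IsSmoothField lam (fun y => y l) (tanGrad fun y => y l) where
  smooth_perp := by
    have : ContDiff ℝ ∞ fun y : Eucl n => y l := by fun_prop
    exact this.contDiffOn
  smooth_par := by
    rw [tanGrad_coord]
    have : ContDiff ℝ ∞ fun y : Eucl n => (stdVec l - y l • y : Eucl n) := by fun_prop
    exact this.contDiffOn
  tangent x _ := by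
    rw [tanGrad_coord, inner_sub_right, inner_smul_right, real_inner_self_eq_norm_sq,
      norm_eq_of_mem_sphere]
    simp [stdVec, EuclideanSpace.inner_single_right]

theorem continuous_starJet (l : Fin n) : Continuous (starJet l) := by
  refine (PiLp.continuous_toLp 2 _).comp (continuous_pi fun j => ?_)
  rcases j with j | j | j | j <;> simp only [Sum.elim_inl, Sum.elim_inr] <;> fun_prop

/-- The density of the functional `L^α_l`. -/
noncomputable def momentJet (α : ℝ) (l : Fin n) (θ : Sph n) : Jet n :=
  WithLp.toLp 2 (Sum.elim (fun _ => 2 * α * (θ : Eucl n) l)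
    (Sum.elim (fun i => if i = l then -1 else 0)
    (Sum.elim (fun i => if i = l then α + 1 else 0) (fun _ => 0))))

theorem continuous_momentJet (α : ℝ) (l : Fin n) : Continuous (momentJet α l) := by
  refine (PiLp.continuous_toLp 2 _).comp (continuous_pi fun j => ?_)
  rcases j with j | j | j | j <;> simp only [Sum.elim_inl, Sum.elim_inr] <;> fun_prop

theorem inner_momentJet (α : ℝ) (l : Fin n) (θ : Sph n) (u : Jet n) :
    inner ℝ (momentJet α l θ) u =
      (-dperp u l + 2 * α * (θ : Eucl n) l * perp u) + (α + 1) * par u l := by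
  rw [PiLp.inner_apply]
  simp [Fintype.sum_sum_type, momentJet, perp, dperp, par]
  ring

/-- The pointwise identity behind `⟨B^{λ,α}[ξ], ξ^{⋆(l)}⟩ = (a - α) L^α_l(ξ) / 2`. -/
theorem dens_starJet (a α : ℝ) (l : Fin n) (θ : Sph n) {u : Jet n}
    (h1 : ∑ i, (θ : Eucl n) i * dperp u i = 0) (h2 : ∑ i, (θ : Eucl n) i * par u i = 0)
    (h3 : ∀ k, ∑ i, (θ : Eucl n) i * dpar u i k = 0) :
    dens a α u (starJet l θ) = 1 / 2 * (a - α) * inner ℝ (momentJet α l θ) u := by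
  rw [inner_momentJet]
  have s0 : perp (starJet l θ) = (θ : Eucl n) l := rfl
  have s1 : ∀ i, dperp (starJet l θ) i =
      (if i = l then 1 else 0) - (θ : Eucl n) i * (θ : Eucl n) l := fun _ => rfl
  have s2 : ∀ i, par (starJet l θ) i =
      (if i = l then 1 else 0) - (θ : Eucl n) i * (θ : Eucl n) l := fun _ => rfl
  have s3 : ∀ i k, dpar (starJet l θ) i k = -(θ : Eucl n) l *
      ((if i = k then 1 else 0) - (θ : Eucl n) i * (θ : Eucl n) k) := fun _ _ => rfl
  have s4 : ∀ i k, symPar (starJet l θ) i k = -(θ : Eucl n) l *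
      ((if i = k then 1 else 0) - (θ : Eucl n) i * (θ : Eucl n) k) := fun i k => by
    rw [symPar, s3, s3]
    simp only [eq_comm (a := k) (b := i)]
    ring
  have e1 : ∀ w : Fin n → ℝ, ∑ i, (θ : Eucl n) i * w i = 0 →
      ∑ i, w i * ((if i = l then 1 else 0) - (θ : Eucl n) i * (θ : Eucl n) l) = w l := by
    intro w hw
    have : ∑ i, w i * ((θ : Eucl n) i * (θ : Eucl n) l) = 0 := by
      have : ∑ i, w i * ((θ : Eucl n) i * (θ : Eucl n) l) =
          (∑ i, (θ : Eucl n) i * w i) * (θ : Eucl n) l := by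
        rw [Finset.sum_mul]; exact Finset.sum_congr rfl fun i _ => by ring
      rw [this, hw, zero_mul]
    simp [mul_sub, Finset.sum_sub_distrib, this]
  have e2 : divPar (starJet l θ) = -(θ : Eucl n) l * (n - 1) := by
    simp only [divPar, s3, if_true, ← Finset.mul_sum, Finset.sum_sub_distrib, ← pow_two,
      sum_sq_sphere]
    simp
  -- Sym(∇ξ⋆∥) is −x̂_l times the tangential metric, so contracting with it amounts to taking the
  -- trace.
  have e3 : ∑ i, ∑ k, symPar u i k * symPar (starJet l θ) i k = -(θ : Eucl n) l * divPar u := by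
    have z1 : ∑ i, ∑ k, dpar u i k * ((θ : Eucl n) i * (θ : Eucl n) k) = 0 := by
      rw [Finset.sum_comm]
      refine Finset.sum_eq_zero fun k _ => ?_
      have : ∑ i, dpar u i k * ((θ : Eucl n) i * (θ : Eucl n) k) =
          (∑ i, (θ : Eucl n) i * dpar u i k) * (θ : Eucl n) k := by
        rw [Finset.sum_mul]; exact Finset.sum_congr rfl fun i _ => by ring
      rw [this, h3, zero_mul]
    have z2 : ∑ i, ∑ k, dpar u k i * ((θ : Eucl n) i * (θ : Eucl n) k) = 0 := by
      rw [Finset.sum_comm, ← z1]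
      exact Finset.sum_congr rfl fun i _ => Finset.sum_congr rfl fun k _ => by ring
    have z3 : ∑ i, ∑ k, symPar u i k * ((θ : Eucl n) i * (θ : Eucl n) k) = 0 := by
      have : ∑ i, ∑ k, symPar u i k * ((θ : Eucl n) i * (θ : Eucl n) k) =
          1 / 2 * (∑ i, ∑ k, dpar u i k * ((θ : Eucl n) i * (θ : Eucl n) k)) +
          1 / 2 * (∑ i, ∑ k, dpar u k i * ((θ : Eucl n) i * (θ : Eucl n) k)) := by
        simp only [Finset.mul_sum, ← Finset.sum_add_distrib]
        exact Finset.sum_congr rfl fun i _ => Finset.sum_congr rfl fun k _ => by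
          rw [symPar]; ring
      rw [this, z1, z2]
      ring
    have z4 : ∑ i, ∑ k, symPar u i k * (if i = k then 1 else 0) = divPar u := by
      simp [divPar, symPar]
    calc ∑ i, ∑ k, symPar u i k * symPar (starJet l θ) i k
        = -(θ : Eucl n) l * ((∑ i, ∑ k, symPar u i k * (if i = k then 1 else 0)) -
            ∑ i, ∑ k, symPar u i k * ((θ : Eucl n) i * (θ : Eucl n) k)) := by
          simp only [← Finset.sum_sub_distrib, Finset.mul_sum, s4]
          exact Finset.sum_congr rfl fun i _ => Finset.sum_congr rfl fun k _ => by ring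
      _ = _ := by rw [z3, z4, sub_zero]
  -- The coefficient n − 1 of B^{⊥⊥} cancels against div ξ⋆∥, and the two occurrences of div ξ∥
  -- cancel. What remains factors through a − α, since α(a − α) + a − α = (a − α)(α + 1).
  simp only [dens, densPerpPerp, densPerpPar, densParPerp, densParPar, s0, s1, s2, e2, e3,
    e1 _ h1, e1 _ h2]
  ring

theorem sum_smul_tanProj (θ : Sph n) :
    ∑ i, (θ : Eucl n) i • tanProj (θ : Eucl n) (stdVec i) = 0 := by
  ext l
  simp only [WithLp.ofLp_sum, Finset.sum_apply, PiLp.smul_apply, smul_eq_mul,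
    tanProj_stdVec_apply, mul_sub, Finset.sum_sub_distrib]
  have : ∑ i, (θ : Eucl n) i * ((θ : Eucl n) i * (θ : Eucl n) l) = (θ : Eucl n) l := by
    have h : ∑ i, (θ : Eucl n) i * ((θ : Eucl n) i * (θ : Eucl n) l) =
        (∑ i, (θ : Eucl n) i ^ 2) * (θ : Eucl n) l := by
      rw [Finset.sum_mul]; exact Finset.sum_congr rfl fun i _ => by ring
    rw [h, sum_sq_sphere, one_mul]
  rw [this]
  simp

/-- The tangency relations required by `dens_starJet` hold for jets of actual fields: X is tangent
on Λ, and the projection of θ to its own tangent space is zero. -/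
theorem dens_jet_starJet (a α : ℝ) {lam : Sph n → ℝ} {f : Eucl n → ℝ} {X : Eucl n → Eucl n}
    (hX : IsSmoothField lam f X) (l : Fin n) {θ : Sph n} (hθ : θ ∈ domain lam) :
    dens a α (jet f X θ) (starJet l θ) =
      1 / 2 * (a - α) * inner ℝ (momentJet α l θ) (jet f X θ) := by
  apply dens_starJet
  · have : ∑ i, (θ : Eucl n) i * dperp (jet f X θ) i =
        fderiv ℝ f θ (∑ i, (θ : Eucl n) i • tanProj (θ : Eucl n) (stdVec i)) := by
      rw [map_sum]
      exact Finset.sum_congr rfl fun i _ => by rw [map_smul]; rfl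
    rw [this, sum_smul_tanProj, map_zero]
  · have := hX.tangent θ hθ
    rw [PiLp.inner_apply] at this
    rw [← this]
    exact Finset.sum_congr rfl fun i _ => mul_comm _ _
  · intro k
    have : ∑ i, (θ : Eucl n) i * dpar (jet f X θ) i k =
        inner ℝ (∑ i, (θ : Eucl n) i • tanProj (θ : Eucl n) (stdVec i))
          (fderiv ℝ X θ (tanProj θ (stdVec k))) := by
      rw [sum_inner]
      exact Finset.sum_congr rfl fun i _ => by rw [inner_smul_left]; rfl
    rw [this, sum_smul_tanProj, inner_zero_left]

end star

/-! ### Kernel, cokernel and bijectivity in the abstract setting. -/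

section abstract_operator

variable {n : ℕ} {H : Type*} [NormedAddCommGroup H] [InnerProductSpace ℝ H] [CompleteSpace H]
  {B : H →L[ℝ] H →L[ℝ] ℝ} {L : Fin n → H →L[ℝ] ℝ} {e : Fin n → H} {κ γ : ℝ}

/-- When κ ≠ 0, the moments of a kernel element vanish on testing with e, so coercivity kills it;
conversely φ prescribes the moments of its preimage to be φ(e_l)/κ. -/
theorem bijective_of_coercive (hK : ∀ ξ l, B ξ (e l) = κ * L l ξ) (hκ : κ ≠ 0) (hγ : 0 < γ)
    (hG : ∀ d : Fin n → ℝ, γ * ∑ l, d l ^ 2 ≤ ∑ l, d l * ∑ k, d k * L l (e k))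
    (hcoer : ∃ c > 0, ∀ ξ, (∀ l, L l ξ = 0) → c * ‖ξ‖ ^ 2 ≤ B ξ ξ) :
    Function.Bijective B ∧ LinearMap.ker B.toLinearMap = ⊥ ∧
      LinearMap.ker B.flip.toLinearMap = ⊥ := by
  have hinj : ∀ ξ, B ξ = 0 → ξ = 0 := by
    intro ξ hξ
    refine eq_zero_of_coercive hcoer (fun l => ?_) (by rw [hξ]; rfl)
    have := hK ξ l
    rw [hξ] at this
    exact (mul_eq_zero.1 this.symm).resolve_left hκ
  have hsurj : ∀ φ, ∃ ξ, B ξ = φ := by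
    intro φ
    obtain ⟨ξ, h, -⟩ := exists_solution hK hγ hG hcoer φ (fun l => φ (e l) / κ)
      fun l => (mul_div_cancel₀ _ hκ).symm
    exact ⟨ξ, h⟩
  refine ⟨⟨(injective_iff_map_eq_zero _).2 hinj, hsurj⟩, ?_, ?_⟩
  · rw [eq_bot_iff]
    intro ξ hξ
    exact hinj ξ hξ
  · rw [eq_bot_iff]
    intro ρ hρ
    -- A cokernel element annihilates the range of B, which contains its own Riesz functional.
    obtain ⟨ξ, hξ⟩ := hsurj (innerSL ℝ ρ)
    have h1 : B.flip ρ = 0 := hρ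
    have h2 : B ξ ρ = 0 := by
      rw [← ContinuousLinearMap.flip_apply, h1]; rfl
    rw [hξ] at h2
    exact inner_self_eq_zero.1 h2

/-- For κ = 0 and φ = 0 the compatibility condition is void, so `exists_solution` yields kernel
elements with arbitrary moments. Coercivity makes the moments injective on the kernel, which gives
uniqueness and the spanning property. -/
theorem exists_normalized_family (hK : ∀ ξ l, B ξ (e l) = 0) (hγ : 0 < γ)
    (hG : ∀ d : Fin n → ℝ, γ * ∑ l, d l ^ 2 ≤ ∑ l, d l * ∑ k, d k * L l (e k))
    (hcoer : ∃ c > 0, ∀ ξ, (∀ l, L l ξ = 0) → c * ‖ξ‖ ^ 2 ≤ B ξ ξ) {η : ℝ} (hη : η ≠ 0) :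
    ∃ ξ : Fin n → H, (∀ j, B (ξ j) = 0 ∧ ∀ l, L l (ξ j) = if j = l then η else 0) ∧
      (∀ ξ' : Fin n → H, (∀ j, B (ξ' j) = 0 ∧ ∀ l, L l (ξ' j) = if j = l then η else 0) →
        ξ' = ξ) ∧ LinearIndependent ℝ ξ ∧
      LinearMap.ker B.toLinearMap = Submodule.span ℝ (Set.range ξ) := by
  have huniq : ∀ ξ, B ξ = 0 → (∀ l, L l ξ = 0) → ξ = 0 := fun ξ h1 h2 =>
    eq_zero_of_coercive hcoer h2 (by rw [h1]; rfl)
  choose ξ hξ using fun j : Fin n => exists_solution (κ := 0) (by simpa using hK) hγ hG hcoer 0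
    (fun l => if j = l then η else 0) (fun l => by simp)
  refine ⟨ξ, hξ, fun ξ' hξ' => ?_, ?_, le_antisymm (fun x hx => ?_) ?_⟩
  · funext j
    rw [← sub_eq_zero]
    refine huniq _ (by rw [map_sub, (hξ' j).1, (hξ j).1, sub_zero]) fun l => ?_
    rw [map_sub, (hξ' j).2, (hξ j).2, sub_self]
  · rw [Fintype.linearIndependent_iff]
    intro d hd l
    have := congrArg (L l) hd
    simpa [(hξ _).2, hη] using this
  · have hx0 : B x = 0 := hx
    have h0 : x - ∑ j, (L j x / η) • ξ j = 0 := by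
      refine huniq _ ?_ fun l => ?_
      · rw [map_sub, map_sum, hx0]
        simp [(hξ _).1]
      · rw [map_sub, map_sum]
        simp [(hξ _).2, hη]
    rw [sub_eq_zero.1 h0]
    exact Submodule.sum_mem _ fun k _ => Submodule.smul_mem _ _ (Submodule.subset_span ⟨k, rfl⟩)
  · rw [Submodule.span_le]
    rintro _ ⟨j, rfl⟩
    exact (hξ j).1

end abstract_operator

/-! ### The momentum operator tested against ξ⋆. -/

section main

variable {n : ℕ} {lam : Sph n → ℝ} {P : ℝ}

theorem memLp_of_continuous (hlam : IsLocalizationFunction lam) (hP : 0 < P) {g : Sph n → Jet n}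
    (hg : Continuous g) : MemLp g 2 (chi lam P) := by
  have := isFiniteMeasure_chi hlam hP
  exact hg.memLp_of_hasCompactSupport (HasCompactSupport.of_compactSpace _)

theorem exists_xiStar (hlam : IsLocalizationFunction lam) (hP : 0 < P) :
    ∃ ξ : Fin n → H1 lam P, (∀ l, IsXiStar l (ξ l)) ∧
      ∀ l, (ξ l).1 =ᵐ[chi lam P] starJet l := by
  have hmem := fun l => memLp_of_continuous hlam hP (continuous_starJet (n := n) l)
  have hae := fun l => (hmem l).coeFn_toLp
  have hjet : ∀ l, ∀ᵐ x ∂(chi lam P), (hmem l).toLp (starJet l) x =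
      jet (fun y => y l) (tanGrad fun y => y l) x := fun l => by
    filter_upwards [hae l] with x hx
    rw [hx, jet_star]
  refine ⟨fun l => ⟨(hmem l).toLp (starJet l), Submodule.le_topologicalClosure _
    (Submodule.subset_span ⟨_, _, isSmoothField_star lam l, hjet l⟩)⟩, hjet, hae⟩

/-- The functional `L^α_l` is continuous on `L²`, and is represented by `momentJet`. -/
theorem exists_moment_functional (hlam : IsLocalizationFunction lam) (hP : 0 < P) (α : ℝ) :
    ∃ L : Fin n → Lp (Jet n) 2 (chi lam P) →L[ℝ] ℝ,
      (∀ l v, L l v = ((chi lam P).real univ)⁻¹ *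
        ∫ x, inner ℝ (momentJet α l x) (v x) ∂(chi lam P)) ∧
      ∀ l (ξ : H1 lam P), moment lam P α ξ l = L l ξ.1 := by
  have := isFiniteMeasure_chi hlam hP
  have hmem := fun l => memLp_of_continuous hlam hP (continuous_momentJet (n := n) α l)
  have hL : ∀ l (v : Lp (Jet n) 2 (chi lam P)), inner ℝ ((hmem l).toLp (momentJet α l)) v =
      ∫ x, inner ℝ (momentJet α l x) (v x) ∂(chi lam P) := fun l v => by
    rw [L2.inner_def]
    exact integral_congr_ae ((hmem l).coeFn_toLp.mono fun x hx => by simp only [hx])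
  refine ⟨fun l => ((chi lam P).real univ)⁻¹ • innerSL ℝ ((hmem l).toLp (momentJet α l)),
    fun l v => ?_, fun l ξ => ?_⟩
  · rw [← hL]; rfl
  · change _ = ((chi lam P).real univ)⁻¹ * inner ℝ ((hmem l).toLp (momentJet α l)) ξ.1
    rw [hL]
    simp only [inner_momentJet]
    have i1 : Integrable (fun x => par (ξ.1 x) l) (chi lam P) :=
      (memLp_par ξ.1 l).integrable (by norm_num)
    have i2 : Integrable (fun x => dperp (ξ.1 x) l) (chi lam P) :=
      (memLp_dperp ξ.1 l).integrable (by norm_num)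
    have i3 : Integrable (fun x => perp (ξ.1 x)) (chi lam P) :=
      (memLp_perp ξ.1).integrable (by norm_num)
    have i4 : Integrable (fun x : Sph n => 2 * α * (x : Eucl n) l * perp (ξ.1 x)) (chi lam P) := by
      refine i3.bdd_mul (c := |2 * α|) (by
        exact (Continuous.aestronglyMeasurable (by fun_prop))) (Eventually.of_forall fun x => ?_)
      rw [norm_mul, Real.norm_eq_abs]
      have h1 := PiLp.norm_apply_le (x : Eucl n) l
      rw [norm_eq_of_mem_sphere] at h1
      exact mul_le_of_le_one_right (abs_nonneg _) h1
    have i5 : Integrable (fun x : Sph n => -dperp (ξ.1 x) l +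
        2 * α * (x : Eucl n) l * perp (ξ.1 x)) (chi lam P) := i2.neg.add i4
    rw [integral_add i5 (i1.const_mul _), integral_const_mul, moment, average_eq, average_eq,
      smul_eq_mul, smul_eq_mul]
    ring

/-- Both sides are continuous in ξ for the L² norm of jets, so it is enough to integrate the
pointwise identity for smooth fields. -/
theorem momentumOp_xiStar (hlam : IsLocalizationFunction lam) (hP : 0 < P) (a α : ℝ)
    {s : H1 lam P} {l : Fin n} (hs : s.1 =ᵐ[chi lam P] starJet l) (ξ : H1 lam P) :
    momentumOp lam P a α ξ s = 1 / 2 * (a - α) * moment lam P α ξ l := by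
  obtain ⟨L, hL, hmom⟩ := exists_moment_functional hlam hP α
  rw [hmom]
  refine H1_induction hlam hP (p := fun u => ((chi lam P).real univ)⁻¹ *
    (densBilin a α).lpPairing (chi lam P) 2 2 u s.1 = 1 / 2 * (a - α) * L l u) ?_ ?_ ξ
  · exact isClosed_eq (continuous_const.mul
      (((densBilin a α).lpPairing (chi lam P) 2 2).flip s.1).continuous)
      (continuous_const.mul (L l).continuous)
  · intro u f X hX hu
    have h : ∫ x, densBilin a α (u x) (s.1 x) ∂(chi lam P) =
        1 / 2 * (a - α) * ∫ x, inner ℝ (momentJet α l x) (u x) ∂(chi lam P) := by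
      rw [← integral_const_mul]
      refine integral_congr_ae ?_
      filter_upwards [hu, hs, ae_chi_domain hlam hP] with x h1 h2 h3
      rw [h1, h2]
      exact dens_jet_starJet a α hX l h3
    rw [ContinuousLinearMap.lpPairing_eq_integral, hL, h]
    ring

/-- The moments of ξ⋆(k) are α⟨δ_kl + x̂_k x̂_l⟩, and the rank-one part contributes α⟨(d · x̂)²⟩ ≥
0. -/
theorem moment_xiStar_posDef (hlam : IsLocalizationFunction lam) (hP : 0 < P) (hn : 1 ≤ n) {α : ℝ}
    (hα : 0 ≤ α) {s : Fin n → H1 lam P} (hs : ∀ l, (s l).1 =ᵐ[chi lam P] starJet l)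
    (d : Fin n → ℝ) :
    α * ∑ l, d l ^ 2 ≤ ∑ l, d l * ∑ k, d k * moment lam P α (s k) l := by
  have := isFiniteMeasure_chi hlam hP
  have hN := chi_univ_pos hlam hP hn
  obtain ⟨L, hL, hmom⟩ := exists_moment_functional hlam hP α
  set N := (chi lam P).real univ with hNdef
  have hpt : ∀ l k, ∀ θ : Sph n, inner ℝ (momentJet α l θ) (starJet k θ) =
      α * ((if l = k then 1 else 0) + (θ : Eucl n) l * (θ : Eucl n) k) := fun l k θ => by
    rw [inner_momentJet]
    simp only [starJet, perp, dperp, par, Sum.elim_inl, Sum.elim_inr]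
    ring
  have hint : ∀ l k, Integrable (fun θ : Sph n =>
      α * ((if l = k then 1 else 0) + (θ : Eucl n) l * (θ : Eucl n) k)) (chi lam P) := fun l k =>
    Continuous.integrable_of_hasCompactSupport (by fun_prop) (HasCompactSupport.of_compactSpace _)
  have hval : ∀ l k, moment lam P α (s k) l = N⁻¹ * ∫ θ : Sph n,
      α * ((if l = k then 1 else 0) + (θ : Eucl n) l * (θ : Eucl n) k) ∂(chi lam P) := fun l k => by
    rw [hmom, hL]
    congr 1
    exact integral_congr_ae ((hs k).mono fun θ hθ => by simp only [hθ, hpt])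
  have hsum : ∑ l, d l * ∑ k, d k * moment lam P α (s k) l =
      N⁻¹ * ∫ θ : Sph n, ∑ l, ∑ k, d l * d k *
        (α * ((if l = k then 1 else 0) + (θ : Eucl n) l * (θ : Eucl n) k)) ∂(chi lam P) := by
    rw [integral_finsetSum _ fun l _ => integrable_finsetSum _ fun k _ => (hint l k).const_mul _,
      Finset.mul_sum]
    refine Finset.sum_congr rfl fun l _ => ?_
    rw [integral_finsetSum _ fun k _ => (hint l k).const_mul _, Finset.mul_sum, Finset.mul_sum]
    refine Finset.sum_congr rfl fun k _ => ?_
    rw [hval, integral_const_mul (d l * d k)]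
    ring
  have hlow : N * (α * ∑ l, d l ^ 2) ≤ ∫ θ : Sph n, ∑ l, ∑ k, d l * d k *
        (α * ((if l = k then 1 else 0) + (θ : Eucl n) l * (θ : Eucl n) k)) ∂(chi lam P) := by
    have h0 : N * (α * ∑ l, d l ^ 2) = ∫ _θ : Sph n, α * ∑ l, d l ^ 2 ∂(chi lam P) := by
      rw [integral_const, smul_eq_mul]
    rw [h0]
    refine integral_mono (integrable_const _) (integrable_finsetSum _ fun l _ =>
      integrable_finsetSum _ fun k _ => (hint l k).const_mul _) fun θ => ?_
    have e : ∑ l, ∑ k, d l * d k *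
        (α * ((if l = k then 1 else 0) + (θ : Eucl n) l * (θ : Eucl n) k)) =
        α * ∑ l, d l ^ 2 + α * (∑ l, d l * (θ : Eucl n) l) ^ 2 := by
      rw [pow_two (∑ l, d l * (θ : Eucl n) l), Finset.sum_mul_sum, Finset.mul_sum, Finset.mul_sum,
        ← Finset.sum_add_distrib]
      refine Finset.sum_congr rfl fun l _ => ?_
      have h1 : α * d l ^ 2 = ∑ k, d l * d k * (α * (if l = k then 1 else 0)) := by
        simp
        ring
      rw [h1, Finset.mul_sum, ← Finset.sum_add_distrib]
      exact Finset.sum_congr rfl fun k _ => by ring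
    simp only [e]
    have : 0 ≤ α * (∑ l, d l * (θ : Eucl n) l) ^ 2 := by positivity
    linarith
  rw [hsum, ← div_eq_inv_mul, le_div_iff₀ hN, mul_comm]
  exact hlow

end main

end HarmonicMomentum

theorem mainTheorem10 (n : ℕ) (hn : 3 ≤ n) (p P a : ℝ) (hp : p ∈ Set.Ioo (0 : ℝ) (n - 2))
    (hP : 2 ≤ P) (ha : a = harmonicExponent n p) (lam : Sph n → ℝ)
    (hlam : IsLocalizationFunction lam) (hstab : HarmonicStability lam P a) :
    (∀ α ∈ Set.Ico (a / 2) a,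
      Function.Bijective (momentumOp lam P a α) ∧
        HarmonicMomentum.ker lam P a α = ⊥ ∧ coker lam P a α = ⊥) ∧
    Module.finrank ℝ (coker lam P a a) = n ∧
    Module.finrank ℝ (HarmonicMomentum.ker lam P a a) = n ∧
    (∃ ξstar : Fin n → H1 lam P, (∀ l, IsXiStar l (ξstar l)) ∧
      coker lam P a a = Submodule.span ℝ (Set.range ξstar)) ∧
    (∃ ξnorm : Fin n → H1 lam P, IsNormalizedFamily a ξnorm ∧
      (∀ ξ' : Fin n → H1 lam P, IsNormalizedFamily a ξ' → ξ' = ξnorm) ∧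
      LinearIndependent ℝ ξnorm ∧
      HarmonicMomentum.ker lam P a a = Submodule.span ℝ (Set.range ξnorm)) := by
  have hn1 : 1 ≤ n := by omega
  have hP0 : 0 < P := by linarith
  have ha0 : 0 < a := by
    rw [ha, harmonicExponent]
    have := hp.2
    linarith
  have hcomplete : CompleteSpace (H1 lam P) :=
    (Submodule.isClosed_topologicalClosure _).completeSpace_coe
  obtain ⟨s, hstar, hs⟩ := exists_xiStar (n := n) hlam hP0
  obtain ⟨C, hC, hKorn⟩ := exists_norm_sq_le_symEnergy hlam hn1 hP
  -- the moments as continuous functionals on `H¹`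
  have hfun : ∀ α : ℝ, ∃ L : Fin n → H1 lam P →L[ℝ] ℝ, ∀ l ξ, L l ξ = moment lam P α ξ l := by
    intro α
    obtain ⟨L, -, h⟩ := exists_moment_functional (n := n) hlam hP0 α
    exact ⟨fun l => (L l).comp (H1 lam P).subtypeL, fun l ξ => (h l ξ).symm⟩
  -- Korn's inequality upgrades the stability condition to coercivity in the full H¹ norm, at the
  -- cost of the factor 1/C.
  have hcoer : ∀ α ∈ Icc (a / 2) a, ∃ c > 0, ∀ ξ : H1 lam P,
      (∀ l, moment lam P α ξ l = 0) → c * ‖ξ‖ ^ 2 ≤ momentumOp lam P a α ξ ξ := by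
    intro α hα
    obtain ⟨c, hc, h⟩ := hstab α hα
    refine ⟨c / C, div_pos hc hC, fun ξ hξ => ?_⟩
    refine le_trans ?_ (h ξ hξ)
    rw [div_mul_eq_mul_div, div_le_iff₀ hC, mul_assoc, mul_comm _ C]
    exact mul_le_mul_of_nonneg_left (hKorn ξ) hc.le
  have hG := fun α (hα : 0 ≤ α) => moment_xiStar_posDef hlam hP0 hn1 hα hs
  have haI : a ∈ Icc (a / 2) a := ⟨by linarith, le_rfl⟩
  have hη : eta lam P ≠ 0 := by
    have hnon : Nonempty (Fin n) := ⟨⟨0, hn1⟩⟩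
    have h1 : (surf n).real univ ≠ 0 := by
      rw [Ne, measureReal_eq_zero_iff, Measure.measure_univ_eq_zero]
      exact Measure.toSphere_ne_zero (volume : Measure (Eucl n))
    have h2 : ((n : ℝ) - 1) ≠ 0 := by
      have : (3 : ℝ) ≤ n := by exact_mod_cast hn
      intro h
      linarith
    exact div_ne_zero (mul_ne_zero (mul_ne_zero two_ne_zero h2) h1) (chi_univ_pos hlam hP0 hn1).ne'
  obtain ⟨L, hL⟩ := hfun a
  have hKa : ∀ ξ l, momentumOp lam P a a ξ (s l) = 0 := fun ξ l => by
    rw [momentumOp_xiStar hlam hP0 a a (hs l) ξ]; ring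
  have hGa : ∀ d : Fin n → ℝ, a * ∑ l, d l ^ 2 ≤ ∑ l, d l * ∑ k, d k * L l (s k) := by
    simpa only [hL] using hG a ha0.le
  have hca : ∃ c > 0, ∀ ξ : H1 lam P, (∀ l, L l ξ = 0) →
      c * ‖ξ‖ ^ 2 ≤ momentumOp lam P a a ξ ξ := by
    simpa only [hL] using hcoer a haI
  have hcoker : coker lam P a a = Submodule.span ℝ (Set.range s) :=
    coker_eq_span hKa ha0 hGa hca
  have hslin : LinearIndependent ℝ s := linearIndependent_of_moments ha0 hGa
  obtain ⟨ξn, h1, h2, h3, h4⟩ := exists_normalized_family hKa ha0 hGa hca hη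
  have hker : HarmonicMomentum.ker lam P a a = Submodule.span ℝ (Set.range ξn) := h4
  refine ⟨fun α hα => ?_, ?_, ?_, ⟨s, hstar, hcoker⟩, ξn,
    fun j => ⟨(h1 j).1, fun l => by rw [← hL]; exact (h1 j).2 l⟩,
    fun ξ' hξ' => h2 ξ' fun j => ⟨(hξ' j).1, fun l => by rw [hL]; exact (hξ' j).2 l⟩, h3, hker⟩
  · obtain ⟨L', hL'⟩ := hfun α
    have hα0 : 0 < α := lt_of_lt_of_le (by linarith) hα.1
    have hK : ∀ ξ l, momentumOp lam P a α ξ (s l) = 1 / 2 * (a - α) * L' l ξ := fun ξ l => by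
      rw [hL']; exact momentumOp_xiStar hlam hP0 a α (hs l) ξ
    -- Here α < a is essential: at the endpoint this factor vanishes and the cokernel appears.
    have hκ : 1 / 2 * (a - α) ≠ 0 := (mul_pos one_half_pos (sub_pos.2 hα.2)).ne'
    exact bijective_of_coercive hK hκ hα0 (by simpa only [hL'] using hG α hα0.le)
      (by simpa only [hL'] using hcoer α ⟨hα.1, hα.2.le⟩)
  · rw [hcoker, finrank_span_eq_card hslin, Fintype.card_fin]
  · rw [hker, finrank_span_eq_card h3, Fintype.card_fin]
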